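/- Define the integers $a(n)$, $n\ge 1$, by $$\sum_{n=1}^{\infty} a(n)q^n=\phi(q):=\sum_{n=0}^{\infty}\frac{(-q;q)_{2n}\,q^{n+1}}{(q;q^2)_{n+1}^2},$$ where $(x;q)_0:=1$ and $(x;q)_n:=\prod_{k=0}^{n-1}(1-xq^k)$ for $n\ge 1$. Then, for every integer $n\ge 0$ and each $r\in\{1,3,4\}$, $$a(1250n+250r+219)\equiv 0\pmod{125}.$$ -/

import Mathlib

namespace RamanujanPhi

open PowerSeries
open scoped PowerSeries.WithPiTopology

/-- The finite `q`-shifted factorial `(a; q)_n = ∏_{0 ≤ k < n} (1 - a q ^ k)`. -/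
def qPoch {R : Type*} [CommRing R] (a q : R) (n : ℕ) : R :=
  ∏ k ∈ Finset.range n, (1 - a * q ^ k)

/-- The `n`-th summand `(-q; q)_{2n} q^{n+1} / (q; q^2)_{n+1}^2` of `φ(q)`, as a formal power
series in `q = X`. The denominator has constant coefficient `1`, and `invOfUnit _ 1` is its
multiplicative inverse in `ℤ⟦X⟧` (see `denom_mul_invOfUnit`). -/
noncomputable def phiTerm (n : ℕ) : PowerSeries ℤ :=
  qPoch (-X) X (2 * n) * X ^ (n + 1) * invOfUnit (qPoch X (X ^ 2) (n + 1) ^ 2) 1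

/-- The function `φ(q) = ∑_{n ≥ 0} (-q; q)_{2n} q^{n+1} / (q; q^2)_{n+1}^2`, as a formal power
series in `q`. The sum converges coefficientwise (see `hasSum_phiTerm`). -/
noncomputable def phi : PowerSeries ℤ := ∑' n : ℕ, phiTerm n

/-- The coefficients `a(n)` of `φ(q) = ∑ a(n) q^n`; here `a(0) = 0`. -/
noncomputable def a (n : ℕ) : ℤ := coeff n phi

theorem denom_mul_invOfUnit (n : ℕ) :
    qPoch (X : PowerSeries ℤ) (X ^ 2) (n + 1) ^ 2 *
      invOfUnit (qPoch (X : PowerSeries ℤ) (X ^ 2) (n + 1) ^ 2) 1 = 1 := by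
  apply mul_invOfUnit
  simp [qPoch, map_prod]

theorem coeff_phiTerm_of_le {m n : ℕ} (h : m ≤ n) : coeff m (phiTerm n) = 0 := by
  have hd : (X : PowerSeries ℤ) ^ (n + 1) ∣ phiTerm n :=
    ((Dvd.intro_left _ rfl : (X : PowerSeries ℤ) ^ (n + 1) ∣
      qPoch (-X) X (2 * n) * X ^ (n + 1))).mul_right _
  exact (X_pow_dvd_iff.mp hd) m (by omega)

theorem summable_phiTerm : Summable phiTerm := by
  refine ⟨PowerSeries.mk fun m => ∑ n ∈ Finset.range m, coeff m (phiTerm n), ?_⟩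
  rw [PowerSeries.WithPiTopology.hasSum_iff_hasSum_coeff]
  intro m
  rw [coeff_mk]
  apply hasSum_sum_of_ne_finset_zero
  intro n hn
  exact coeff_phiTerm_of_le (by simpa using hn)

theorem hasSum_phiTerm : HasSum phiTerm phi := summable_phiTerm.hasSum

/-- Each coefficient `a(m)` is a finite sum of coefficients of summands. -/
theorem a_eq_sum (m : ℕ) : a m = ∑ n ∈ Finset.range m, coeff m (phiTerm n) := by
  have h := ((PowerSeries.WithPiTopology.hasSum_iff_hasSum_coeff (R := ℤ)).mp hasSum_phiTerm) m
  refine h.unique (hasSum_sum_of_ne_finset_zero ?_)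
  intro n hn
  exact coeff_phiTerm_of_le (by simpa using hn)

open Filter Topology
open Finset.HasAntidiagonal (antidiagonal mem_antidiagonal)
open scoped Ring

/-!
Expanding `1 / (q; q²)_{n+1}²` in partial fractions and summing over `n` first turns
`φ(q) · ∑ (-1) ^ n q ^ (n ^ 2)` into an Appell–Lerch sum. Comparing it with a Lambert series shows
that the odd part of `φ` is an eta quotient: with `η_k = ∏ (1 - q ^ (k n))`,
`∑ a(2 n + 1) q ^ n = η₂⁸ / η₁⁷`.

Put `α = η₁⁵ / η₅` and `β = η₂⁵ / η₁₀`. Rewriting it all in Ramanujan's parameter `k = R(q) R(q²)²`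
gives the level ten identity `β = α + 5 g` with `g` an integral eta quotient. Since
`η₂⁸ / η₁⁷ = κ β / α²` for a further eta quotient `κ`, expanding in powers of `5 g` leaves only
`κ (β⁻¹ + 10 g β⁻² + 75 g² β⁻³)` modulo `125`.

As `219 = 2 (4 + 5 · 1 + 25 · 4) + 1`, one takes the components `4`, `1`, `4` of three successive
dissections modulo `5`, which are those of `∑ (-1) ^ n q ^ (n ^ 2)`, `η₁`, `η₁³` and `1 / η₁`. The
outcome is `50 η₅ η₁₀ η₂³` modulo `125`. In the next dissection the cube `η₂³` contributes no
component `3` or `4`, and its component `1` is divisible by `5`.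
-/

section FormalSums

variable {R ι : Type*} [CommRing R] [TopologicalSpace R] {f g : ι → R⟦X⟧} {S T : R⟦X⟧} {e : ι → ℕ}

theorem hasSum_coeff (h : HasSum f S) (d : ℕ) : HasSum (fun i => coeff d (f i)) (coeff d S) :=
  (WithPiTopology.hasSum_iff_hasSum_coeff (R := R)).mp h d

theorem X_pow_dvd_of_hasSum [T2Space R] {d : ℕ} (h : HasSum f S) (hf : ∀ i, X ^ d ∣ f i) :
    X ^ d ∣ S := by
  refine X_pow_dvd_iff.mpr fun m hm => (hasSum_coeff h m).unique ?_
  simpa only [X_pow_dvd_iff.mp (hf _) m hm] using hasSum_zero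

theorem summable_of_X_pow_dvd (he : Tendsto e cofinite atTop) (h : ∀ i, X ^ e i ∣ f i) :
    Summable f := by
  refine WithPiTopology.summable_iff_summable_coeff R |>.mpr fun d => ?_
  refine summable_of_hasFiniteSupport <| (eventually_cofinite.mp (he.eventually_gt_atTop d)).subset
    fun i hi hd => hi (X_pow_dvd_iff.mp (h i) d hd)

theorem tendsto_of_X_pow_dvd_sub {l : Filter ι} (he : Tendsto e l atTop)
    (h : ∀ i, X ^ e i ∣ f i - S) : Tendsto f l (𝓝 S) := by
  refine (WithPiTopology.tendsto_iff_coeff_tendsto R _ _ _).mpr fun d => ?_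
  refine tendsto_nhds_of_eventually_eq ((he.eventually_gt_atTop d).mono fun i hi => ?_)
  simpa only [map_sub, sub_eq_zero] using X_pow_dvd_iff.mp (h i) d hi

theorem X_pow_dvd_sub_of_tendsto [T2Space R] {F : ℕ → R⟦X⟧} {d : ℕ}
    (hF : Tendsto F atTop (𝓝 S)) (h : ∀ n, X ^ d ∣ F n - T) : X ^ d ∣ S - T := by
  refine X_pow_dvd_iff.mpr fun m hm => ?_
  rw [map_sub, sub_eq_zero]
  refine tendsto_nhds_unique ((WithPiTopology.tendsto_iff_coeff_tendsto R _ _ _).mp hF m)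
    (tendsto_const_nhds.congr fun n => ?_)
  exact (sub_eq_zero.mp (by simpa only [map_sub] using X_pow_dvd_iff.mp (h n) m hm)).symm

theorem tendsto_of_hasSum_of_X_pow_dvd_sub [IsTopologicalRing R] [T2Space R]
    {F : ℕ → ι → R⟦X⟧} {s : ℕ → R⟦X⟧} (hF : ∀ n, HasSum (F n) (s n)) (hg : HasSum g S)
    (h : ∀ n i, X ^ n ∣ F n i - g i) : Tendsto s atTop (𝓝 S) :=
  tendsto_of_X_pow_dvd_sub tendsto_id fun n => X_pow_dvd_of_hasSum ((hF n).sub hg) (h n)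

theorem continuous_of_continuous_coeff {A : Type*} [TopologicalSpace A] {F : A → R⟦X⟧}
    (h : ∀ d, Continuous fun x => coeff d (F x)) : Continuous F :=
  continuous_iff_continuousAt.mpr fun x =>
    (WithPiTopology.tendsto_iff_coeff_tendsto R _ _ _).mpr fun d => (h d).tendsto x

theorem continuous_expand {k : ℕ} (hk : k ≠ 0) :
    Continuous (expand k hk : R⟦X⟧ → R⟦X⟧) := by
  refine continuous_of_continuous_coeff fun d => ?_
  simp_rw [coeff_expand]
  split_ifs
  · exact WithPiTopology.continuous_coeff R _
  · exact continuous_const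

end FormalSums

section QPochhammer

theorem qPoch_succ {A : Type*} [CommRing A] (a q : A) (n : ℕ) :
    qPoch a q (n + 1) = qPoch a q n * (1 - a * q ^ n) :=
  Finset.prod_range_succ _ _

theorem qPoch_succ' {A : Type*} [CommRing A] (a q : A) (n : ℕ) :
    qPoch a q (n + 1) = (1 - a) * qPoch (a * q) q n := by
  rw [qPoch, Finset.prod_range_succ', mul_comm, pow_zero, mul_one, qPoch]
  exact congrArg _ (Finset.prod_congr rfl fun k _ => by ring)

theorem qPoch_mul_eq_prod {A : Type*} [CommRing A] (a q : A) (m n : ℕ) :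
    qPoch a q (m * n) = ∏ i ∈ Finset.range m, qPoch (a * q ^ i) (q ^ m) n := by
  induction n with
  | zero => simp [qPoch]
  | succ n ih =>
    simp_rw [qPoch_succ, Finset.prod_mul_distrib]
    rw [← ih, mul_add_one, qPoch, Finset.prod_range_add, qPoch]
    exact congrArg _ (Finset.prod_congr rfl fun i _ => by ring)

variable {R : Type*} [CommRing R]

theorem X_pow_dvd_qPoch_sub {q : R⟦X⟧} (hq : X ∣ q) (a : R⟦X⟧) {m n : ℕ} (hmn : m ≤ n) :
    X ^ m ∣ qPoch a q n - qPoch a q m := by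
  induction n, hmn using Nat.le_induction with
  | base => simp
  | succ n hmn ih =>
    have hstep : X ^ m ∣ qPoch a q n * (a * q ^ n) :=
      ((((pow_dvd_pow X hmn).trans (pow_dvd_pow_of_dvd hq n)).mul_left a).mul_left _)
    rw [qPoch_succ, show qPoch a q n * (1 - a * q ^ n) - qPoch a q m =
      qPoch a q n - qPoch a q m - qPoch a q n * (a * q ^ n) by ring]
    exact dvd_sub ih hstep

variable [TopologicalSpace R]

/-- The infinite `q`-shifted factorial `(a; q)_∞`. The product converges when `X ∣ q`. -/
noncomputable def qPochInf (a q : R⟦X⟧) : R⟦X⟧ :=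
  ∏' k : ℕ, (1 - a * q ^ k)

variable {q : R⟦X⟧}

theorem tendsto_qPoch (a : R⟦X⟧) (hq : X ∣ q) :
    Tendsto (qPoch a q) atTop (𝓝 (qPochInf a q)) := by
  have horder : Tendsto (fun k => (-(a * q ^ k)).order) atTop (𝓝 ⊤) := by
    refine ENat.tendsto_nhds_top_iff_natCast_lt.mpr fun n => ?_
    filter_upwards [eventually_gt_atTop n] with k hk
    refine (Nat.cast_lt.mpr hk).trans_le (nat_le_order _ _ fun i hi => ?_)
    exact X_pow_dvd_iff.mp (((pow_dvd_pow_of_dvd hq k).mul_left a).neg_right) i hi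
  have h := WithPiTopology.multipliable_one_add_of_tendsto_order_atTop_nhds_top R horder
  simp_rw [← sub_eq_add_neg] at h
  exact h.hasProd.tendsto_prod_nat

theorem map_qPochInf {S : Type*} [CommRing S] [TopologicalSpace S] [T2Space S]
    (F : R⟦X⟧ →+* S⟦X⟧) (hF : Continuous F) (a : R⟦X⟧) (hq : X ∣ q) (hFq : X ∣ F q) :
    F (qPochInf a q) = qPochInf (F a) (F q) := by
  refine tendsto_nhds_unique ((hF.tendsto _).comp (tendsto_qPoch a hq))
    ((tendsto_qPoch (F a) hFq).congr fun n => ?_)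
  simp [qPoch, map_prod]

variable [T2Space R]

theorem X_pow_dvd_qPochInf_sub (a : R⟦X⟧) (hq : X ∣ q) (n : ℕ) :
    X ^ n ∣ qPochInf a q - qPoch a q n :=
  X_pow_dvd_sub_of_tendsto ((tendsto_add_atTop_iff_nat n).mpr (tendsto_qPoch a hq)) fun m =>
    X_pow_dvd_qPoch_sub hq a (Nat.le_add_left n m)

theorem constantCoeff_qPochInf {a : R⟦X⟧} (ha : X ∣ a) (hq : X ∣ q) :
    constantCoeff (qPochInf a q) = 1 := by
  have h : X ∣ qPochInf a q - (1 - a) := by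
    simpa [qPoch] using X_pow_dvd_qPochInf_sub a hq 1
  have h0 := X_dvd_iff.mp ha
  rw [X_dvd_iff] at h
  simpa [h0, sub_eq_zero] using h

theorem isUnit_qPochInf {a : R⟦X⟧} (ha : X ∣ a) (hq : X ∣ q) : IsUnit (qPochInf a q) :=
  isUnit_iff_constantCoeff.mpr (by simp [constantCoeff_qPochInf ha hq])

variable [IsTopologicalRing R]

theorem qPochInf_eq_mul (a : R⟦X⟧) (hq : X ∣ q) :
    qPochInf a q = (1 - a) * qPochInf (a * q) q := by
  refine tendsto_nhds_unique ((tendsto_add_atTop_iff_nat 1).mpr (tendsto_qPoch a hq)) ?_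
  simp_rw [qPoch_succ']
  exact (tendsto_qPoch (a * q) hq).const_mul _

theorem qPochInf_eq_prod (a : R⟦X⟧) (hq : X ∣ q) {m : ℕ} (hm : m ≠ 0) :
    qPochInf a q = ∏ i ∈ Finset.range m, qPochInf (a * q ^ i) (q ^ m) := by
  refine tendsto_nhds_unique ((tendsto_qPoch a hq).comp
    (tendsto_id.const_mul_atTop' (Nat.pos_of_ne_zero hm))) ?_
  refine (tendsto_finsetProd (Finset.range m) fun i _ =>
    tendsto_qPoch (a * q ^ i) (hq.trans (dvd_pow_self q hm))).congr fun n => ?_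
  exact (qPoch_mul_eq_prod a q m n).symm

theorem qPochInf_mul_qPochInf_neg (a : R⟦X⟧) (hq : X ∣ q) :
    qPochInf a q * qPochInf (-a) q = qPochInf (a ^ 2) (q ^ 2) := by
  refine tendsto_nhds_unique ((tendsto_qPoch a hq).mul (tendsto_qPoch (-a) hq)) ?_
  refine (tendsto_qPoch (a ^ 2) (hq.trans (dvd_pow_self q two_ne_zero))).congr fun n => ?_
  simp only [qPoch, ← Finset.prod_mul_distrib]
  exact Finset.prod_congr rfl fun k _ => by ring

end QPochhammer

section GaussBinom

variable {A : Type*} [CommRing A]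

/-- The Gaussian binomial coefficient with base `q`, defined by the `q`-Pascal recurrence so that
it makes sense in every commutative ring. -/
def gaussBinom (q : A) : ℕ → ℕ → A
  | _, 0 => 1
  | 0, _ + 1 => 0
  | n + 1, k + 1 => gaussBinom q n k + q ^ (k + 1) * gaussBinom q n (k + 1)

@[simp]
theorem gaussBinom_zero_right (q : A) (n : ℕ) : gaussBinom q n 0 = 1 := by
  cases n <;> rfl

theorem gaussBinom_succ_succ (q : A) (n k : ℕ) :
    gaussBinom q (n + 1) (k + 1) = gaussBinom q n k + q ^ (k + 1) * gaussBinom q n (k + 1) :=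
  rfl

theorem gaussBinom_eq_zero_of_lt (q : A) {n k : ℕ} (h : n < k) : gaussBinom q n k = 0 := by
  induction n generalizing k with
  | zero => obtain ⟨k, rfl⟩ := Nat.exists_eq_add_one_of_ne_zero h.ne'; rfl
  | succ n ih =>
    obtain ⟨k, rfl⟩ := Nat.exists_eq_add_one_of_ne_zero h.ne_bot
    rw [gaussBinom_succ_succ, ih (by omega), ih (by omega), mul_zero, add_zero]

theorem gaussBinom_succ_succ' (q : A) {n k : ℕ} (h : k ≤ n) :
    gaussBinom q (n + 1) (k + 1) = q ^ (n - k) * gaussBinom q n k + gaussBinom q n (k + 1) := by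
  induction n generalizing k with
  | zero => obtain rfl : k = 0 := by omega
            simp [gaussBinom]
  | succ n ih =>
    rcases h.eq_or_lt with rfl | hlt
    · simp [gaussBinom_succ_succ q (n + 1), gaussBinom_eq_zero_of_lt q (Nat.lt_succ_self _)]
    obtain ⟨m, rfl⟩ := Nat.exists_eq_add_of_le (Nat.lt_succ_iff.mp hlt)
    rcases k with _ | k
    · have h₀ := ih (Nat.zero_le (0 + m))
      have p₀ := gaussBinom_succ_succ q (0 + m) 0
      rw [gaussBinom_succ_succ]
      simp only [gaussBinom_zero_right, Nat.zero_add, Nat.sub_zero] at h₀ p₀ ⊢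
      linear_combination q * h₀ - p₀
    · have h₀ := ih (show k ≤ k + 1 + m by omega)
      have h₁ := ih (show k + 1 ≤ k + 1 + m by omega)
      have p₀ := gaussBinom_succ_succ q (k + 1 + m) k
      have p₁ := gaussBinom_succ_succ q (k + 1 + m) (k + 1)
      rw [gaussBinom_succ_succ]
      simp only [show k + 1 + m + 1 - (k + 1) = m + 1 by omega, Nat.add_sub_cancel_left,
        show k + 1 + m - k = m + 1 by omega] at h₀ h₁ ⊢
      linear_combination h₀ + q ^ (k + 2) * h₁ - q ^ (m + 1) * p₀ - p₁

theorem sum_range_gaussBinom_succ (q : A) (n : ℕ) (f : ℕ → A) :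
    ∑ k ∈ Finset.range (n + 2), gaussBinom q (n + 1) k * f k =
      ∑ k ∈ Finset.range (n + 1), gaussBinom q n k * (q ^ k * f k + f (k + 1)) := by
  have htop : ∑ k ∈ Finset.range (n + 2), gaussBinom q n k * (q ^ k * f k) =
      ∑ k ∈ Finset.range (n + 1), gaussBinom q n k * (q ^ k * f k) := by
    rw [Finset.sum_range_succ, gaussBinom_eq_zero_of_lt q n.lt_succ_self, zero_mul, add_zero]
  have hpascal : ∑ k ∈ Finset.range (n + 1), gaussBinom q (n + 1) (k + 1) * f (k + 1) =
      ∑ k ∈ Finset.range (n + 1),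
        (gaussBinom q n k * f (k + 1) + gaussBinom q n (k + 1) * (q ^ (k + 1) * f (k + 1))) :=
    Finset.sum_congr rfl fun k _ => by rw [gaussBinom_succ_succ]; ring
  rw [Finset.sum_range_succ'] at htop ⊢
  simp only [hpascal, gaussBinom_zero_right, mul_add, Finset.sum_add_distrib, ← htop]
  ring

theorem sum_range_gaussBinom_succ' (q : A) (n : ℕ) (f : ℕ → A) :
    ∑ k ∈ Finset.range (n + 2), gaussBinom q (n + 1) k * f k =
      ∑ k ∈ Finset.range (n + 1), gaussBinom q n k * (f k + q ^ (n - k) * f (k + 1)) := by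
  have htop : ∑ k ∈ Finset.range (n + 2), gaussBinom q n k * f k =
      ∑ k ∈ Finset.range (n + 1), gaussBinom q n k * f k := by
    rw [Finset.sum_range_succ, gaussBinom_eq_zero_of_lt q n.lt_succ_self, zero_mul, add_zero]
  have hpascal : ∑ k ∈ Finset.range (n + 1), gaussBinom q (n + 1) (k + 1) * f (k + 1) =
      ∑ k ∈ Finset.range (n + 1),
        (gaussBinom q n k * (q ^ (n - k) * f (k + 1)) + gaussBinom q n (k + 1) * f (k + 1)) :=
    Finset.sum_congr rfl fun k hk => by
      rw [gaussBinom_succ_succ' q (Finset.mem_range_succ_iff.mp hk)]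
      ring
  rw [Finset.sum_range_succ'] at htop ⊢
  simp only [hpascal, gaussBinom_zero_right, mul_add, Finset.sum_add_distrib, ← htop]
  ring

theorem gaussBinom_mul_qPoch (q : A) (m k : ℕ) :
    gaussBinom q (m + k) k * (qPoch q q m * qPoch q q k) = qPoch q q (m + k) := by
  induction hn : m + k generalizing m k with
  | zero => obtain ⟨rfl, rfl⟩ : m = 0 ∧ k = 0 := by omega
            simp [qPoch]
  | succ n ih =>
    rcases k with _ | k
    · obtain rfl : m = n + 1 := hn
      simp [qPoch]
    obtain rfl : n = m + k := by omega
    have hleft := ih m k rfl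
    rcases m with _ | m
    · rw [Nat.zero_add] at hleft ⊢
      rw [gaussBinom_succ_succ, gaussBinom_eq_zero_of_lt q k.lt_succ_self, qPoch_succ]
      linear_combination (1 - q * q ^ k) * hleft
    · have hright := ih m (k + 1) (by omega)
      rw [gaussBinom_succ_succ, qPoch_succ q q (m + 1 + k)]
      rw [qPoch_succ q q k] at hright ⊢
      rw [qPoch_succ q q m] at hleft ⊢
      linear_combination (1 - q * q ^ k) * hleft + q ^ (k + 1) * (1 - q * q ^ m) * hright

end GaussBinom

section JacobiTripleProduct

/-- The triangular number `n (n + 1) / 2` of an integer `n`; it satisfies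
`triangle (-n - 1) = triangle n`. -/
def triangle (n : ℤ) : ℕ := (n * (n + 1) / 2).toNat

theorem two_mul_triangle (n : ℤ) : 2 * (triangle n : ℤ) = n * (n + 1) := by
  have hnonneg : 0 ≤ n * (n + 1) := by
    rcases le_or_gt 0 n with h | h
    · positivity
    · nlinarith
  rw [triangle, Int.toNat_of_nonneg (by omega)]
  exact Int.mul_ediv_cancel' (Int.even_mul_succ_self n).two_dvd

theorem triangle_eq_add (n : ℤ) : (triangle n : ℤ) = triangle (n - 1) + n := by
  linarith [two_mul_triangle n, two_mul_triangle (n - 1)]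

theorem triangle_add_triangle_sub_one (n : ℤ) : triangle n + triangle (n - 1) = n.natAbs ^ 2 := by
  zify
  rw [sq_abs]
  linarith [two_mul_triangle n, two_mul_triangle (n - 1)]

theorem triangle_neg (n : ℤ) : triangle (-n) = triangle (n - 1) := by
  have h₁ := two_mul_triangle (-n)
  have h₂ := two_mul_triangle (n - 1)
  zify
  linarith

theorem natAbs_le_triangle_add_one (n : ℤ) : n.natAbs ≤ triangle n + 1 := by
  have h := two_mul_triangle n
  zify
  rw [abs_le]
  constructor <;> nlinarith

variable {A : Type*} [CommRing A] {a b : A}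

/-- The general term `a ^ (n (n + 1) / 2) * b ^ (n (n - 1) / 2)` of Ramanujan's theta function
`f(a, b)`. -/
def thetaTerm (a b : A) (n : ℤ) : A := a ^ triangle n * b ^ triangle (n - 1)

theorem mul_thetaTerm_sub_one (a b : A) {M j : ℕ} {n : ℤ} (h : n + j = M + 1) :
    a * (a * b) ^ M * thetaTerm a b (n - 1) = (a * b) ^ j * thetaTerm a b n := by
  have h₁ := triangle_eq_add n
  have h₂ := triangle_eq_add (n - 1)
  have ha : M + 1 + triangle (n - 1) = j + triangle n := by omega
  have hb : M + triangle (n - 1 - 1) = j + triangle (n - 1) := by omega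
  calc a * (a * b) ^ M * thetaTerm a b (n - 1)
      = a ^ (M + 1 + triangle (n - 1)) * b ^ (M + triangle (n - 1 - 1)) := by
        rw [thetaTerm]; ring
    _ = (a * b) ^ j * thetaTerm a b n := by rw [ha, hb, thetaTerm]; ring

theorem mul_thetaTerm_add_one (a b : A) {N j : ℕ} {n : ℤ} (h : N + n + 1 = j) :
    b * (a * b) ^ N * thetaTerm a b (n + 1) = (a * b) ^ j * thetaTerm a b n := by
  have h₁ := triangle_eq_add (n + 1)
  have h₂ := triangle_eq_add n
  rw [add_sub_cancel_right] at h₁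
  have ha : N + triangle (n + 1) = j + triangle n := by omega
  have hb : N + 1 + triangle n = j + triangle (n - 1) := by omega
  calc b * (a * b) ^ N * thetaTerm a b (n + 1)
      = a ^ (N + triangle (n + 1)) * b ^ (N + 1 + triangle n) := by
        rw [thetaTerm, add_sub_cancel_right]; ring
    _ = (a * b) ^ j * thetaTerm a b n := by rw [ha, hb, thetaTerm]; ring

theorem qPoch_neg_eq_sum (a b : A) (N : ℕ) :
    qPoch (-b) (a * b) N =
      ∑ k ∈ Finset.range (N + 1), gaussBinom (a * b) N k * thetaTerm a b (k - N) := by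
  induction N with
  | zero => simp [qPoch, thetaTerm, triangle]
  | succ N ih =>
    rw [qPoch_succ, ih, sum_range_gaussBinom_succ, Finset.sum_mul]
    refine Finset.sum_congr rfl fun k _ => ?_
    have hshift := mul_thetaTerm_add_one a b (N := N) (j := k) (n := k - (N + 1)) (by ring)
    rw [show (k : ℤ) - (N + 1) + 1 = k - N by ring] at hshift
    push_cast
    rw [show (k : ℤ) + 1 - (N + 1) = k - N by ring, ← hshift]
    ring

theorem qPoch_mul_qPoch_eq_sum (a b : A) (M N : ℕ) :
    qPoch (-a) (a * b) M * qPoch (-b) (a * b) N =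
      ∑ k ∈ Finset.range (M + N + 1), gaussBinom (a * b) (M + N) k * thetaTerm a b (k - N) := by
  induction M with
  | zero => simpa [qPoch] using qPoch_neg_eq_sum a b N
  | succ M ih =>
    rw [qPoch_succ, mul_right_comm, ih, show M + 1 + N = M + N + 1 by ring,
      sum_range_gaussBinom_succ', Finset.sum_mul]
    refine Finset.sum_congr rfl fun k hk => ?_
    have hk := Finset.mem_range_succ_iff.mp hk
    have hshift := mul_thetaTerm_sub_one a b (M := M) (j := M + N - k) (n := k + 1 - N)
      (by push_cast [hk]; ring)
    rw [show (k : ℤ) + 1 - N - 1 = k - N by ring] at hshift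
    push_cast
    rw [← hshift]
    ring

end JacobiTripleProduct

section InfiniteTripleProduct

theorem tendsto_natAbs_sub_cofinite (m : ℕ) :
    Tendsto (fun n : ℤ => n.natAbs - m) cofinite atTop := by
  refine (tendsto_sub_atTop_nat m).comp (tendsto_atTop.mpr fun b => eventually_cofinite.mpr ?_)
  refine (Set.finite_Icc (-b : ℤ) b).subset fun n hn => ?_
  simp only [Set.mem_ofPred_eq, Set.mem_Icc] at hn ⊢
  omega

theorem pow_natAbs_sub_one_dvd_thetaTerm {A : Type*} [CommRing A] (a b : A) (n : ℤ) :
    (a * b) ^ (n.natAbs - 1) ∣ thetaTerm a b n := by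
  have h₁ := natAbs_le_triangle_add_one n
  have h₂ := natAbs_le_triangle_add_one (-n)
  rw [triangle_neg, Int.natAbs_neg] at h₂
  rw [mul_pow, thetaTerm]
  exact mul_dvd_mul (pow_dvd_pow a (by omega)) (pow_dvd_pow b (by omega))

variable {R : Type*} [CommRing R] [TopologicalSpace R] {a b q : R⟦X⟧}

theorem summable_thetaTerm (hab : X ∣ a * b) : Summable (thetaTerm a b) :=
  summable_of_X_pow_dvd (tendsto_natAbs_sub_cofinite 1) fun n =>
    (pow_dvd_pow_of_dvd hab _).trans (pow_natAbs_sub_one_dvd_thetaTerm a b n)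

/-- The general term of the finite triple product with `2 (N + 1)` factors, as a function of the
exponent `n` in `thetaTerm a b n`; it vanishes for `N + 1 < |n|`. -/
def finiteThetaTerm {A : Type*} [CommRing A] (a b : A) (N : ℕ) (n : ℤ) : A :=
  if -(N + 1) ≤ n then
    gaussBinom (a * b) (N + 1 + (N + 1)) (n + (N + 1)).toNat * thetaTerm a b n
  else 0

theorem hasSum_finiteThetaTerm (a b : R⟦X⟧) (N : ℕ) :
    HasSum (finiteThetaTerm a b N)
      (qPoch (-a) (a * b) (N + 1) * qPoch (-b) (a * b) (N + 1)) := by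
  have hinj : Function.Injective fun k : ℕ => (k : ℤ) - (N + 1) := fun i j h => by
    simpa using h
  have hterm (k : ℕ) : finiteThetaTerm a b N (k - (N + 1)) =
      gaussBinom (a * b) (N + 1 + (N + 1)) k * thetaTerm a b (k - (N + 1 : ℕ)) := by
    rw [finiteThetaTerm, if_pos (by omega), sub_add_cancel, Int.toNat_natCast, Nat.cast_add_one]
  rw [← hinj.hasSum_iff, qPoch_mul_qPoch_eq_sum]
  · refine (hasSum_sum_of_ne_finset_zero fun k hk => ?_).congr_fun fun k => hterm k
    rw [gaussBinom_eq_zero_of_lt _ (by simpa using hk), zero_mul]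
  · intro n hn
    refine if_neg fun h => hn ⟨(n + (N + 1)).toNat, ?_⟩
    simp only
    omega

variable [T2Space R]

theorem X_pow_dvd_qPochInf_mul_gaussBinom_sub_one (hq : X ∣ q) {d m k : ℕ} (hm : d ≤ m)
    (hk : d ≤ k) : X ^ d ∣ qPochInf q q * gaussBinom q (m + k) k - 1 := by
  have hcong {n : ℕ} (hn : d ≤ n) : X ^ d ∣ qPochInf q q - qPoch q q n :=
    (pow_dvd_pow X hn).trans (X_pow_dvd_qPochInf_sub q hq n)
  refine (isUnit_qPochInf hq hq).dvd_mul_right.mp ?_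
  have hdvd : X ^ d ∣
      gaussBinom q (m + k) k * (qPochInf q q * (qPochInf q q - qPoch q q k) +
        (qPochInf q q - qPoch q q m) * qPoch q q k) - (qPochInf q q - qPoch q q (m + k)) :=
    dvd_sub (dvd_mul_of_dvd_right (dvd_add (dvd_mul_of_dvd_right (hcong hk) _)
      (dvd_mul_of_dvd_left (hcong hm) _)) _) (hcong (hm.trans (Nat.le_add_right m k)))
  convert hdvd using 1
  linear_combination gaussBinom_mul_qPoch q m k

theorem X_pow_dvd_mul_finiteThetaTerm_sub (hab : X ∣ a * b) (N : ℕ) (n : ℤ) :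
    X ^ N ∣ qPochInf (a * b) (a * b) * finiteThetaTerm a b N n - thetaTerm a b n := by
  have hterm : X ^ (n.natAbs - 1) ∣ thetaTerm a b n :=
    (pow_dvd_pow_of_dvd hab _).trans (pow_natAbs_sub_one_dvd_thetaTerm a b n)
  rcases le_or_gt n.natAbs (N + 1) with hn | hn
  · obtain ⟨k, rfl⟩ : ∃ k : ℕ, n = k - (N + 1) := ⟨(n + (N + 1)).toNat, by omega⟩
    obtain ⟨m, hm⟩ : ∃ m : ℕ, N + 1 + (N + 1) = m + k := Nat.exists_eq_add_of_le' (by omega)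
    have hcoeff := X_pow_dvd_qPochInf_mul_gaussBinom_sub_one hab (min_le_left m k)
      (min_le_right m k)
    rw [finiteThetaTerm, if_pos (by omega), sub_add_cancel, Int.toNat_natCast, hm]
    rw [← mul_assoc, ← sub_one_mul]
    refine (pow_dvd_pow X ?_).trans ((pow_add (X : R⟦X⟧) _ _).symm ▸ mul_dvd_mul hcoeff hterm)
    omega
  · have hzero : finiteThetaTerm a b N n = 0 := by
      rw [finiteThetaTerm]
      split_ifs with h
      · rw [gaussBinom_eq_zero_of_lt _ (by omega), zero_mul]
      · rfl
    rw [hzero, mul_zero, zero_sub, dvd_neg]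
    exact (pow_dvd_pow X (by omega)).trans hterm

variable [IsTopologicalRing R]

/-- **Jacobi's triple product identity** in Ramanujan's form
`∑ a ^ (n (n + 1) / 2) b ^ (n (n - 1) / 2) = (-a; ab)_∞ (-b; ab)_∞ (ab; ab)_∞`. -/
theorem hasSum_thetaTerm (hab : X ∣ a * b) :
    HasSum (thetaTerm a b)
      (qPochInf (a * b) (a * b) * (qPochInf (-a) (a * b) * qPochInf (-b) (a * b))) := by
  have hsum := (summable_thetaTerm hab).hasSum
  have hlim := tendsto_of_hasSum_of_X_pow_dvd_sub
    (fun N => (hasSum_finiteThetaTerm a b N).mul_left (qPochInf (a * b) (a * b))) hsum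
    (X_pow_dvd_mul_finiteThetaTerm_sub hab)
  have hprod := (((tendsto_qPoch (-a) hab).mul (tendsto_qPoch (-b) hab)).const_mul
    (qPochInf (a * b) (a * b))).comp (tendsto_add_atTop_nat 1)
  exact tendsto_nhds_unique hlim hprod ▸ hsum

end InfiniteTripleProduct

section ThetaFunctions

/-- The Dedekind product `∏_{n ≥ 1} (1 - X ^ (k n))`, without its fractional power of `X`. -/
noncomputable def eta (k : ℕ) : ℤ⟦X⟧ := qPochInf (X ^ k) (X ^ k)

theorem X_dvd_X_pow {R : Type*} [CommRing R] (k : ℕ) [NeZero k] : (X : R⟦X⟧) ∣ X ^ k :=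
  dvd_pow_self X (NeZero.ne k)

theorem constantCoeff_eta (k : ℕ) [NeZero k] : constantCoeff (eta k) = 1 :=
  constantCoeff_qPochInf (X_dvd_X_pow k) (X_dvd_X_pow k)

theorem isUnit_eta (k : ℕ) [NeZero k] : IsUnit (eta k) :=
  isUnit_qPochInf (X_dvd_X_pow k) (X_dvd_X_pow k)

theorem eta_ne_zero (k : ℕ) [NeZero k] : eta k ≠ 0 := (isUnit_eta k).ne_zero

theorem expand_qPochInf {m : ℕ} (hm : m ≠ 0) (a : ℤ⟦X⟧) (k : ℕ) [NeZero k] :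
    expand m hm (qPochInf a (X ^ k)) = qPochInf (expand m hm a) (X ^ (m * k)) := by
  have hX : expand m hm (X ^ k : ℤ⟦X⟧) = X ^ (m * k) := by rw [map_pow, expand_X, pow_mul]
  rw [← hX]
  refine map_qPochInf (expand m hm : ℤ⟦X⟧ →ₐ[ℤ] ℤ⟦X⟧).toRingHom (continuous_expand hm) a
    (X_dvd_X_pow k) ?_
  exact hX ▸ dvd_pow_self X (mul_ne_zero hm (NeZero.ne k))

theorem expand_eta {m : ℕ} (hm : m ≠ 0) (k : ℕ) [NeZero k] :
    expand m hm (eta k) = eta (m * k) := by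
  rw [eta, expand_qPochInf hm, map_pow, expand_X, ← pow_mul, eta]

theorem qPochInf_X_X_sq_mul_eta : qPochInf X (X ^ 2) * eta 2 = eta 1 := by
  have h := qPochInf_eq_prod (X : ℤ⟦X⟧) dvd_rfl two_ne_zero
  rw [Finset.prod_range_succ, Finset.prod_range_one, pow_zero, mul_one, pow_one, ← sq] at h
  rw [eta, eta, pow_one, h]

theorem qPochInf_neg_X_mul_eta : qPochInf (-X) X * eta 1 = eta 2 := by
  rw [eta, eta, pow_one, mul_comm, qPochInf_mul_qPochInf_neg X dvd_rfl]

/-- Ramanujan's theta function `∑ (-1) ^ n q ^ (n ^ 2)`, defined as a product. -/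
noncomputable def theta : ℤ⟦X⟧ := qPochInf X (X ^ 2) ^ 2 * eta 2

/-- Ramanujan's theta function `∑ q ^ (n ^ 2)`, defined as a product. -/
noncomputable def thetaPos : ℤ⟦X⟧ := qPochInf (-X) (X ^ 2) ^ 2 * eta 2

/-- Ramanujan's theta function `∑_{n ≥ 0} q ^ (n (n + 1) / 2)`, defined as a product. -/
noncomputable def psi : ℤ⟦X⟧ := qPochInf (-X) X ^ 2 * eta 1

theorem theta_mul_eta : theta * eta 2 = eta 1 ^ 2 := by
  rw [theta, ← qPochInf_X_X_sq_mul_eta]; ring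

theorem psi_mul_eta : psi * eta 1 = eta 2 ^ 2 := by
  rw [psi, ← qPochInf_neg_X_mul_eta]; ring

theorem theta_mul_thetaPos : theta * thetaPos * eta 4 ^ 2 = eta 2 ^ 4 := by
  have hneg := qPochInf_mul_qPochInf_neg (R := ℤ) X (X_dvd_X_pow 2)
  have htwo := congrArg (expand 2 two_ne_zero) qPochInf_X_X_sq_mul_eta
  rw [← pow_mul] at hneg
  rw [map_mul, expand_qPochInf, expand_eta, expand_eta, expand_X] at htwo
  rw [theta, thetaPos]
  linear_combination (qPochInf X (X ^ 2) * qPochInf (-X) (X ^ 2) * eta 4 + eta 2) * eta 2 ^ 2 *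
    (eta 4 * hneg + htwo)

theorem constantCoeff_theta : constantCoeff theta = 1 := by
  rw [theta, map_mul, map_pow, constantCoeff_qPochInf dvd_rfl (X_dvd_X_pow 2), constantCoeff_eta,
    one_pow, one_mul]

theorem thetaTerm_neg_neg {A : Type*} [CommRing A] (a b : A) (n : ℤ) :
    thetaTerm (-a) (-b) n = (n.negOnePow : ℤ) * thetaTerm a b n := by
  have hsign : (-1 : A) ^ triangle n * (-1) ^ triangle (n - 1) = (n.negOnePow : ℤ) := by
    rw [← pow_add, triangle_add_triangle_sub_one, Int.coe_negOnePow, sq, pow_mul,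
      ← Int.coe_negOnePow A n]
    rcases Int.even_or_odd n with h | h
    · simp [Int.negOnePow_even n h]
    · simp [Int.negOnePow_odd n h, (Int.natAbs_odd.mpr h).neg_one_pow]
  rw [thetaTerm, neg_pow, neg_pow b, ← hsign, thetaTerm]
  ring

theorem hasSum_theta :
    HasSum (fun n : ℤ => ((n.negOnePow : ℤ) : ℤ⟦X⟧) * X ^ n.natAbs ^ 2) theta := by
  have h := hasSum_thetaTerm (R := ℤ) (a := -X) (b := -X)
    (by rw [neg_mul_neg]; exact Dvd.intro _ rfl)
  convert h using 1
  · ext1 n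
    rw [thetaTerm_neg_neg, thetaTerm, ← pow_add, triangle_add_triangle_sub_one]
  · rw [theta, eta, neg_mul_neg, neg_neg, ← sq]; ring

theorem hasSum_thetaPos : HasSum (fun n : ℤ => (X ^ n.natAbs ^ 2 : ℤ⟦X⟧)) thetaPos := by
  have h := hasSum_thetaTerm (R := ℤ) (a := X) (b := X) (Dvd.intro _ rfl)
  convert h using 1
  · ext1 n
    rw [thetaTerm, ← pow_add, triangle_add_triangle_sub_one]
  · rw [thetaPos, eta, ← sq]; ring

theorem hasSum_two_mul_psi : HasSum (fun n : ℤ => (X ^ triangle n : ℤ⟦X⟧)) (2 * psi) := by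
  have h := hasSum_thetaTerm (R := ℤ) (a := X) (b := 1) (by rw [mul_one])
  convert h using 1
  · simp [funext_iff, thetaTerm]
  · rw [mul_one, qPochInf_eq_mul (-1) dvd_rfl, neg_one_mul, psi, eta, pow_one]; ring

theorem hasSum_negOnePow_mul_X_pow_triangle :
    HasSum (fun n : ℤ => ((n.negOnePow : ℤ) : ℤ⟦X⟧) * X ^ triangle n) 0 := by
  have h := hasSum_thetaTerm (R := ℤ) (a := -X) (b := -1) (by rw [neg_mul_neg, mul_one])
  convert h using 1
  · ext1 n
    rw [thetaTerm_neg_neg, thetaTerm, one_pow, mul_one]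
  · rw [neg_mul_neg, neg_neg, neg_neg, mul_one, qPochInf_eq_mul 1 dvd_rfl]; ring

theorem hasSum_eta_one :
    HasSum (fun n : ℤ => ((n.negOnePow : ℤ) : ℤ⟦X⟧) * X ^ pentagonal n) (eta 1) := by
  have h : eta 1 = pentagonalSeries ℤ := by
    rw [← WithPiTopology.tprod_one_sub_X_pow, eta, qPochInf]
    simp_rw [pow_one, ← pow_succ']
  exact h ▸ WithPiTopology.hasSum_pentagonalSeries ℤ

end ThetaFunctions

section JacobiCube

open DualNumber

/-- The coefficientwise `ε`-part of a power series over the dual numbers. -/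
noncomputable def epsPart : ℤ[ε]⟦X⟧ →+ ℤ⟦X⟧ where
  toFun f := mk fun d => (coeff d f).snd
  map_zero' := by ext; simp
  map_add' f g := by ext; simp

theorem continuous_epsPart : Continuous epsPart :=
  continuous_of_continuous_coeff fun d => by
    simpa [epsPart, Function.comp_def] using
      TrivSqZeroExt.continuous_snd.comp (WithPiTopology.continuous_coeff ℤ[ε] d)

/-- Reduction modulo `ε` of a power series over the dual numbers. -/
noncomputable def modEps : ℤ[ε]⟦X⟧ →+* ℤ⟦X⟧ :=
  PowerSeries.map (TrivSqZeroExt.fstHom ℤ ℤ ℤ).toRingHom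

theorem modEps_C (z : ℤ[ε]) : modEps (C z) = C z.fst := by simp [modEps]

theorem modEps_X : modEps X = X := by simp [modEps]

theorem continuous_modEps : Continuous modEps :=
  continuous_of_continuous_coeff fun d => by
    simpa [modEps, Function.comp_def] using
      TrivSqZeroExt.continuous_fst.comp (WithPiTopology.continuous_coeff ℤ[ε] d)

theorem modEps_qPochInf (a : ℤ[ε]⟦X⟧) :
    modEps (qPochInf a X) = qPochInf (modEps a) X := by
  rw [map_qPochInf modEps continuous_modEps a dvd_rfl (modEps_X ▸ dvd_rfl), modEps_X]

theorem epsPart_C_eps_mul (f : ℤ[ε]⟦X⟧) : epsPart (C ε * f) = modEps f := by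
  ext d
  simp [epsPart, modEps]

theorem epsPart_X_pow (n : ℕ) : epsPart (X ^ n) = 0 := by
  ext d
  simp only [epsPart, AddMonoidHom.coe_mk, ZeroHom.coe_mk, coeff_mk, coeff_X_pow]
  split_ifs <;> simp

theorem one_sub_eps_pow_mul_one_add_eps_pow (i j : ℕ) :
    (1 - (ε : ℤ[ε])) ^ i * (1 + ε) ^ j = 1 + ((j : ℤ[ε]) - (i : ℤ[ε])) * (ε : ℤ[ε]) := by
  ext <;> simp [TrivSqZeroExt.snd_pow]
  ring

theorem epsPart_thetaTerm (n : ℤ) :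
    epsPart (thetaTerm (-(X * C (1 - ε))) (-C (1 + ε)) n) =
      -((n : ℤ⟦X⟧) * (((n.negOnePow : ℤ) : ℤ⟦X⟧) * X ^ triangle n)) := by
  have hexp : (1 - (ε : ℤ[ε])) ^ triangle n * (1 + ε) ^ triangle (n - 1) = 1 - (n : ℤ[ε]) * ε := by
    have h := congrArg (Int.cast : ℤ → ℤ[ε]) (triangle_eq_add n)
    push_cast at h
    rw [one_sub_eps_pow_mul_one_add_eps_pow, h]
    ring
  have hterm : thetaTerm (-(X * C (1 - ε))) (-C (1 + ε)) n =
      (n.negOnePow : ℤ) • (X ^ triangle n : ℤ[ε]⟦X⟧) -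
        (n * n.negOnePow : ℤ) • (C ε * X ^ triangle n) := by
    rw [thetaTerm_neg_neg, thetaTerm, mul_pow, mul_assoc, ← map_pow, ← map_pow, ← map_mul, hexp,
      map_sub, map_one, map_mul, map_intCast, zsmul_eq_mul, zsmul_eq_mul]
    push_cast
    ring
  rw [hterm, map_sub, map_zsmul, map_zsmul, epsPart_X_pow, epsPart_C_eps_mul, map_pow, modEps_X,
    smul_zero, zero_sub, zsmul_eq_mul]
  push_cast
  ring

theorem hasSum_mul_negOnePow_mul_X_pow_triangle :
    HasSum (fun n : ℤ => (n : ℤ⟦X⟧) * (((n.negOnePow : ℤ) : ℤ⟦X⟧) * X ^ triangle n))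
      (eta 1 ^ 3) := by
  have hab : -(X * C (1 - (ε : ℤ[ε]))) * -C (1 + ε) = X := by
    have heps : (1 - (ε : ℤ[ε])) * (1 + ε) = 1 := by
      linear_combination -(DualNumber.eps_mul_eps (R := ℤ))
    rw [neg_mul_neg, mul_assoc, ← map_mul, heps, map_one, mul_one]
  have hprod : qPochInf X X * (qPochInf (X * C (1 - (ε : ℤ[ε]))) X * qPochInf (C (1 + ε)) X) =
      -(C ε * (qPochInf X X * (qPochInf (X * C (1 - ε)) X * qPochInf (C (1 + ε) * X) X))) := by
    rw [qPochInf_eq_mul (C (1 + ε)) dvd_rfl, map_add, map_one]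
    ring
  have h := (hasSum_thetaTerm (dvd_of_eq hab.symm)).map epsPart continuous_epsPart
  rw [hab, neg_neg, neg_neg, hprod, map_neg, epsPart_C_eps_mul] at h
  simp only [map_mul, modEps_qPochInf, modEps_X, modEps_C, Function.comp_def,
    epsPart_thetaTerm] at h
  have hval : qPochInf X X * (qPochInf (X * C (1 - (ε : ℤ[ε])).fst) X *
      qPochInf (C (1 + (ε : ℤ[ε])).fst * X) X) = eta 1 ^ 3 := by
    simp only [eta, TrivSqZeroExt.fst_sub, TrivSqZeroExt.fst_add, TrivSqZeroExt.fst_one, fst_eps,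
      sub_zero, add_zero, map_one, mul_one, one_mul, pow_one]
    ring
  rw [hval] at h
  simpa only [neg_neg] using h.neg

end JacobiCube

section EulerSum

variable {R : Type*} [CommRing R]

theorem isUnit_one_sub_X_pow (k : ℕ) [NeZero k] : IsUnit (1 - X ^ k : R⟦X⟧) :=
  isUnit_iff_constantCoeff.mpr (by simp [NeZero.ne k])

theorem isUnit_qPoch {a q : R⟦X⟧} (ha : X ∣ a) (n : ℕ) : IsUnit (qPoch a q n) :=
  isUnit_iff_constantCoeff.mpr (by simp [qPoch, map_prod, X_dvd_iff.mp ha])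

/-- The reciprocal `1 / (q; q)_n`, meaningful when `X ∣ q`. -/
noncomputable def recipPoch (q : R⟦X⟧) (n : ℕ) : R⟦X⟧ := (qPoch q q n)⁻¹ʳ

theorem recipPoch_zero (q : R⟦X⟧) : recipPoch q 0 = 1 := by simp [recipPoch, qPoch]

variable {q z : R⟦X⟧}

theorem qPoch_mul_recipPoch (hq : X ∣ q) (n : ℕ) : qPoch q q n * recipPoch q n = 1 :=
  Ring.mul_inverse_cancel _ (isUnit_qPoch hq n)

theorem recipPoch_eq_mul (hq : X ∣ q) (n : ℕ) :
    recipPoch q n = (1 - q ^ (n + 1)) * recipPoch q (n + 1) := by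
  have h := qPoch_mul_recipPoch hq (n + 1)
  rw [qPoch_succ] at h
  linear_combination -recipPoch q n * h +
    (1 - q ^ (n + 1)) * recipPoch q (n + 1) * qPoch_mul_recipPoch hq n

variable [TopologicalSpace R]

theorem summable_pow_mul_recipPoch (q : R⟦X⟧) (hz : X ∣ z) :
    Summable fun m : ℕ => z ^ m * recipPoch q m :=
  summable_of_X_pow_dvd (Nat.cofinite_eq_atTop ▸ tendsto_id) fun m =>
    (pow_dvd_pow_of_dvd hz m).mul_right _

variable [T2Space R]

theorem X_pow_dvd_qPochInf_mul_recipPoch_sub_one (hq : X ∣ q) (n : ℕ) :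
    X ^ n ∣ qPochInf q q * recipPoch q n - 1 := by
  rw [← qPoch_mul_recipPoch hq n, ← sub_mul]
  exact (X_pow_dvd_qPochInf_sub q hq n).mul_right _

variable [IsTopologicalRing R]

theorem one_sub_mul_tsum_pow_mul_recipPoch (hq : X ∣ q) (hz : X ∣ z) :
    (1 - z) * ∑' m, z ^ m * recipPoch q m = ∑' m, (z * q) ^ m * recipPoch q m := by
  have hz' := (summable_pow_mul_recipPoch q hz).hasSum
  have hdiff := hz'.sub (summable_pow_mul_recipPoch q (hz.mul_right q)).hasSum
  have hshift := (hasSum_nat_add_iff' 1).mpr hdiff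
  simp only [Finset.sum_range_one, pow_zero, one_mul, sub_self, sub_zero] at hshift
  have hterm (m : ℕ) : z ^ (m + 1) * recipPoch q (m + 1) - (z * q) ^ (m + 1) * recipPoch q (m + 1) =
      z * (z ^ m * recipPoch q m) := by
    rw [recipPoch_eq_mul hq m]; ring
  simp_rw [hterm] at hshift
  linear_combination -(hz'.mul_left z).unique hshift

theorem qPochInf_mul_tsum_pow_mul_recipPoch (hq : X ∣ q) (hz : X ∣ z) :
    qPochInf z q * ∑' m, z ^ m * recipPoch q m = 1 := by
  have hdvd (N : ℕ) : X ∣ z * q ^ N := hz.mul_right _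
  have hprod (N : ℕ) : qPoch z q N * ∑' m, z ^ m * recipPoch q m =
      ∑' m, (z * q ^ N) ^ m * recipPoch q m := by
    induction N with
    | zero => simp [qPoch]
    | succ N ih =>
      rw [pow_succ, ← mul_assoc z, ← one_sub_mul_tsum_pow_mul_recipPoch hq (hdvd N), ← ih,
        qPoch_succ]
      ring
  have hlim : Tendsto (fun N => ∑' m, (z * q ^ N) ^ m * recipPoch q m) atTop (𝓝 1) := by
    refine tendsto_of_hasSum_of_X_pow_dvd_sub
      (fun N => (summable_pow_mul_recipPoch q (hdvd N)).hasSum)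
      (hasSum_ite_eq (0 : ℕ) (1 : R⟦X⟧)) fun N m => ?_
    rcases m with _ | m
    · simp [recipPoch_zero]
    · rw [if_neg m.succ_ne_zero, sub_zero, pow_succ, mul_assoc, mul_assoc]
      exact (((pow_dvd_pow_of_dvd hq N).mul_right _).mul_left z).mul_left _
  refine tendsto_nhds_unique ((tendsto_qPoch z hq).mul_const _) ?_
  simpa only [hprod] using hlim

end EulerSum

section PartialFractions

/-- The coefficient of `1 / ((q²; q²)_{n - r} (q²; q²)_{n + r + 1})` in the partial fraction
expansion of `1 / (q; q²)_{n + 1} ^ 2`. -/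
noncomputable def partialFractionCoeff (r : ℕ) : ℤ⟦X⟧ :=
  (-1) ^ r * X ^ (r * (r + 1)) * (1 + X ^ (2 * r + 1)) * (1 - X ^ (2 * r + 1))⁻¹ʳ

/-- The `r`-th term, with `u = n - r`, of the partial fraction expansion of
`1 / (q; q²)_{n + 1} ^ 2`. -/
noncomputable def partialFractionTerm (r u : ℕ) : ℤ⟦X⟧ :=
  partialFractionCoeff r * (recipPoch (X ^ 2) u * recipPoch (X ^ 2) (u + 2 * r + 1))

/-- The sequence whose differences telescope the recurrence for the partial fraction sums. -/
noncomputable def partialFractionAux (r u : ℕ) : ℤ⟦X⟧ :=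
  (-1) ^ r * X ^ (r * (r + 1) + 2 * u) * (1 - X ^ (2 * r)) *
    (recipPoch (X ^ 2) u * recipPoch (X ^ 2) (u + 2 * r))

theorem recipPoch_X_sq (n : ℕ) : recipPoch (X ^ 2 : ℤ⟦X⟧) n =
    (1 - X ^ (2 * n + 2)) * recipPoch (X ^ 2) (n + 1) := by
  rw [recipPoch_eq_mul (X_dvd_X_pow 2), ← pow_mul, mul_add_one]

theorem partialFractionTerm_sub (r u : ℕ) :
    (1 - X ^ (2 * (r + u) + 2)) * ((1 - X ^ (2 * (r + u) + 3)) ^ 2 * partialFractionTerm r (u + 1) -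
      partialFractionTerm r u) = partialFractionAux r (u + 1) - partialFractionAux (r + 1) u := by
  have hinv := Ring.mul_inverse_cancel _ (isUnit_one_sub_X_pow (R := ℤ) (2 * r + 1))
  simp only [partialFractionTerm, partialFractionAux, partialFractionCoeff]
  rw [show u + 1 + 2 * r + 1 = u + 2 * r + 1 + 1 by ring,
    show u + 1 + 2 * r = u + 2 * r + 1 by ring,
    show u + 2 * (r + 1) = u + 2 * r + 1 + 1 by ring, recipPoch_X_sq u,
    recipPoch_X_sq (u + 2 * r + 1)]
  linear_combination (1 - X ^ (2 * (r + u) + 2)) * (-1) ^ r * X ^ (r * (r + 1)) *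
    (1 + X ^ (2 * r + 1)) * X ^ (2 * u + 2) * (1 - X ^ (2 * r + 1)) * recipPoch (X ^ 2) (u + 1) *
    recipPoch (X ^ 2) (u + 2 * r + 1 + 1) * hinv

theorem partialFractionTerm_zero (r : ℕ) :
    (1 - X ^ (2 * r)) * ((1 - X ^ (2 * r + 1)) ^ 2 * partialFractionTerm r 0) =
      partialFractionAux r 0 := by
  have hinv := Ring.mul_inverse_cancel _ (isUnit_one_sub_X_pow (R := ℤ) (2 * r + 1))
  simp only [partialFractionTerm, partialFractionAux, partialFractionCoeff]
  rw [recipPoch_X_sq (0 + 2 * r)]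
  linear_combination (1 - X ^ (2 * r)) * (-1) ^ r * X ^ (r * (r + 1)) * (1 + X ^ (2 * r + 1)) *
    (1 - X ^ (2 * r + 1)) * recipPoch (X ^ 2) 0 * recipPoch (X ^ 2) (0 + 2 * r + 1) * hinv

theorem sum_partialFractionTerm_succ (n : ℕ) :
    (1 - X ^ (2 * n + 3)) ^ 2 * ∑ p ∈ antidiagonal (n + 1), partialFractionTerm p.1 p.2 =
      ∑ p ∈ antidiagonal n, partialFractionTerm p.1 p.2 := by
  have hstep : ∑ p ∈ antidiagonal n, (1 - X ^ (2 * n + 2)) *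
      ((1 - X ^ (2 * n + 3)) ^ 2 * partialFractionTerm p.1 (p.2 + 1) -
        partialFractionTerm p.1 p.2) =
      ∑ p ∈ antidiagonal n,
        (partialFractionAux p.1 (p.2 + 1) - partialFractionAux (p.1 + 1) p.2) :=
    Finset.sum_congr rfl fun p hp => by
      rw [← partialFractionTerm_sub, mem_antidiagonal.mp hp]
  have htop := partialFractionTerm_zero (n + 1)
  have hbot : partialFractionAux 0 (n + 1) = 0 := by simp [partialFractionAux]
  have hfirst := Finset.Nat.sum_antidiagonal_succ (n := n)
    (f := fun p => partialFractionAux p.1 p.2)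
  have hlast := Finset.Nat.sum_antidiagonal_succ' (n := n)
    (f := fun p => partialFractionAux p.1 p.2)
  rw [← Finset.mul_sum, Finset.sum_sub_distrib, Finset.sum_sub_distrib, ← Finset.mul_sum] at hstep
  refine (isUnit_one_sub_X_pow (2 * n + 2)).mul_left_cancel ?_
  rw [Finset.Nat.sum_antidiagonal_succ']
  linear_combination hstep + htop + hfirst - hlast + hbot

theorem sum_partialFractionTerm_mul (n : ℕ) :
    (∑ p ∈ antidiagonal n, partialFractionTerm p.1 p.2) * qPoch X (X ^ 2) (n + 1) ^ 2 =
      1 := by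
  induction n with
  | zero =>
    have hinv := Ring.mul_inverse_cancel _ (isUnit_one_sub_X_pow (R := ℤ) 1)
    have hrecip := recipPoch_X_sq 0
    rw [recipPoch_zero] at hrecip
    simp only [Finset.Nat.antidiagonal_zero, Finset.sum_singleton, partialFractionTerm,
      partialFractionCoeff, recipPoch_zero, qPoch, Finset.prod_range_one, mul_zero, zero_add]
    linear_combination (1 - X ^ 2) * recipPoch (X ^ 2) 1 * hinv - hrecip
  | succ n ih =>
    rw [← sum_partialFractionTerm_succ] at ih
    rw [qPoch_succ]
    linear_combination ih

end PartialFractions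

section AppellLerch

/-- The terms of the column sums that arise when the partial fraction expansion is inserted into
`φ` and the order of summation is interchanged. -/
noncomputable def columnTerm (r m : ℕ) : ℤ⟦X⟧ :=
  qPoch (-X) X (2 * (r + m)) *
    (X ^ m * (recipPoch (X ^ 2) m * recipPoch (X ^ 2) (m + 2 * r + 1)))

/-- The sum of the `r`-th column. -/
noncomputable def columnSum (r : ℕ) : ℤ⟦X⟧ := ∑' m, columnTerm r m

/-- The sequence whose differences telescope the recurrence for the column sums. -/
noncomputable def columnAux (r m : ℕ) : ℤ⟦X⟧ :=
  qPoch (-X) X (2 * (r + m + 1)) *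
    (X ^ m * ((1 - X ^ (2 * r + 2)) * (recipPoch (X ^ 2) m * recipPoch (X ^ 2) (m + 2 * r + 2))))

theorem X_pow_dvd_columnTerm (r m : ℕ) : X ^ m ∣ columnTerm r m :=
  (Dvd.intro _ rfl).mul_left _

theorem summable_columnTerm (r : ℕ) : Summable (columnTerm r) :=
  summable_of_X_pow_dvd (Nat.cofinite_eq_atTop ▸ tendsto_id) (X_pow_dvd_columnTerm r)

theorem qPoch_neg_X_two_mul_succ (n : ℕ) : qPoch (-X : ℤ⟦X⟧) X (2 * (n + 1)) =
    qPoch (-X) X (2 * n) * ((1 + X ^ (2 * n + 1)) * (1 + X ^ (2 * n + 2))) := by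
  rw [mul_add_one, qPoch_succ, qPoch_succ]
  ring

theorem columnTerm_zero (r : ℕ) : (1 + X ^ (2 * r + 1)) * columnTerm r 0 = columnAux r 0 := by
  rw [columnTerm, columnAux, recipPoch_X_sq (0 + 2 * r + 1), add_zero, qPoch_neg_X_two_mul_succ]
  ring

theorem columnTerm_succ_sub (r m : ℕ) :
    (1 + X ^ (2 * r + 1)) * columnTerm r (m + 1) - (1 + X ^ (2 * r + 3)) * columnTerm (r + 1) m =
      columnAux r (m + 1) - columnAux r m := by
  simp only [columnTerm, columnAux]
  rw [recipPoch_X_sq m, show m + 2 * (r + 1) + 1 = m + 2 * r + 2 + 1 by ring,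
    show m + 1 + 2 * r + 1 = m + 2 * r + 2 by ring,
    show m + 1 + 2 * r + 2 = m + 2 * r + 2 + 1 by ring,
    recipPoch_X_sq (m + 2 * r + 2), show r + 1 + m = r + m + 1 by ring,
    show r + (m + 1) = r + m + 1 by ring, qPoch_neg_X_two_mul_succ (r + m + 1)]
  ring

theorem columnSum_succ (r : ℕ) :
    (1 + X ^ (2 * r + 3)) * columnSum (r + 1) = (1 + X ^ (2 * r + 1)) * columnSum r := by
  have htail := (hasSum_nat_add_iff' 1).mpr
    ((summable_columnTerm r).hasSum.mul_left (1 + X ^ (2 * r + 1)))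
  have hsum := htail.sub ((summable_columnTerm (r + 1)).hasSum.mul_left (1 + X ^ (2 * r + 3)))
  simp only [columnTerm_succ_sub, Finset.sum_range_one, columnTerm_zero] at hsum
  have hpartial := hsum.tendsto_sum_nat
  simp_rw [Finset.sum_range_sub] at hpartial
  have hlim : Tendsto (fun m => columnAux r m - columnAux r 0) atTop (𝓝 (0 - columnAux r 0)) := by
    refine Tendsto.sub_const (tendsto_of_X_pow_dvd_sub tendsto_id fun m => ?_) _
    rw [sub_zero]
    exact (Dvd.intro _ rfl).mul_left _
  rw [columnSum, columnSum]
  linear_combination tendsto_nhds_unique hlim hpartial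

theorem one_add_X_pow_mul_columnSum (r : ℕ) :
    (1 + X ^ (2 * r + 1)) * columnSum r = (1 + X) * columnSum 0 := by
  induction r with
  | zero => rw [mul_zero, zero_add, pow_one]
  | succ r ih => exact (columnSum_succ r).trans ih

theorem tendsto_eta_two_mul_columnSum :
    Tendsto (fun r => eta 2 * columnSum r) atTop
      (𝓝 (qPochInf (-X) X * ∑' m : ℕ, X ^ m * recipPoch (X ^ 2) m)) := by
  have hcolumn (r : ℕ) : HasSum (fun m => eta 2 * columnTerm r m) (eta 2 * columnSum r) :=
    (summable_columnTerm r).hasSum.mul_left (eta 2)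
  have heuler : Summable fun m : ℕ => X ^ m * recipPoch (X ^ 2 : ℤ⟦X⟧) m :=
    summable_pow_mul_recipPoch (X ^ 2) dvd_rfl
  refine tendsto_of_hasSum_of_X_pow_dvd_sub hcolumn
    (heuler.hasSum.mul_left (qPochInf (-X) X)) fun r m => ?_
  have hpoch := (pow_dvd_pow X (by omega : r ≤ 2 * (r + m))).trans
    (X_pow_dvd_qPochInf_sub (-X : ℤ⟦X⟧) dvd_rfl (2 * (r + m)))
  have hrecip := (pow_dvd_pow X (by omega : r ≤ m + 2 * r + 1)).trans
    (X_pow_dvd_qPochInf_mul_recipPoch_sub_one (R := ℤ) (X_dvd_X_pow 2) (m + 2 * r + 1))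
  have hsub := (dvd_sub (hrecip.mul_left (qPoch (-X) X (2 * (r + m)))) hpoch).mul_left
    (X ^ m * recipPoch (X ^ 2) m)
  convert hsub using 1
  rw [columnTerm, eta]
  ring

theorem one_add_X_pow_mul_columnSum_mul_theta (r : ℕ) :
    (1 + X ^ (2 * r + 1)) * columnSum r * theta = 1 := by
  have hlim : Tendsto (fun r => (1 + X ^ (2 * r + 1)) * (eta 2 * columnSum r)) atTop
      (𝓝 (1 * (qPochInf (-X) X * ∑' m : ℕ, X ^ m * recipPoch (X ^ 2) m))) := by
    refine Tendsto.mul (tendsto_of_X_pow_dvd_sub tendsto_id fun r => ?_)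
      tendsto_eta_two_mul_columnSum
    rw [add_sub_cancel_left]
    exact pow_dvd_pow X (by simp only [id]; omega)
  simp_rw [mul_left_comm _ (eta 2), one_add_X_pow_mul_columnSum] at hlim
  have hconst := tendsto_nhds_unique tendsto_const_nhds hlim
  have heuler := qPochInf_mul_tsum_pow_mul_recipPoch (R := ℤ) (X_dvd_X_pow 2) (dvd_refl X)
  have hprod : qPochInf (-X) X * qPochInf X (X ^ 2) * eta 1 = eta 1 := by
    rw [mul_right_comm, qPochInf_neg_X_mul_eta, mul_comm, qPochInf_X_X_sq_mul_eta]
  rw [one_add_X_pow_mul_columnSum, theta]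
  refine (isUnit_eta 1).mul_right_cancel ?_
  linear_combination qPochInf X (X ^ 2) ^ 2 * eta 1 * hconst +
    qPochInf (-X) X * qPochInf X (X ^ 2) * eta 1 * heuler + hprod

theorem phiTerm_eq_sum (n : ℕ) :
    phiTerm n = ∑ p ∈ antidiagonal n,
      partialFractionCoeff p.1 * (X ^ (p.1 + 1) * columnTerm p.1 p.2) := by
  have hinv := left_inv_eq_right_inv (sum_partialFractionTerm_mul n) (denom_mul_invOfUnit n)
  rw [phiTerm, ← hinv, Finset.mul_sum]
  refine Finset.sum_congr rfl fun p hp => ?_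
  rw [partialFractionTerm, columnTerm, ← mem_antidiagonal.mp hp]
  ring

theorem tendsto_add_cofinite : Tendsto (fun p : ℕ × ℕ => p.1 + p.2) cofinite atTop := by
  refine tendsto_atTop.mpr fun b => eventually_cofinite.mpr ?_
  refine (Set.finite_Iic (b, b)).subset fun p hp => ?_
  simp only [Set.mem_ofPred_eq, Set.mem_Iic, Prod.le_def] at hp ⊢
  omega

theorem hasSum_antidiagonal_iff_hasSum_rows {F : ℕ × ℕ → ℤ⟦X⟧} {g : ℕ → ℤ⟦X⟧} {S : ℤ⟦X⟧}
    (hF : ∀ p, X ^ (p.1 + p.2) ∣ F p) (hg : ∀ i, HasSum (fun j => F (i, j)) (g i)) :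
    HasSum (fun n => ∑ p ∈ antidiagonal n, F p) S ↔ HasSum g S := by
  have hsum := (summable_of_X_pow_dvd tendsto_add_cofinite hF).hasSum
  have hrows := hsum.prod_fiberwise hg
  have hdiag : HasSum (fun n => ∑ p ∈ antidiagonal n, F p) (∑' p, F p) :=
    (Finset.HasAntidiagonal.sigmaAntidiagonalEquivProd.hasSum_iff.mpr hsum).sigma
      fun n => Finset.hasSum (antidiagonal n) F
  exact ⟨fun h => h.unique hdiag ▸ hrows, fun h => h.unique hrows ▸ hdiag⟩

theorem X_pow_dvd_partialFractionCoeff (r : ℕ) : X ^ r ∣ partialFractionCoeff r :=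
  (((pow_dvd_pow X (by nlinarith)).mul_left _).mul_right _).mul_right _

theorem hasSum_phi_mul_theta :
    HasSum (fun r : ℕ => (-1) ^ r * X ^ ((r + 1) ^ 2) * (1 - X ^ (2 * r + 1))⁻¹ʳ)
      (phi * theta) := by
  have hdvd (p : ℕ × ℕ) : X ^ (p.1 + p.2) ∣
      partialFractionCoeff p.1 * (X ^ (p.1 + 1) * columnTerm p.1 p.2) := by
    rw [pow_add]
    exact mul_dvd_mul (X_pow_dvd_partialFractionCoeff p.1)
      ((X_pow_dvd_columnTerm p.1 p.2).mul_left _)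
  have hcolumn (r : ℕ) :
      HasSum (fun m => partialFractionCoeff r * (X ^ (r + 1) * columnTerm r m))
        (partialFractionCoeff r * (X ^ (r + 1) * columnSum r)) :=
    ((summable_columnTerm r).hasSum.mul_left _).mul_left _
  have hdiag := hasSum_phiTerm
  rw [funext phiTerm_eq_sum] at hdiag
  have hrows := (hasSum_antidiagonal_iff_hasSum_rows hdvd hcolumn).mp hdiag
  refine (hrows.mul_right theta).congr_fun fun r => ?_
  rw [partialFractionCoeff]
  linear_combination -((-1) ^ r * X ^ ((r + 1) ^ 2) * (1 - X ^ (2 * r + 1))⁻¹ʳ) *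
    one_add_X_pow_mul_columnSum_mul_theta r

/-- The coefficients of the Appell–Lerch sum for `φ` after expanding the geometric series and
collecting the terms with a given sum of the two indices. -/
noncomputable def appellTerm (k : ℕ) : ℤ⟦X⟧ :=
  ∑ p ∈ antidiagonal k, (-1) ^ p.1 * X ^ ((p.1 + 1) ^ 2 + (2 * p.1 + 1) * p.2)

theorem appellTerm_succ (k : ℕ) :
    appellTerm (k + 1) = X ^ (k + 2) - X ^ (2 * k + 3) * appellTerm k := by
  rw [appellTerm, Finset.Nat.sum_antidiagonal_succ, appellTerm, Finset.mul_sum, sub_eq_add_neg,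
    ← Finset.sum_neg_distrib]
  congr 1
  · simp only [pow_zero, one_mul]; ring
  · refine Finset.sum_congr rfl fun p hp => ?_
    rw [← mem_antidiagonal.mp hp]
    ring

theorem hasSum_inverse_one_sub_X_pow (k : ℕ) [NeZero k] :
    HasSum (fun i : ℕ => (X ^ k : ℤ⟦X⟧) ^ i) (1 - X ^ k)⁻¹ʳ := by
  have hcoeff : constantCoeff (X ^ k : ℤ⟦X⟧) = 0 := by simp [NeZero.ne k]
  have hmul := WithPiTopology.one_sub_mul_tsum_pow_of_constantCoeff_eq_zero hcoeff
  have hval : ∑' i : ℕ, (X ^ k : ℤ⟦X⟧) ^ i = (1 - X ^ k)⁻¹ʳ := by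
    have h := Ring.inverse_mul_cancel _ (isUnit_one_sub_X_pow (R := ℤ) k)
    exact (left_inv_eq_right_inv h hmul).symm
  exact hval ▸ (WithPiTopology.summable_pow_of_constantCoeff_eq_zero hcoeff).hasSum

theorem hasSum_appellTerm : HasSum appellTerm (phi * theta) := by
  refine (hasSum_antidiagonal_iff_hasSum_rows (fun p => ?_) fun r => ?_).mpr hasSum_phi_mul_theta
  · exact (pow_dvd_pow X (by nlinarith)).mul_left _
  · refine ((hasSum_inverse_one_sub_X_pow (2 * r + 1)).mul_left
      ((-1) ^ r * X ^ ((r + 1) ^ 2))).congr_fun fun i => ?_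
    rw [← pow_mul, pow_add, mul_assoc]

end AppellLerch

section Nonarchimedean

instance {R : Type*} [CommRing R] [TopologicalSpace R] [IsTopologicalRing R]
    [IsLinearTopology R R] : NonarchimedeanRing R⟦X⟧ where
  is_nonarchimedean U hU := by
    obtain ⟨I, hI, hIU⟩ := (IsLinearTopology.hasBasis_open_ideal (R := R⟦X⟧)).mem_iff.mp hU
    exact ⟨⟨I.toAddSubgroup, hI⟩, hIU⟩

end Nonarchimedean

section Convolution

variable {ι R : Type*} [AddCommGroup ι]

/-- The convolution of two families indexed by an additive group. -/
noncomputable def conv [Ring R] [TopologicalSpace R] (f g : ι → R) (k : ι) : R :=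
  ∑' n, f n * g (k - n)

theorem conv_reflect [Ring R] [TopologicalSpace R] {f g : ι → R} {b c : ι}
    (hf : ∀ n, f (b - n) = f n) (hg : ∀ n, g (c - n) = g n) (k : ι) :
    conv f g (b + c - k) = conv f g k := by
  rw [conv, ← (Equiv.subLeft b).tsum_eq]
  refine tsum_congr fun n => ?_
  rw [Equiv.subLeft_apply, hf, show b + c - k - (b - n) = c - (k - n) by abel, hg]

variable [Ring R] [UniformSpace R] [IsUniformAddGroup R] [NonarchimedeanRing R] [CompleteSpace R]
  {f g : ι → R} {A B : R}

theorem summable_mul_sub (hf : HasSum f A) (hg : HasSum g B) (k : ι) :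
    Summable fun n => f n * g (k - n) := by
  have hinj : Function.Injective fun n => (n, k - n) := fun m n h => (Prod.ext_iff.mp h).1
  exact (hf.mul_of_nonarchimedean hg).summable.comp_injective hinj

theorem hasSum_conv (hf : HasSum f A) (hg : HasSum g B) : HasSum (conv f g) (A * B) := by
  have hmul := (Equiv.sigmaFiberEquiv fun p : ι × ι => p.1 + p.2).hasSum_iff.mpr
    (hf.mul_of_nonarchimedean hg)
  refine hmul.sigma fun k => ?_
  let e : ι ≃ {p : ι × ι // p.1 + p.2 = k} :=
    { toFun := fun n => ⟨(n, k - n), add_sub_cancel n k⟩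
      invFun := fun p => p.1.1
      left_inv := fun _ => rfl
      right_inv := fun p => Subtype.ext (Prod.ext rfl (sub_eq_of_eq_add' p.2.symm)) }
  exact e.hasSum_iff.mp (summable_mul_sub hf hg k).hasSum

end Convolution

section LambertSeries

theorem hasSum_int_of_even {f : ℤ → ℤ⟦X⟧} {S : ℤ⟦X⟧} (h0 : f 0 = 0) (hneg : ∀ n, f (-n) = f n)
    (h : HasSum (fun n : ℕ => f (n + 1)) S) : HasSum f (2 * S) := by
  have hint := HasSum.of_add_one_of_neg_add_one (f := f) h (by simpa only [hneg] using h)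
  rwa [h0, add_zero, ← two_mul] at hint

/-- The summand `|m| X ^ |m| / (1 - X ^ (2 |m|))` of a Lambert series. -/
noncomputable def lambertTerm (m : ℤ) : ℤ⟦X⟧ :=
  (m.natAbs : ℤ⟦X⟧) * X ^ m.natAbs * (1 - X ^ (2 * m.natAbs))⁻¹ʳ

/-- The Lambert series `∑_{m ≥ 1} m X ^ m / (1 - X ^ (2 m))`. -/
noncomputable def lambert : ℤ⟦X⟧ := ∑' n : ℕ, lambertTerm (n + 1)

theorem lambertTerm_zero : lambertTerm 0 = 0 := by simp [lambertTerm]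

theorem lambertTerm_neg (m : ℤ) : lambertTerm (-m) = lambertTerm m := by
  rw [lambertTerm, Int.natAbs_neg, lambertTerm]

theorem X_pow_dvd_lambertTerm (m : ℤ) : X ^ m.natAbs ∣ lambertTerm m :=
  (Dvd.intro_left _ rfl).mul_right _

theorem one_sub_mul_lambertTerm (m : ℕ) :
    (1 - X ^ (2 * m)) * lambertTerm m = (m : ℤ⟦X⟧) * X ^ m := by
  rcases eq_or_ne m 0 with rfl | hm
  · simp only [Nat.cast_zero, lambertTerm_zero, mul_zero, zero_mul]
  · have : NeZero m := ⟨hm⟩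
    rw [lambertTerm, Int.natAbs_natCast]
    linear_combination ((m : ℤ⟦X⟧) * X ^ m) *
      Ring.mul_inverse_cancel _ (isUnit_one_sub_X_pow (R := ℤ) (2 * m))

theorem hasSum_lambert : HasSum (fun n : ℕ => lambertTerm (n + 1)) lambert :=
  (summable_of_X_pow_dvd (e := id) (Nat.cofinite_eq_atTop ▸ tendsto_id)
    fun n => (pow_dvd_pow X (by simp only [id]; omega)).trans (X_pow_dvd_lambertTerm _)).hasSum

theorem hasSum_lambertTerm : HasSum lambertTerm (2 * lambert) :=
  hasSum_int_of_even lambertTerm_zero lambertTerm_neg hasSum_lambert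

/-- The terms of the series expansion of `theta`. -/
noncomputable def thetaSummand (n : ℤ) : ℤ⟦X⟧ :=
  ((n.negOnePow : ℤ) : ℤ⟦X⟧) * X ^ n.natAbs ^ 2

theorem thetaSummand_zero : thetaSummand 0 = 1 := by simp [thetaSummand]

theorem thetaSummand_neg (n : ℤ) : thetaSummand (-n) = thetaSummand n := by
  rw [thetaSummand, Int.negOnePow_neg, Int.natAbs_neg, thetaSummand]

theorem thetaSummand_succ (k : ℕ) :
    thetaSummand (k + 1) = -(X ^ (2 * k + 1) * thetaSummand k) := by
  have hexp : (k + 1 : ℤ).natAbs ^ 2 = 2 * k + 1 + (k : ℤ).natAbs ^ 2 := by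
    zify; rw [sq_abs, sq_abs]; ring
  rw [thetaSummand, thetaSummand, hexp, Int.negOnePow_succ]
  push_cast
  ring

/-- The convolution of the theta series with the Lambert series; up to an explicit correction, its
values are the diagonals of the Appell–Lerch sum for `φ`. -/
noncomputable def thetaLambert : ℤ → ℤ⟦X⟧ := conv thetaSummand lambertTerm

theorem hasSum_thetaSummand_mul_lambertTerm (k : ℤ) :
    HasSum (fun n => thetaSummand n * lambertTerm (k - n)) (thetaLambert k) :=
  (summable_mul_sub hasSum_theta hasSum_lambertTerm k).hasSum

theorem hasSum_thetaLambert : HasSum thetaLambert (theta * (2 * lambert)) :=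
  hasSum_conv hasSum_theta hasSum_lambertTerm

theorem thetaLambert_neg (k : ℤ) : thetaLambert (-k) = thetaLambert k := by
  have h := conv_reflect (b := 0) (c := 0) (f := thetaSummand) (g := lambertTerm)
    (fun n => by rw [zero_sub, thetaSummand_neg]) (fun n => by rw [zero_sub, lambertTerm_neg]) k
  rwa [zero_add, zero_sub] at h

theorem expand_two_X_pow (n : ℕ) : expand 2 two_ne_zero (X ^ n : ℤ⟦X⟧) = X ^ (2 * n) := by
  rw [map_pow, expand_X, ← pow_mul]

theorem hasSum_expand {ι : Type*} {f : ι → ℤ⟦X⟧} {S : ℤ⟦X⟧} (h : HasSum f S) {m : ℕ}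
    (hm : m ≠ 0) : HasSum (fun i => expand m hm (f i)) (expand m hm S) :=
  h.map (expand m hm) (continuous_expand hm)

/-- The terms `(-1) ^ n X ^ (n (n + 1))`. -/
noncomputable def pronicTerm (n : ℤ) : ℤ⟦X⟧ :=
  ((n.negOnePow : ℤ) : ℤ⟦X⟧) * X ^ (2 * triangle n)

theorem expand_two_negOnePow_mul_X_pow_triangle (n : ℤ) :
    expand 2 two_ne_zero (((n.negOnePow : ℤ) : ℤ⟦X⟧) * X ^ triangle n) = pronicTerm n := by
  rw [map_mul, map_intCast, expand_two_X_pow, pronicTerm]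

theorem hasSum_pronicTerm : HasSum pronicTerm 0 := by
  simpa only [expand_two_negOnePow_mul_X_pow_triangle, map_zero] using
    hasSum_expand hasSum_negOnePow_mul_X_pow_triangle two_ne_zero

theorem hasSum_mul_pronicTerm : HasSum (fun n : ℤ => (n : ℤ⟦X⟧) * pronicTerm n) (eta 2 ^ 3) := by
  have h := hasSum_expand hasSum_mul_negOnePow_mul_X_pow_triangle two_ne_zero
  rw [map_pow, expand_eta, mul_one] at h
  refine h.congr_fun fun n => ?_
  rw [map_mul, map_intCast, expand_two_negOnePow_mul_X_pow_triangle]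

theorem thetaSummand_mul_lambertTerm_of_le {k m : ℕ} {n : ℤ} (h : k - n = m) :
    (X ^ (2 * k + 1) * thetaSummand n + thetaSummand (n + 1)) * lambertTerm m =
      -(X ^ (k + 1) * ((m : ℤ⟦X⟧) * pronicTerm n)) := by
  have hexp₁ : 2 * k + 1 + n.natAbs ^ 2 = (n + 1).natAbs ^ 2 + 2 * m := by
    zify; rw [sq_abs, sq_abs]; linear_combination 2 * h
  have hexp₂ : k + 1 + 2 * triangle n = (n + 1).natAbs ^ 2 + m := by
    zify; rw [sq_abs, two_mul_triangle]; linear_combination h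
  have hX₁ := congrArg (fun i => (X : ℤ⟦X⟧) ^ i) hexp₁
  have hX₂ := congrArg (fun i => (X : ℤ⟦X⟧) ^ i) hexp₂
  simp only [pow_add _ _ (2 * m), pow_add _ _ m, pow_add _ (2 * k + 1),
    pow_add _ (k + 1)] at hX₁ hX₂
  rw [thetaSummand, thetaSummand, pronicTerm, Int.negOnePow_succ]
  push_cast
  linear_combination ((n.negOnePow : ℤ) : ℤ⟦X⟧) * (lambertTerm m * hX₁ + (m : ℤ⟦X⟧) * hX₂ -
    X ^ (n + 1).natAbs ^ 2 * one_sub_mul_lambertTerm m)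

theorem thetaSummand_mul_lambertTerm_of_ge {k m : ℕ} {n : ℤ} (h : n - k = m) :
    (X ^ (2 * k + 1) * thetaSummand n + thetaSummand (n + 1)) * lambertTerm m =
      X ^ (k + 1) * ((m : ℤ⟦X⟧) * pronicTerm n) := by
  have hexp₁ : 2 * k + 1 + n.natAbs ^ 2 + 2 * m = (n + 1).natAbs ^ 2 := by
    zify; rw [sq_abs, sq_abs]; linear_combination -2 * h
  have hexp₂ : k + 1 + 2 * triangle n = 2 * k + 1 + n.natAbs ^ 2 + m := by
    zify; rw [sq_abs, two_mul_triangle]; linear_combination h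
  have hX₁ := congrArg (fun i => (X : ℤ⟦X⟧) ^ i) hexp₁
  have hX₂ := congrArg (fun i => (X : ℤ⟦X⟧) ^ i) hexp₂
  simp only [pow_add _ _ (2 * m), pow_add _ _ m, pow_add _ (2 * k + 1),
    pow_add _ (k + 1)] at hX₁ hX₂
  rw [thetaSummand, thetaSummand, pronicTerm, Int.negOnePow_succ]
  push_cast
  linear_combination ((n.negOnePow : ℤ) : ℤ⟦X⟧) * (lambertTerm m * hX₁ - (m : ℤ⟦X⟧) * hX₂ +
    X ^ (2 * k + 1) * X ^ n.natAbs ^ 2 * one_sub_mul_lambertTerm m)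

theorem thetaSummand_mul_lambertTerm (k : ℕ) (n : ℤ) :
    (X ^ (2 * k + 1) * thetaSummand n + thetaSummand (n + 1)) * lambertTerm (k - n) =
      X ^ (k + 1) * ((n : ℤ⟦X⟧) * pronicTerm n - (k : ℤ⟦X⟧) * pronicTerm n) := by
  obtain ⟨m, hm | hm⟩ := ((k : ℤ) - n).eq_nat_or_neg
  · have hcast : (m : ℤ⟦X⟧) = k - n := by rw [← Int.cast_natCast m, ← hm]; push_cast; rfl
    rw [hm, thetaSummand_mul_lambertTerm_of_le hm, hcast]
    ring
  · have hsub : n - k = m := by linarith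
    have hcast : (m : ℤ⟦X⟧) = n - k := by rw [← Int.cast_natCast m, ← hsub]; push_cast; rfl
    rw [hm, lambertTerm_neg, thetaSummand_mul_lambertTerm_of_ge hsub, hcast]
    ring

theorem thetaLambert_succ (k : ℕ) :
    thetaLambert (k + 1) = X ^ (k + 1) * eta 2 ^ 3 - X ^ (2 * k + 1) * thetaLambert k := by
  have hshift := (Equiv.addRight (1 : ℤ)).hasSum_iff.mpr
    (hasSum_thetaSummand_mul_lambertTerm (k + 1))
  have hadd := ((hasSum_thetaSummand_mul_lambertTerm k).mul_left (X ^ (2 * k + 1))).add hshift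
  have hpronic := (hasSum_mul_pronicTerm.sub (hasSum_pronicTerm.mul_left (k : ℤ⟦X⟧))).mul_left
    (X ^ (k + 1))
  have heq := hadd.unique (hpronic.congr_fun fun n => ?_)
  · linear_combination heq
  · rw [← thetaSummand_mul_lambertTerm, Function.comp_apply, Equiv.coe_addRight,
      add_sub_add_right_eq_sub]
    ring

theorem thetaLambert_succ_eq (k : ℕ) : thetaLambert (k + 1) =
    eta 2 ^ 3 * appellTerm k + thetaSummand (k + 1) * thetaLambert 0 := by
  induction k with
  | zero =>
    have hrec := thetaLambert_succ 0
    have hterm := thetaSummand_succ 0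
    have happell : appellTerm 0 = X := by simp [appellTerm]
    simp only [Nat.cast_zero, thetaSummand_zero] at hrec hterm ⊢
    rw [hrec, hterm, happell]
    ring
  | succ k ih =>
    have hrec := thetaLambert_succ (k + 1)
    have hterm := thetaSummand_succ (k + 1)
    push_cast at hrec hterm ⊢
    rw [hrec, ih, hterm, appellTerm_succ]
    ring

theorem two_mul_eta_pow_mul_phi : 2 * (eta 2 ^ 3 * phi) + thetaLambert 0 = 2 * lambert := by
  have hsucc (k : ℕ) : eta 2 ^ 3 * appellTerm k =
      thetaLambert (k + 1) - thetaSummand (k + 1) * thetaLambert 0 := by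
    rw [thetaLambert_succ_eq, add_sub_cancel_right]
  have hleft := hasSum_int_of_even
    (f := fun k => thetaLambert k - thetaSummand k * thetaLambert 0)
    (by rw [thetaSummand_zero, one_mul, sub_self])
    (fun k => by rw [thetaLambert_neg, thetaSummand_neg])
    ((hasSum_appellTerm.mul_left (eta 2 ^ 3)).congr_fun fun k => (hsucc k).symm)
  have hright := hasSum_thetaLambert.sub (hasSum_theta.mul_right (thetaLambert 0))
  have hne : theta ≠ 0 := by
    refine ne_of_apply_ne constantCoeff ?_
    rw [constantCoeff_theta, map_zero]
    exact one_ne_zero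
  refine mul_right_cancel₀ hne ?_
  linear_combination hleft.unique hright

end LambertSeries

section BilateralSeries

/-- The series `1 / (1 + X ^ (2 u + 1))`. -/
noncomputable def oddRecip (u : ℕ) : ℤ⟦X⟧ := (1 + X ^ (2 * u + 1))⁻¹ʳ

theorem one_add_X_pow_mul_oddRecip (u : ℕ) : (1 + X ^ (2 * u + 1)) * oddRecip u = 1 :=
  Ring.mul_inverse_cancel _ (isUnit_iff_constantCoeff.mpr (by simp))

/-- The rational function `1 / (1 + X ^ (2 m + 1))` of `X`, expanded as a power series for every
integer `m`. -/
noncomputable def bilateralRecip : ℤ → ℤ⟦X⟧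
  | Int.ofNat u => oddRecip u
  | Int.negSucc u => X ^ (2 * u + 1) * oddRecip u

/-- The rational function `X ^ m / (1 + X ^ (2 m + 1))` of `X`, expanded as a power series for every
integer `m`. -/
noncomputable def bilateralTerm : ℤ → ℤ⟦X⟧
  | Int.ofNat u => X ^ u * oddRecip u
  | Int.negSucc u => X ^ u * oddRecip u

theorem eq_natCast_or_eq_neg_one_sub (m : ℤ) : (∃ u : ℕ, m = u) ∨ ∃ u : ℕ, m = -1 - u := by
  rcases le_or_gt 0 m with h | h
  · exact Or.inl ⟨m.toNat, by omega⟩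
  · exact Or.inr ⟨(-1 - m).toNat, by omega⟩

theorem neg_one_sub_natCast (u : ℕ) : -1 - (u : ℤ) = Int.negSucc u := by omega

theorem bilateralRecip_natCast (u : ℕ) : bilateralRecip u = oddRecip u := rfl

theorem bilateralRecip_neg_one_sub_natCast (u : ℕ) :
    bilateralRecip (-1 - u) = X ^ (2 * u + 1) * oddRecip u := by
  rw [neg_one_sub_natCast, bilateralRecip]

theorem bilateralTerm_natCast (u : ℕ) : bilateralTerm u = X ^ u * oddRecip u := rfl

theorem bilateralTerm_neg_one_sub (m : ℤ) : bilateralTerm (-1 - m) = bilateralTerm m := by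
  obtain ⟨u, rfl⟩ | ⟨u, rfl⟩ := eq_natCast_or_eq_neg_one_sub m
  · rw [neg_one_sub_natCast]; rfl
  · rw [sub_sub_cancel, neg_one_sub_natCast]; rfl

theorem bilateralRecip_neg_one_sub (m : ℤ) : bilateralRecip (-1 - m) = 1 - bilateralRecip m := by
  obtain ⟨u, rfl⟩ | ⟨u, rfl⟩ := eq_natCast_or_eq_neg_one_sub m
  · rw [bilateralRecip_neg_one_sub_natCast, bilateralRecip_natCast]
    linear_combination one_add_X_pow_mul_oddRecip u
  · rw [sub_sub_cancel, bilateralRecip_neg_one_sub_natCast, bilateralRecip_natCast]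
    linear_combination one_add_X_pow_mul_oddRecip u

theorem X_pow_dvd_bilateralTerm (m : ℤ) : X ^ (m.natAbs - 1) ∣ bilateralTerm m := by
  obtain ⟨u, rfl⟩ | ⟨u, rfl⟩ := eq_natCast_or_eq_neg_one_sub m
  · exact (pow_dvd_pow X (by omega)).mul_right _
  · rw [bilateralTerm_neg_one_sub]
    exact (pow_dvd_pow X (by omega)).mul_right _

/-- The bilateral sum of `X ^ m / (1 + X ^ (2 m + 1))`. -/
noncomputable def bilateralSum : ℤ⟦X⟧ := ∑' m, bilateralTerm m

theorem hasSum_bilateralTerm : HasSum bilateralTerm bilateralSum :=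
  (summable_of_X_pow_dvd (tendsto_natAbs_sub_cofinite 1) X_pow_dvd_bilateralTerm).hasSum

/-- The difference between `1 / (1 + X ^ (2 m + 1))` and its limit as `m → ±∞`. -/
noncomputable def bilateralTail (m : ℤ) : ℤ⟦X⟧ := bilateralRecip m - if 0 ≤ m then 1 else 0

theorem X_pow_dvd_bilateralTail (m : ℤ) : X ^ (m.natAbs - 0) ∣ bilateralTail m := by
  obtain ⟨u, rfl⟩ | ⟨u, rfl⟩ := eq_natCast_or_eq_neg_one_sub m
  · have htail : bilateralTail u = X ^ (2 * u + 1) * -oddRecip u := by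
      rw [bilateralTail, if_pos (by omega), bilateralRecip_natCast]
      linear_combination one_add_X_pow_mul_oddRecip u
    rw [htail]
    exact (pow_dvd_pow X (by omega)).mul_right _
  · rw [bilateralTail, if_neg (by omega), sub_zero, bilateralRecip_neg_one_sub_natCast]
    exact (pow_dvd_pow X (by omega)).mul_right _

theorem hasSum_bilateralRecip_sub (d : ℕ) :
    HasSum (fun m => bilateralRecip m - bilateralRecip (m - d)) (d : ℤ⟦X⟧) := by
  have htail := (summable_of_X_pow_dvd (tendsto_natAbs_sub_cofinite 0)
    X_pow_dvd_bilateralTail).hasSum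
  have hshift := (Equiv.subRight (d : ℤ)).hasSum_iff.mpr htail
  have hfinite : HasSum (fun m : ℤ => if m ∈ Finset.Ico 0 (d : ℤ) then (1 : ℤ⟦X⟧) else 0) d := by
    have h := hasSum_sum_of_ne_finset_zero (s := Finset.Ico 0 (d : ℤ)) (L := .unconditional ℤ)
      (f := fun m => if m ∈ Finset.Ico 0 (d : ℤ) then (1 : ℤ⟦X⟧) else 0) fun m hm => if_neg hm
    simpa only [Finset.sum_ite_mem, Finset.inter_self, Finset.sum_const, Int.card_Ico, sub_zero,
      Int.toNat_natCast, nsmul_eq_mul, mul_one] using h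
  have hadd := (htail.sub hshift).add hfinite
  rw [sub_self, zero_add] at hadd
  refine hadd.congr_fun fun m => ?_
  simp only [Function.comp_apply, Equiv.subRight_apply, bilateralTail, Finset.mem_Ico, sub_nonneg]
  split_ifs <;> first | omega | ring

/-- The differences of consecutive values of `1 / (1 + X ^ (2 m + 1))`. -/
noncomputable def bilateralDiff (m : ℤ) : ℤ⟦X⟧ := bilateralRecip m - bilateralRecip (m - 1)

theorem hasSum_bilateralDiff : HasSum bilateralDiff 1 := by
  have h := hasSum_bilateralRecip_sub 1
  rwa [Nat.cast_one] at h

theorem X_pow_dvd_bilateralDiff (m : ℤ) : X ^ (m.natAbs - 1) ∣ bilateralDiff m := by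
  rcases eq_or_ne m 0 with rfl | hm
  · exact one_dvd _
  · have hdiff : bilateralDiff m = bilateralTail m - bilateralTail (m - 1) := by
      rw [bilateralDiff, bilateralTail, bilateralTail]
      split_ifs <;> first | omega | ring
    rw [hdiff]
    exact dvd_sub ((pow_dvd_pow X (by omega)).trans (X_pow_dvd_bilateralTail m))
      ((pow_dvd_pow X (by omega)).trans (X_pow_dvd_bilateralTail (m - 1)))

theorem summable_mul_bilateralDiff : Summable fun m : ℤ => (m : ℤ⟦X⟧) * bilateralDiff m :=
  summable_of_X_pow_dvd (tendsto_natAbs_sub_cofinite 1) fun m =>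
    (X_pow_dvd_bilateralDiff m).mul_left _

theorem X_pow_mul_pronicTerm_neg {a b : ℕ} {n : ℤ} (h : a = b + 2 * n) :
    X ^ a * pronicTerm (-n) = X ^ b * pronicTerm n := by
  have hexp : a + 2 * triangle (-n) = b + 2 * triangle n := by
    zify; rw [two_mul_triangle, two_mul_triangle]; linear_combination h
  rw [pronicTerm, pronicTerm, Int.negOnePow_neg, mul_left_comm, ← pow_add, hexp, pow_add,
    mul_left_comm]

theorem X_pow_mul_pronicTerm_neg_eq_thetaSummand {a b : ℕ} {n : ℤ} (h : a = b + n) :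
    X ^ a * pronicTerm (-n) = X ^ b * thetaSummand n := by
  have hexp : a + 2 * triangle (-n) = b + n.natAbs ^ 2 := by
    zify; rw [two_mul_triangle, sq_abs]; linear_combination h
  rw [pronicTerm, thetaSummand, Int.negOnePow_neg, mul_left_comm, ← pow_add, hexp, pow_add,
    mul_left_comm]

theorem pronicTerm_neg_one_sub (n : ℤ) : pronicTerm (-1 - n) = -pronicTerm n := by
  have htriangle : triangle (-1 - n) = triangle n := by
    rw [← neg_add', triangle_neg, add_sub_cancel_left]
  rw [pronicTerm, htriangle, ← neg_add', Int.negOnePow_neg, add_comm, Int.negOnePow_succ,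
    pronicTerm]
  push_cast
  ring

theorem hasSum_pronicTerm_neg : HasSum (fun n => pronicTerm (-n)) 0 :=
  (Equiv.neg ℤ).hasSum_iff.mpr hasSum_pronicTerm

theorem hasSum_mul_pronicTerm_neg :
    HasSum (fun n : ℤ => (n : ℤ⟦X⟧) * pronicTerm (-n)) (-eta 2 ^ 3) := by
  refine ((Equiv.neg ℤ).hasSum_iff.mpr hasSum_mul_pronicTerm).neg.congr_fun fun n => ?_
  simp only [Function.comp_apply, Equiv.neg_apply, Int.cast_neg, neg_mul, neg_neg]

/-- The convolution of `(-1) ^ n X ^ (n (n - 1))` with `1 / (1 + X ^ (2 n + 1))`. -/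
noncomputable def pronicRecip : ℤ → ℤ⟦X⟧ := conv (fun n => pronicTerm (-n)) bilateralRecip

theorem hasSum_pronicRecip (k : ℤ) :
    HasSum (fun n => pronicTerm (-n) * bilateralRecip (k - n)) (pronicRecip k) := by
  refine (summable_of_X_pow_dvd (tendsto_natAbs_sub_cofinite 1) fun n => ?_).hasSum
  have hexp : n.natAbs - 1 ≤ 2 * triangle (-n) := by
    have := natAbs_le_triangle_add_one (-n)
    omega
  exact ((pow_dvd_pow X hexp).mul_left _).mul_right _

theorem pronicRecip_neg (k : ℤ) : pronicRecip (-k) = pronicRecip k := by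
  have hreflect := (Equiv.subLeft (1 : ℤ)).hasSum_iff.mpr (hasSum_pronicRecip (-k))
  have hsub := (hasSum_pronicRecip k).sub hasSum_pronicTerm_neg
  rw [sub_zero] at hsub
  refine hreflect.unique (hsub.congr_fun fun n => ?_)
  rw [Function.comp_apply, Equiv.subLeft_apply, show -(1 - n) = -1 - -n by ring,
    pronicTerm_neg_one_sub, show -k - (1 - n) = -1 - (k - n) by ring, bilateralRecip_neg_one_sub]
  ring

theorem pronicTerm_add_mul_bilateralRecip (k : ℕ) (n : ℤ) :
    (pronicTerm n + X ^ (2 * k + 1) * pronicTerm (-n)) * bilateralRecip (k - n) = pronicTerm n := by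
  obtain ⟨u, hu⟩ | ⟨u, hu⟩ := eq_natCast_or_eq_neg_one_sub (k - n)
  · have hpow := X_pow_mul_pronicTerm_neg (a := 2 * k + 1) (b := 2 * u + 1) (n := n)
      (by push_cast; linear_combination 2 * hu)
    rw [hu, bilateralRecip_natCast, hpow]
    linear_combination pronicTerm n * one_add_X_pow_mul_oddRecip u
  · have hpow := X_pow_mul_pronicTerm_neg (a := 2 * k + 1 + (2 * u + 1)) (b := 0) (n := n)
      (by push_cast; linear_combination 2 * hu)
    rw [pow_zero, one_mul, pow_add] at hpow
    rw [hu, bilateralRecip_neg_one_sub_natCast, ← hpow]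
    linear_combination X ^ (2 * k + 1) * X ^ (2 * u + 1) * pronicTerm (-n) *
      one_add_X_pow_mul_oddRecip u

theorem pronicRecip_succ (k : ℕ) :
    pronicRecip (k + 1) = X ^ (2 * k + 1) * pronicRecip k := by
  have hshift := (Equiv.addRight (1 : ℤ)).hasSum_iff.mpr (hasSum_pronicRecip (k + 1))
  have hsub := hshift.sub ((hasSum_pronicRecip k).mul_left (X ^ (2 * k + 1)))
  have hzero := hasSum_pronicTerm.neg
  rw [neg_zero] at hzero
  refine sub_eq_zero.mp (hsub.unique (hzero.congr_fun fun n => ?_))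
  rw [Function.comp_apply, Equiv.coe_addRight, add_sub_add_right_eq_sub,
    show -(n + 1) = -1 - n by ring, pronicTerm_neg_one_sub]
  linear_combination -pronicTerm_add_mul_bilateralRecip k n

theorem pronicRecip_eq (k : ℤ) : pronicRecip k = X ^ k.natAbs ^ 2 * pronicRecip 0 := by
  have hnat (k : ℕ) : pronicRecip k = X ^ k ^ 2 * pronicRecip 0 := by
    induction k with
    | zero => rw [Nat.cast_zero, zero_pow two_ne_zero, pow_zero, one_mul]
    | succ k ih =>
      rw [Nat.cast_succ, pronicRecip_succ, ih]
      ring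
  obtain ⟨n, rfl | rfl⟩ := k.eq_nat_or_neg
  · rw [hnat, Int.natAbs_natCast]
  · rw [pronicRecip_neg, hnat, Int.natAbs_neg, Int.natAbs_natCast]

theorem pronicRecip_sub (k : ℤ) :
    pronicRecip k - pronicRecip (k - 1) = conv (fun n => pronicTerm (-n)) bilateralDiff k := by
  refine (((hasSum_pronicRecip k).sub (hasSum_pronicRecip (k - 1))).congr_fun
    fun n => ?_).tsum_eq.symm
  rw [bilateralDiff, sub_right_comm, mul_sub]

theorem conv_mul_add_conv_mul {f g : ℤ → ℤ⟦X⟧} {k : ℤ}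
    (hfg : Summable fun n : ℤ => f n * g (k - n))
    (hf : Summable fun n : ℤ => (n : ℤ⟦X⟧) * f n * g (k - n)) :
    conv (fun n : ℤ => (n : ℤ⟦X⟧) * f n) g k + conv f (fun n : ℤ => (n : ℤ⟦X⟧) * g n) k =
      (k : ℤ⟦X⟧) * conv f g k := by
  have hg : HasSum (fun n : ℤ => f n * (((k - n : ℤ) : ℤ⟦X⟧) * g (k - n)))
      (k * conv f g k - conv (fun n : ℤ => (n : ℤ⟦X⟧) * f n) g k) := by
    refine ((hfg.hasSum.mul_left _).sub hf.hasSum).congr_fun fun n => ?_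
    push_cast
    ring
  exact (congrArg _ hg.tsum_eq).trans (add_sub_cancel _ _)

theorem pronicRecip_zero_mul_thetaPos : pronicRecip 0 * thetaPos = eta 2 ^ 3 := by
  have hsum : HasSum pronicRecip (thetaPos * pronicRecip 0) :=
    (hasSum_thetaPos.mul_right (pronicRecip 0)).congr_fun pronicRecip_eq
  have hsummable : Summable fun k : ℤ => (k : ℤ⟦X⟧) * pronicRecip k :=
    summable_of_X_pow_dvd (tendsto_natAbs_sub_cofinite 0) fun k => by
      rw [pronicRecip_eq]
      exact ((pow_dvd_pow X (by rw [Nat.sub_zero]; exact Nat.le_self_pow two_ne_zero _)).mul_right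
        _).mul_left _
  have hsum_shift := (Equiv.subRight (1 : ℤ)).hasSum_iff.mpr hsum
  have hmul_shift := (Equiv.subRight (1 : ℤ)).hasSum_iff.mpr hsummable.hasSum
  have hleft := (hsummable.hasSum.sub hmul_shift).sub hsum_shift
  have hdiff := summable_mul_bilateralDiff.hasSum
  have hright := (hasSum_conv hasSum_mul_pronicTerm_neg hasSum_bilateralDiff).add
    (hasSum_conv hasSum_pronicTerm_neg hdiff)
  have heq := hleft.unique (hright.congr_fun fun k => ?_)
  · linear_combination -heq
  · rw [conv_mul_add_conv_mul
      (summable_mul_sub hasSum_pronicTerm_neg hasSum_bilateralDiff k)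
      (summable_mul_sub hasSum_mul_pronicTerm_neg hasSum_bilateralDiff k), ← pronicRecip_sub]
    simp only [Function.comp_apply, Equiv.subRight_apply]
    push_cast
    ring

theorem thetaSummand_mul_bilateralTerm (k : ℕ) (n : ℤ) :
    thetaSummand n * bilateralTerm (k - n) =
      X ^ k * (pronicTerm (-n) * bilateralRecip (k - n)) := by
  obtain ⟨u, hu⟩ | ⟨u, hu⟩ := eq_natCast_or_eq_neg_one_sub (k - n)
  · have hpow := X_pow_mul_pronicTerm_neg_eq_thetaSummand (a := k) (b := u) (n := n)
      (by linear_combination hu)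
    rw [hu, bilateralTerm_natCast, bilateralRecip_natCast]
    linear_combination -oddRecip u * hpow
  · have hpow := X_pow_mul_pronicTerm_neg_eq_thetaSummand (a := k + (2 * u + 1)) (b := u) (n := n)
      (by push_cast; linear_combination hu)
    rw [hu, bilateralTerm_neg_one_sub, bilateralTerm_natCast, bilateralRecip_neg_one_sub_natCast]
    linear_combination -oddRecip u * hpow

theorem conv_thetaSummand_bilateralTerm (k : ℤ) :
    conv thetaSummand bilateralTerm k = X ^ (2 * triangle k) * pronicRecip 0 := by
  have hnat (k : ℕ) :
      conv thetaSummand bilateralTerm k = X ^ (2 * triangle k) * pronicRecip 0 := by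
    have hexp : 2 * triangle k = k + (k : ℤ).natAbs ^ 2 := by
      zify; rw [two_mul_triangle, sq_abs]; ring
    rw [hexp, pow_add, mul_assoc, ← pronicRecip_eq]
    exact (((hasSum_pronicRecip k).mul_left (X ^ k)).congr_fun
      (thetaSummand_mul_bilateralTerm k)).tsum_eq
  obtain ⟨u, rfl⟩ | ⟨u, rfl⟩ := eq_natCast_or_eq_neg_one_sub k
  · exact hnat u
  · have hreflect := conv_reflect (b := 0) (c := -1) (f := thetaSummand) (g := bilateralTerm)
      (fun n => by rw [zero_sub, thetaSummand_neg]) bilateralTerm_neg_one_sub u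
    rw [zero_add] at hreflect
    rw [hreflect, hnat, ← neg_add', triangle_neg, add_sub_cancel_left]

theorem expand_two_psi_mul_eta : expand 2 two_ne_zero psi * eta 2 = eta 4 ^ 2 := by
  have h := congrArg (expand 2 two_ne_zero) psi_mul_eta
  rwa [map_mul, map_pow, expand_eta, expand_eta] at h

theorem theta_mul_bilateralSum :
    theta * bilateralSum = 2 * expand 2 two_ne_zero psi * pronicRecip 0 := by
  have hpsi := hasSum_expand hasSum_two_mul_psi two_ne_zero
  simp only [expand_two_X_pow, map_mul, map_ofNat] at hpsi
  exact (hasSum_conv hasSum_theta hasSum_bilateralTerm).unique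
    ((hpsi.mul_right (pronicRecip 0)).congr_fun conv_thetaSummand_bilateralTerm)

theorem eta_sq_mul_bilateralSum : eta 2 ^ 2 * bilateralSum = 2 * eta 4 ^ 4 := by
  refine mul_left_cancel₀ (pow_ne_zero 3 (eta_ne_zero 2)) ?_
  linear_combination (-(eta 2 * bilateralSum)) * theta_mul_thetaPos +
    (eta 2 * thetaPos * eta 4 ^ 2) * theta_mul_bilateralSum +
    (2 * eta 2 * expand 2 two_ne_zero psi * eta 4 ^ 2) * pronicRecip_zero_mul_thetaPos +
    (2 * eta 2 ^ 3 * eta 4 ^ 2) * expand_two_psi_mul_eta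

end BilateralSeries

section EvalNeg

theorem map_inverse_of_isUnit {M N F : Type*} [MonoidWithZero M] [MonoidWithZero N]
    [FunLike F M N] [MonoidHomClass F M N] (f : F) {x : M} (hx : IsUnit x) :
    f x⁻¹ʳ = (f x)⁻¹ʳ := by
  obtain ⟨u, rfl⟩ := hx
  have h (v : Mˣ) : f v = Units.map (f : M →* N) v := rfl
  rw [Ring.inverse_unit, h, h, map_inv, Ring.inverse_unit]

theorem continuous_evalNegHom {R : Type*} [CommRing R] [TopologicalSpace R] [IsTopologicalRing R] :
    Continuous (evalNegHom : R⟦X⟧ →+* R⟦X⟧) := by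
  refine continuous_of_continuous_coeff fun d => ?_
  simp only [evalNegHom, coeff_rescale]
  exact continuous_const.mul (WithPiTopology.continuous_coeff R d)

theorem hasSum_evalNegHom {ι : Type*} {f : ι → ℤ⟦X⟧} {S : ℤ⟦X⟧} (h : HasSum f S) :
    HasSum (fun i => evalNegHom (f i)) (evalNegHom S) :=
  h.map evalNegHom continuous_evalNegHom

variable {R : Type*} [CommRing R]

theorem evalNegHom_X_pow (n : ℕ) : evalNegHom (X ^ n : R⟦X⟧) = (-1) ^ n * X ^ n := by
  rw [map_pow, evalNegHom_X, neg_pow]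

theorem evalNegHom_X_pow_odd (n : ℕ) :
    evalNegHom (X ^ (2 * n + 1) : R⟦X⟧) = -X ^ (2 * n + 1) := by
  rw [map_pow, evalNegHom_X, Odd.neg_pow ⟨n, rfl⟩]

theorem evalNegHom_expand_two (f : R⟦X⟧) :
    evalNegHom (expand 2 two_ne_zero f) = expand 2 two_ne_zero f := by
  ext n
  rw [evalNegHom, coeff_rescale]
  by_cases h : 2 ∣ n
  · rw [(even_iff_two_dvd.mpr h).neg_one_pow, one_mul]
  · rw [coeff_expand_of_not_dvd _ _ _ h, mul_zero]

theorem evalNegHom_inverse_one_sub_X_pow_even (m : ℕ) [NeZero m] :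
    evalNegHom (1 - X ^ (2 * m) : R⟦X⟧)⁻¹ʳ = (1 - X ^ (2 * m))⁻¹ʳ := by
  rw [map_inverse_of_isUnit evalNegHom (isUnit_one_sub_X_pow (2 * m)), map_sub, map_one,
    evalNegHom_X_pow, pow_mul (-1 : R⟦X⟧), neg_one_sq, one_pow, one_mul]

theorem evalNegHom_inverse_one_sub_X_pow_odd (u : ℕ) :
    evalNegHom (1 - X ^ (2 * u + 1) : ℤ⟦X⟧)⁻¹ʳ = oddRecip u := by
  rw [map_inverse_of_isUnit evalNegHom (isUnit_one_sub_X_pow (2 * u + 1)), map_sub, map_one,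
    evalNegHom_X_pow_odd, sub_neg_eq_add, oddRecip]

theorem neg_one_pow_natAbs (n : ℤ) : (-1 : ℤ⟦X⟧) ^ n.natAbs = ((n.negOnePow : ℤ) : ℤ⟦X⟧) := by
  rw [← Int.negOnePow_abs, Int.abs_eq_natAbs, ← Int.cast_negOnePow_natCast]

theorem evalNegHom_lambertTerm (m : ℤ) :
    evalNegHom (lambertTerm m) = ((m.negOnePow : ℤ) : ℤ⟦X⟧) * lambertTerm m := by
  rcases eq_or_ne m 0 with rfl | hm
  · rw [lambertTerm_zero, map_zero, mul_zero]
  · have : NeZero m.natAbs := ⟨Int.natAbs_ne_zero.mpr hm⟩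
    rw [lambertTerm, map_mul, map_mul, evalNegHom_inverse_one_sub_X_pow_even, evalNegHom_X_pow,
      map_natCast, neg_one_pow_natAbs]
    ring

theorem evalNegHom_thetaSummand (n : ℤ) :
    evalNegHom (thetaSummand n) = ((n.negOnePow : ℤ) : ℤ⟦X⟧) * thetaSummand n := by
  have hsq : (-1 : ℤ⟦X⟧) ^ n.natAbs ^ 2 = (-1) ^ n.natAbs :=
    neg_one_pow_congr (by simp [Nat.even_pow])
  rw [thetaSummand, map_mul, map_intCast, evalNegHom_X_pow, hsq, neg_one_pow_natAbs]

theorem evalNegHom_thetaLambert_zero : evalNegHom (thetaLambert 0) = thetaLambert 0 := by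
  have h := hasSum_thetaSummand_mul_lambertTerm 0
  refine ((hasSum_evalNegHom h).congr_fun fun n => ?_).unique h
  have hsq : ((n.negOnePow : ℤ) : ℤ⟦X⟧) * ((n.negOnePow : ℤ) : ℤ⟦X⟧) = 1 := by
    rw [← Int.cast_mul, ← Units.val_mul, Int.units_mul_self, Units.val_one, Int.cast_one]
  rw [map_mul, evalNegHom_thetaSummand, evalNegHom_lambertTerm, zero_sub, Int.negOnePow_neg]
  linear_combination -(thetaSummand n * lambertTerm (-n)) * hsq

end EvalNeg

section OddLambert

theorem hasSum_succ_mul_X_pow (k : ℕ) [NeZero k] :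
    HasSum (fun i : ℕ => ((i : ℤ⟦X⟧) + 1) * (X ^ k) ^ i) ((1 - X ^ k)⁻¹ʳ ^ 2) := by
  obtain ⟨S, hS⟩ : Summable fun i : ℕ => ((i : ℤ⟦X⟧) + 1) * (X ^ k) ^ i :=
    summable_of_X_pow_dvd (e := id) (Nat.cofinite_eq_atTop ▸ tendsto_id) fun i =>
      (pow_dvd_pow_of_dvd (X_dvd_X_pow k) i).mul_left _
  have hmul : HasSum (fun i : ℕ => (i : ℤ⟦X⟧) * (X ^ k) ^ i) (X ^ k * S) := by
    rw [← hasSum_nat_add_iff' 1]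
    simp only [Finset.sum_range_one, Nat.cast_zero, zero_mul, sub_zero]
    refine (hS.mul_left (X ^ k)).congr_fun fun i => ?_
    push_cast
    ring
  have heq : S - X ^ k * S = (1 - X ^ k)⁻¹ʳ :=
    (hS.sub hmul).unique ((hasSum_inverse_one_sub_X_pow k).congr_fun fun i => by ring)
  have hunit := Ring.mul_inverse_cancel _ (isUnit_one_sub_X_pow (R := ℤ) k)
  have hval : S = (1 - X ^ k)⁻¹ʳ ^ 2 := by
    linear_combination (1 - X ^ k)⁻¹ʳ * heq - S * hunit
  rwa [← hval]

theorem hasSum_lambert_odd :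
    HasSum (fun m : ℕ => X ^ (2 * m + 1) * (1 - X ^ (2 * m + 1))⁻¹ʳ ^ 2) lambert := by
  let F (p : ℕ × ℕ) : ℤ⟦X⟧ := ((p.1 : ℤ⟦X⟧) + 1) * X ^ ((p.1 + 1) * (2 * p.2 + 1))
  obtain ⟨S, hS⟩ : Summable F := summable_of_X_pow_dvd tendsto_add_cofinite fun p =>
    (pow_dvd_pow X (by nlinarith)).mul_left _
  have hrow (k : ℕ) : HasSum (fun m => F (k, m)) (lambertTerm (k + 1)) := by
    rw [← Nat.cast_succ, lambertTerm, Int.natAbs_natCast]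
    refine ((hasSum_inverse_one_sub_X_pow (2 * (k + 1))).mul_left
      (((k + 1 : ℕ) : ℤ⟦X⟧) * X ^ (k + 1))).congr_fun fun m => ?_
    simp only [F]
    push_cast
    ring
  have hcol (m : ℕ) :
      HasSum (fun k => F (k, m)) (X ^ (2 * m + 1) * (1 - X ^ (2 * m + 1))⁻¹ʳ ^ 2) := by
    refine ((hasSum_succ_mul_X_pow (2 * m + 1)).mul_left
      (X ^ (2 * m + 1))).congr_fun fun k => ?_
    simp only [F]
    ring
  have hlambert : S = lambert := (hS.prod_fiberwise hrow).unique hasSum_lambert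
  have hswap := (Equiv.prodComm ℕ ℕ).hasSum_iff.mpr hS
  rw [← hlambert]
  exact hswap.prod_fiberwise hcol

theorem hasSum_X_pow_mul_oddRecip_sq :
    HasSum (fun m : ℕ => X ^ (2 * m + 1) * oddRecip m ^ 2) (-evalNegHom lambert) := by
  refine (hasSum_evalNegHom hasSum_lambert_odd).neg.congr_fun fun m => ?_
  rw [map_mul, evalNegHom_X_pow_odd, map_pow evalNegHom (_⁻¹ʳ),
    evalNegHom_inverse_one_sub_X_pow_odd, neg_mul, neg_neg]

theorem bilateralTerm_mul_bilateralTerm (N : ℕ) (m : ℤ) :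
    (1 - X ^ (2 * (N + 1))) * (bilateralTerm m * bilateralTerm (N - m)) =
      X ^ N * (bilateralRecip m - bilateralRecip (m - (N + 1 : ℕ))) := by
  rw [← bilateralTerm_neg_one_sub (N - m),
    show -1 - (N - m) = m - (N + 1 : ℕ) by push_cast; ring]
  obtain ⟨u, rfl⟩ | ⟨u, rfl⟩ := eq_natCast_or_eq_neg_one_sub m
  · obtain ⟨v, hv⟩ | ⟨v, hv⟩ := eq_natCast_or_eq_neg_one_sub (u - (N + 1 : ℕ))
    · rw [hv]
      simp only [bilateralTerm_natCast, bilateralRecip_natCast]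
      obtain rfl : u = v + N + 1 := by omega
      linear_combination X ^ N * oddRecip (v + N + 1) * one_add_X_pow_mul_oddRecip v -
        X ^ N * oddRecip v * one_add_X_pow_mul_oddRecip (v + N + 1)
    · rw [hv]
      simp only [bilateralTerm_neg_one_sub, bilateralTerm_natCast, bilateralRecip_natCast,
        bilateralRecip_neg_one_sub_natCast]
      obtain rfl : N = u + v := by omega
      linear_combination X ^ (u + v) * oddRecip u * one_add_X_pow_mul_oddRecip v -
        X ^ (u + v) * X ^ (2 * v + 1) * oddRecip v * one_add_X_pow_mul_oddRecip u
  · rw [show -1 - (u : ℤ) - (N + 1 : ℕ) = -1 - (u + N + 1 : ℕ) by push_cast; ring]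
    simp only [bilateralTerm_neg_one_sub, bilateralTerm_natCast,
      bilateralRecip_neg_one_sub_natCast]
    linear_combination X ^ N * X ^ (2 * u + 1) * oddRecip u *
      one_add_X_pow_mul_oddRecip (u + N + 1) - X ^ N * X ^ (2 * (u + N + 1) + 1) *
      oddRecip (u + N + 1) * one_add_X_pow_mul_oddRecip u

/-- The convolution of the terms of `bilateralSum` with themselves, whose sum is
`bilateralSum ^ 2`. -/
noncomputable def bilateralConv : ℤ → ℤ⟦X⟧ := conv bilateralTerm bilateralTerm

theorem hasSum_bilateralTerm_mul (k : ℤ) :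
    HasSum (fun n => bilateralTerm n * bilateralTerm (k - n)) (bilateralConv k) :=
  (summable_mul_sub hasSum_bilateralTerm hasSum_bilateralTerm k).hasSum

theorem X_mul_bilateralConv_natCast (N : ℕ) : X * bilateralConv N = lambertTerm (N + 1) := by
  have hconv := (hasSum_bilateralTerm_mul N).mul_left (1 - X ^ (2 * (N + 1)))
  have hsub := (hasSum_bilateralRecip_sub (N + 1)).mul_left (X ^ N)
  have heq := hconv.unique (hsub.congr_fun (bilateralTerm_mul_bilateralTerm N))
  have hterm := one_sub_mul_lambertTerm (N + 1)
  push_cast at heq hterm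
  refine (isUnit_one_sub_X_pow (2 * (N + 1))).mul_left_cancel ?_
  linear_combination X * heq - hterm

theorem bilateralConv_neg_two_sub (k : ℤ) : bilateralConv (-2 - k) = bilateralConv k :=
  conv_reflect (b := -1) (c := -1) bilateralTerm_neg_one_sub bilateralTerm_neg_one_sub k

theorem X_mul_bilateralConv_neg_one : X * bilateralConv (-1) = -(2 * evalNegHom lambert) := by
  have hnat := hasSum_X_pow_mul_oddRecip_sq.congr_fun fun m : ℕ => (show
    X * (bilateralTerm m * bilateralTerm (-1 - m)) = X ^ (2 * m + 1) * oddRecip m ^ 2 by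
      rw [bilateralTerm_neg_one_sub, bilateralTerm_natCast]; ring)
  have hneg := hasSum_X_pow_mul_oddRecip_sq.congr_fun fun m : ℕ => (show
    X * (bilateralTerm (-(m + 1)) * bilateralTerm (-1 - -(m + 1))) =
      X ^ (2 * m + 1) * oddRecip m ^ 2 by
      rw [show -((m : ℤ) + 1) = -1 - m by ring, sub_sub_cancel, bilateralTerm_neg_one_sub,
        bilateralTerm_natCast]
      ring)
  rw [((hasSum_bilateralTerm_mul (-1)).mul_left X).unique (hnat.of_nat_of_neg_add_one hneg)]
  ring

theorem X_mul_bilateralConv_sub_one (j : ℤ) : X * bilateralConv (j - 1) =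
    lambertTerm j + if j = 0 then -(2 * evalNegHom lambert) else 0 := by
  rcases lt_trichotomy j 0 with h | rfl | h
  · obtain ⟨n, hn⟩ := Int.eq_ofNat_of_zero_le (show 0 ≤ -j - 1 by omega)
    rw [if_neg h.ne, add_zero, show j - 1 = -2 - (n : ℤ) by omega, bilateralConv_neg_two_sub,
      X_mul_bilateralConv_natCast, ← lambertTerm_neg]
    exact congrArg _ (by omega)
  · rw [if_pos rfl, zero_sub, X_mul_bilateralConv_neg_one, lambertTerm_zero, zero_add]
  · obtain ⟨n, hn⟩ := Int.eq_ofNat_of_zero_le (show 0 ≤ j - 1 by omega)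
    rw [if_neg h.ne', add_zero, hn, X_mul_bilateralConv_natCast]
    exact congrArg _ (by omega)

theorem X_mul_bilateralSum_sq :
    X * bilateralSum ^ 2 = 2 * (lambert - evalNegHom lambert) := by
  have hconv := (Equiv.subRight (1 : ℤ)).hasSum_iff.mpr
    ((hasSum_conv hasSum_bilateralTerm hasSum_bilateralTerm).mul_left X)
  have hlambert := hasSum_lambertTerm.add (hasSum_ite_eq (0 : ℤ) (-(2 * evalNegHom lambert)))
  linear_combination hconv.unique (hlambert.congr_fun X_mul_bilateralConv_sub_one)

theorem two_ne_zero_powerSeries : (2 : ℤ⟦X⟧) ≠ 0 :=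
  ne_of_apply_ne constantCoeff (by rw [map_ofNat, map_zero]; exact two_ne_zero)

theorem eta_pow_mul_phi_sub : eta 2 ^ 7 * (phi - evalNegHom phi) = 2 * X * eta 4 ^ 8 := by
  have hphi := two_mul_eta_pow_mul_phi
  have hneg := congrArg evalNegHom hphi
  have heta : evalNegHom (eta 2) = eta 2 := by
    rw [← expand_eta two_ne_zero 1, evalNegHom_expand_two]
  rw [map_add, map_mul, map_mul, map_pow, heta, evalNegHom_thetaLambert_zero, map_mul,
    map_ofNat] at hneg
  refine mul_left_cancel₀ two_ne_zero_powerSeries ?_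
  linear_combination eta 2 ^ 4 * (hphi - hneg) - eta 2 ^ 4 * X_mul_bilateralSum_sq +
    X * (eta 2 ^ 2 * bilateralSum + 2 * eta 4 ^ 4) * eta_sq_mul_bilateralSum

end OddLambert

section Dissection

variable {R : Type*} [CommRing R]

/-- The component of a power series along the exponents congruent to `j` modulo `m`: the
coefficient of `X ^ n` in `dissect m j f` is that of `X ^ (m * n + j)` in `f`. -/
noncomputable def dissect (m j : ℕ) : R⟦X⟧ →ₗ[R] R⟦X⟧ where
  toFun f := mk fun n => coeff (m * n + j) f
  map_add' f g := by ext n; simp only [coeff_mk, map_add]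
  map_smul' c f := by ext n; simp only [coeff_mk, coeff_smul, RingHom.id_apply]

theorem coeff_dissect (m j n : ℕ) (f : R⟦X⟧) :
    coeff n (dissect m j f) = coeff (m * n + j) f :=
  coeff_mk n fun n => coeff (m * n + j) f

theorem sub_evalNegHom (f : R⟦X⟧) :
    f - evalNegHom f = 2 * (X * expand 2 two_ne_zero (dissect 2 1 f)) := by
  ext n
  rw [two_mul, map_add, map_sub, evalNegHom, coeff_rescale]
  obtain ⟨m, rfl | rfl⟩ := n.even_or_odd'
  · have hX : coeff (2 * m) (X * expand 2 two_ne_zero (dissect 2 1 f)) = 0 := by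
      rcases m with _ | m
      · exact coeff_zero_X_mul _
      · rw [show 2 * (m + 1) = 2 * m + 1 + 1 by ring, coeff_succ_X_mul,
          coeff_expand_of_not_dvd _ _ _ (by omega)]
    rw [hX, (even_two_mul m).neg_one_pow, one_mul, sub_self, add_zero]
  · rw [coeff_succ_X_mul, coeff_expand_mul, coeff_dissect, (odd_two_mul_add_one m).neg_one_pow]
    ring

theorem expand_injective {m : ℕ} (hm : m ≠ 0) :
    Function.Injective (expand m hm : R⟦X⟧ → R⟦X⟧) := fun f g h => by
  ext n
  have hn := congrArg (coeff (m * n)) h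
  rwa [coeff_expand_mul, coeff_expand_mul] at hn

theorem eta_pow_mul_dissect_phi : eta 1 ^ 7 * dissect 2 1 phi = eta 2 ^ 8 := by
  refine expand_injective two_ne_zero ?_
  have h := eta_pow_mul_phi_sub
  rw [sub_evalNegHom] at h
  refine mul_left_cancel₀ (mul_ne_zero two_ne_zero_powerSeries (X_ne_zero (R := ℤ))) ?_
  simp only [map_mul, map_pow, expand_eta]
  linear_combination h

end Dissection

section DissectionCalculus

variable {R : Type*} [CommRing R]

theorem dissect_intCast_mul (m j : ℕ) (c : ℤ) (f : R⟦X⟧) :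
    dissect m j ((c : R⟦X⟧) * f) = c * dissect m j f := by
  rw [← zsmul_eq_mul, map_zsmul, zsmul_eq_mul]

theorem dissect_ofNat_mul (m j n : ℕ) [n.AtLeastTwo] (f : R⟦X⟧) :
    dissect m j (ofNat(n) * f) = ofNat(n) * dissect m j f := by
  simpa only [Int.cast_ofNat] using dissect_intCast_mul m j ofNat(n) f

theorem dissect_X_pow_mul_expand {m i j : ℕ} (hm : m ≠ 0) (hi : i < m) (hj : j < m) (f : R⟦X⟧) :
    dissect m j (X ^ i * expand m hm f) = if i = j then f else 0 := by
  ext n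
  rw [coeff_dissect, coeff_X_pow_mul']
  split_ifs with hle h h
  · rw [h, Nat.add_sub_cancel, coeff_expand_mul]
  · have hmod : (m * n + j - i) % m ≠ 0 := by
      rcases le_or_gt i j with hij | hij
      · rw [Nat.add_sub_assoc hij, Nat.mul_add_mod, Nat.mod_eq_of_lt (by omega)]
        omega
      · obtain ⟨k, rfl⟩ : ∃ k, n = k + 1 := Nat.exists_eq_succ_of_ne_zero (by rintro rfl; omega)
        rw [show m * (k + 1) + j - i = m * k + (m + j - i) by rw [mul_add_one]; omega,
          Nat.mul_add_mod, Nat.mod_eq_of_lt (by omega)]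
        omega
    rw [coeff_expand_of_not_dvd _ _ _ fun hdvd => hmod (Nat.mod_eq_zero_of_dvd hdvd), map_zero]
  · omega
  · rw [map_zero]

theorem sum_X_pow_mul_expand_dissect {m : ℕ} (hm : m ≠ 0) (f : R⟦X⟧) :
    ∑ i ∈ Finset.range m, X ^ i * expand m hm (dissect m i f) = f := by
  ext n
  have hmod := Nat.mod_lt n (Nat.pos_of_ne_zero hm)
  have hn := Nat.div_add_mod n m
  rw [map_sum, Finset.sum_eq_single_of_mem (n % m) (Finset.mem_range.mpr hmod)]
  · rw [coeff_X_pow_mul', if_pos (Nat.mod_le n m), show n - n % m = m * (n / m) by omega,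
      coeff_expand_mul, coeff_dissect, hn]
  · intro i hi hne
    rw [coeff_X_pow_mul']
    split_ifs with hle
    · refine coeff_expand_of_not_dvd _ _ _ fun hdvd => hne ?_
      rw [← Nat.mod_eq_of_lt (Finset.mem_range.mp hi)]
      exact (Nat.modEq_iff_dvd' hle).mpr hdvd
    · rfl

theorem dissect_sum_X_pow_mul_expand {m j : ℕ} (hm : m ≠ 0) (hj : j < m) (f : ℕ → R⟦X⟧) :
    dissect m j (∑ i ∈ Finset.range m, X ^ i * expand m hm (f i)) = f j := by
  rw [map_sum, Finset.sum_congr rfl fun i hi =>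
    dissect_X_pow_mul_expand hm (Finset.mem_range.mp hi) hj (f i), Finset.sum_ite_eq',
    if_pos (Finset.mem_range.mpr hj)]

theorem dissect_expand_mul {m j : ℕ} (hm : m ≠ 0) (hj : j < m) (f g : R⟦X⟧) :
    dissect m j (expand m hm f * g) = f * dissect m j g := by
  have h : expand m hm f * g =
      ∑ i ∈ Finset.range m, X ^ i * expand m hm (f * dissect m i g) := by
    conv_lhs => rw [← sum_X_pow_mul_expand_dissect hm g, Finset.mul_sum]
    refine Finset.sum_congr rfl fun i _ => ?_
    rw [map_mul]
    ring
  rw [h, dissect_sum_X_pow_mul_expand hm hj]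

theorem dissect_X_pow_mul {m i : ℕ} (hi : i < m) (j : ℕ) (f : R⟦X⟧) : dissect m j (X ^ i * f) =
    if i ≤ j then dissect m (j - i) f else X * dissect m (m + j - i) f := by
  ext n
  rw [coeff_dissect, coeff_X_pow_mul']
  rcases le_or_gt i j with hij | hij
  · rw [if_pos (by omega), if_pos hij, coeff_dissect, Nat.add_sub_assoc hij]
  rw [if_neg hij.not_ge]
  rcases n with _ | n
  · rw [if_neg (by omega), coeff_zero_X_mul]
  · rw [mul_add_one, if_pos (by omega), coeff_succ_X_mul, coeff_dissect]
    exact congrArg (coeff · f) (by omega)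

theorem dissect_mul {m j : ℕ} (hj : j < m) (f g : R⟦X⟧) : dissect m j (f * g) =
    ∑ i ∈ Finset.range m, dissect m i f *
      if i ≤ j then dissect m (j - i) g else X * dissect m (m + j - i) g := by
  have hm : m ≠ 0 := by omega
  conv_lhs => rw [← sum_X_pow_mul_expand_dissect hm f, Finset.sum_mul, map_sum]
  refine Finset.sum_congr rfl fun i hi => ?_
  rw [mul_comm (X ^ i), mul_assoc, dissect_expand_mul hm hj,
    dissect_X_pow_mul (Finset.mem_range.mp hi)]

theorem dissect_X_pow {m j : ℕ} (hm : m ≠ 0) (hj : j < m) (e : ℕ) :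
    dissect m j (X ^ e : R⟦X⟧) = if e % m = j then X ^ (e / m) else 0 := by
  have he : (X : R⟦X⟧) ^ e = X ^ (e % m) * expand m hm (X ^ (e / m)) := by
    rw [map_pow, expand_X, ← pow_mul, ← pow_add, Nat.mod_add_div]
  rw [he, dissect_X_pow_mul_expand hm (Nat.mod_lt e (Nat.pos_of_ne_zero hm)) hj]

end DissectionCalculus

section DissectionOfSums

theorem continuous_dissect (m j : ℕ) : Continuous (dissect m j : ℤ⟦X⟧ → ℤ⟦X⟧) := by
  refine continuous_of_continuous_coeff fun d => ?_
  simp_rw [coeff_dissect]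
  exact WithPiTopology.continuous_coeff ℤ _

variable {ι : Type*} {c : ι → ℤ} {e : ι → ℕ} {S : ℤ⟦X⟧} {m j : ℕ}

theorem hasSum_dissect (h : HasSum (fun i => (c i : ℤ⟦X⟧) * X ^ e i) S) (hj : j < m) :
    HasSum (fun i => if e i % m = j then (c i : ℤ⟦X⟧) * X ^ (e i / m) else 0)
      (dissect m j S) := by
  refine (h.map (dissect m j) (continuous_dissect m j)).congr_fun fun i => ?_
  rw [Function.comp_apply, dissect_intCast_mul, dissect_X_pow (by omega) hj, mul_ite, mul_zero]

theorem dissect_eq_zero (h : HasSum (fun i => (c i : ℤ⟦X⟧) * X ^ e i) S) (hj : j < m)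
    (he : ∀ i, e i % m ≠ j) : dissect m j S = 0 := by
  have hdissect := hasSum_dissect h hj
  simp only [he, if_false] at hdissect
  exact hdissect.unique hasSum_zero

theorem ite_eq_intCast_mul_X_pow {i e' : ℕ} (hj : j < m) (he : i = m * e' + j) (d : ℤ) :
    (if i % m = j then (d : ℤ⟦X⟧) * X ^ (i / m) else 0) = (d : ℤ⟦X⟧) * X ^ e' := by
  rw [he, Nat.mul_add_mod, Nat.mod_eq_of_lt hj, if_pos rfl, Nat.mul_add_div (by omega),
    Nat.div_eq_of_lt hj, add_zero]

theorem hasSum_dissect_of_injective (h : HasSum (fun i => (c i : ℤ⟦X⟧) * X ^ e i) S) (hj : j < m)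
    {κ : Type*} {g : κ → ι} (hg : g.Injective) {e' : κ → ℕ} (he : ∀ k, e (g k) = m * e' k + j)
    (hrange : ∀ i, e i % m = j → i ∈ Set.range g) :
    HasSum (fun k => (c (g k) : ℤ⟦X⟧) * X ^ e' k) (dissect m j S) := by
  refine ((hg.hasSum_iff fun i hi => if_neg (mt (hrange i) hi)).mpr
    (hasSum_dissect h hj)).congr_fun fun k => ?_
  exact (ite_eq_intCast_mul_X_pow hj (he k) _).symm

theorem add_eq_add_of_range_inter_range {ι κ κ' G : Type*} [AddCommGroup G] [TopologicalSpace G]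
    [ContinuousAdd G] [T2Space G] {f : ι → G} {g₁ g₂ : κ → ι} {g₃ : κ' → ι}
    (hg₁ : g₁.Injective) (hg₂ : g₂.Injective) (hg₃ : g₃.Injective)
    (hunion : ∀ i ∉ Set.range g₁ ∪ Set.range g₂, f i = 0)
    (hinter : Set.range g₁ ∩ Set.range g₂ = Set.range g₃) {S S₁ S₂ S₃ : G} (hS : HasSum f S)
    (hS₁ : HasSum (f ∘ g₁) S₁) (hS₂ : HasSum (f ∘ g₂) S₂) (hS₃ : HasSum (f ∘ g₃) S₃) :
    S + S₃ = S₁ + S₂ := by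
  rw [hg₁.hasSum_range_iff.symm.trans hasSum_subtype_iff_indicator] at hS₁
  rw [hg₂.hasSum_range_iff.symm.trans hasSum_subtype_iff_indicator] at hS₂
  rw [hg₃.hasSum_range_iff.symm.trans hasSum_subtype_iff_indicator, ← hinter] at hS₃
  have hf : (Set.range g₁ ∪ Set.range g₂).indicator f = f :=
    Set.indicator_eq_self.mpr fun i hi => by_contra fun h => hi (hunion i h)
  rw [← hf] at hS
  refine (hS.add hS₃).unique ((hS₁.add hS₂).congr_fun fun i => ?_)
  exact congrFun (Set.indicator_union_add_inter f _ _) i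

theorem dissect_add_eq_add (h : HasSum (fun i => (c i : ℤ⟦X⟧) * X ^ e i) S) (hj : j < m)
    {κ κ' : Type*} {g₁ g₂ : κ → ι} {g₃ : κ' → ι} (hg₁ : g₁.Injective) (hg₂ : g₂.Injective)
    (hg₃ : g₃.Injective) {e₁ e₂ : κ → ℕ} {e₃ : κ' → ℕ} (he₁ : ∀ k, e (g₁ k) = m * e₁ k + j)
    (he₂ : ∀ k, e (g₂ k) = m * e₂ k + j) (he₃ : ∀ k, e (g₃ k) = m * e₃ k + j)
    (hunion : ∀ i, e i % m = j → i ∈ Set.range g₁ ∪ Set.range g₂)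
    (hinter : Set.range g₁ ∩ Set.range g₂ = Set.range g₃) {S₁ S₂ S₃ : ℤ⟦X⟧}
    (hS₁ : HasSum (fun k => (c (g₁ k) : ℤ⟦X⟧) * X ^ e₁ k) S₁)
    (hS₂ : HasSum (fun k => (c (g₂ k) : ℤ⟦X⟧) * X ^ e₂ k) S₂)
    (hS₃ : HasSum (fun k => (c (g₃ k) : ℤ⟦X⟧) * X ^ e₃ k) S₃) :
    dissect m j S + S₃ = S₁ + S₂ :=
  add_eq_add_of_range_inter_range hg₁ hg₂ hg₃ (fun i hi => if_neg (mt (hunion i) hi)) hinter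
    (hasSum_dissect h hj)
    (hS₁.congr_fun fun k => ite_eq_intCast_mul_X_pow hj (he₁ k) _)
    (hS₂.congr_fun fun k => ite_eq_intCast_mul_X_pow hj (he₂ k) _)
    (hS₃.congr_fun fun k => ite_eq_intCast_mul_X_pow hj (he₃ k) _)

end DissectionOfSums

section DissectionModFive

local notation "U" => dissect 5

local notation "V" => expand 5 (NeZero.ne 5)

theorem dissect_five_mul (f g : ℤ⟦X⟧) :
    U 0 (f * g) = U 0 f * U 0 g + X * (U 1 f * U 4 g + U 2 f * U 3 g + U 3 f * U 2 g +
      U 4 f * U 1 g) ∧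
    U 1 (f * g) = U 0 f * U 1 g + U 1 f * U 0 g + X * (U 2 f * U 4 g + U 3 f * U 3 g +
      U 4 f * U 2 g) ∧
    U 2 (f * g) = U 0 f * U 2 g + U 1 f * U 1 g + U 2 f * U 0 g + X * (U 3 f * U 4 g +
      U 4 f * U 3 g) ∧
    U 3 (f * g) = U 0 f * U 3 g + U 1 f * U 2 g + U 2 f * U 1 g + U 3 f * U 0 g +
      X * (U 4 f * U 4 g) ∧
    U 4 (f * g) = U 0 f * U 4 g + U 1 f * U 3 g + U 2 f * U 2 g + U 3 f * U 1 g +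
      U 4 f * U 0 g := by
  refine ⟨?_, ?_, ?_, ?_, ?_⟩ <;> rw [dissect_mul (by norm_num)] <;>
    norm_num [Finset.sum_range_succ] <;> ring

theorem dissect_five_X_mul (f : ℤ⟦X⟧) :
    U 0 (X * f) = X * U 4 f ∧ U 1 (X * f) = U 0 f ∧ U 2 (X * f) = U 1 f ∧
      U 3 (X * f) = U 2 f ∧ U 4 (X * f) = U 3 f := by
  have h (j : ℕ) := dissect_X_pow_mul (show 1 < 5 by norm_num) j f
  simp only [pow_one] at h
  exact ⟨h 0, h 1, h 2, h 3, h 4⟩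

theorem dissect_five_expand_two {i j s : ℕ} (hi : i < 5) (hj : j < 5) (h : 2 * i = j + 5 * s)
    (f : ℤ⟦X⟧) :
    U j (expand 2 two_ne_zero f) = X ^ s * expand 2 two_ne_zero (U i f) := by
  ext n
  rw [coeff_dissect, coeff_X_pow_mul', coeff_expand, coeff_expand, coeff_dissect]
  split_ifs <;> first | rfl | omega | exact congrArg (fun k => coeff k f) (by omega)

theorem exists_eq_five_mul_add (n : ℤ) :
    ∃ m, n = 5 * m ∨ n = 5 * m + 1 ∨ n = 5 * m + 2 ∨ n = 5 * m + 3 ∨ n = 5 * m + 4 :=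
  ⟨n / 5, by omega⟩

theorem triangle_mod_five (n : ℤ) : triangle n % 5 = 0 ∧ (n % 5 = 0 ∨ n % 5 = 4) ∨
    triangle n % 5 = 1 ∧ (n % 5 = 1 ∨ n % 5 = 3) ∨ triangle n % 5 = 3 ∧ n % 5 = 2 := by
  have h := two_mul_triangle n
  obtain ⟨m, rfl | rfl | rfl | rfl | rfl⟩ := exists_eq_five_mul_add n <;> ring_nf at h ⊢ <;> omega

theorem natAbs_sq_mod_five (n : ℤ) : n.natAbs ^ 2 % 5 = 0 ∧ n % 5 = 0 ∨
    n.natAbs ^ 2 % 5 = 1 ∧ (n % 5 = 1 ∨ n % 5 = 4) ∨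
      n.natAbs ^ 2 % 5 = 4 ∧ (n % 5 = 2 ∨ n % 5 = 3) := by
  have h := Int.natAbs_sq n
  rw [← Nat.cast_pow] at h
  generalize n.natAbs ^ 2 = a at h ⊢
  obtain ⟨m, rfl | rfl | rfl | rfl | rfl⟩ := exists_eq_five_mul_add n <;> ring_nf at h ⊢ <;> omega

theorem pentagonal_mod_five (n : ℤ) : pentagonal n % 5 = 0 ∧ (n % 5 = 0 ∨ n % 5 = 2) ∨
    pentagonal n % 5 = 2 ∧ (n % 5 = 3 ∨ n % 5 = 4) ∨ pentagonal n % 5 = 1 ∧ n % 5 = 1 := by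
  have h := two_mul_natCast_pentagonal n
  obtain ⟨m, rfl | rfl | rfl | rfl | rfl⟩ := exists_eq_five_mul_add n <;> ring_nf at h ⊢ <;> omega

theorem negOnePow_five_mul (n : ℤ) : (5 * n).negOnePow = n.negOnePow := by
  rw [Int.negOnePow_eq_iff]
  exact ⟨2 * n, by ring⟩

theorem triangle_five_mul_add_two (m : ℤ) : triangle (5 * m + 2) = 5 * (5 * triangle m) + 3 := by
  zify
  linarith [two_mul_triangle m, two_mul_triangle (5 * m + 2)]

theorem pentagonal_five_mul_add_one (m : ℤ) :
    pentagonal (5 * m + 1) = 5 * (5 * pentagonal (-m)) + 1 := by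
  zify
  linarith [two_mul_natCast_pentagonal_neg m, two_mul_natCast_pentagonal (5 * m + 1)]

theorem injective_five_mul_add (a : ℤ) : (fun m : ℤ => 5 * m + a).Injective :=
  fun x y h => by dsimp only at h; omega

theorem mem_range_five_mul_add {n a : ℤ} (h : (n - a) % 5 = 0) :
    n ∈ Set.range fun m : ℤ => 5 * m + a :=
  ⟨(n - a) / 5, by dsimp only; omega⟩

theorem expand_intCast_mul_X_pow (c : ℤ) (e : ℕ) :
    V ((c : ℤ⟦X⟧) * X ^ e) = (c : ℤ⟦X⟧) * X ^ (5 * e) := by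
  rw [map_mul, map_intCast, map_pow, expand_X, ← pow_mul]

theorem dissect_five_eta : U 1 (eta 1) = -eta 5 ∧ U 3 (eta 1) = 0 ∧ U 4 (eta 1) = 0 := by
  refine ⟨?_, dissect_eq_zero hasSum_eta_one (by norm_num) fun n => ?_,
    dissect_eq_zero hasSum_eta_one (by norm_num) fun n => ?_⟩
  · have hU := hasSum_dissect_of_injective hasSum_eta_one (j := 1) (by norm_num)
      (injective_five_mul_add 1) pentagonal_five_mul_add_one
      fun n hn => mem_range_five_mul_add (by have := pentagonal_mod_five n; omega)
    have hV := (hasSum_expand ((Equiv.neg ℤ).hasSum_iff.mpr hasSum_eta_one) (NeZero.ne 5)).neg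
    rw [expand_eta, mul_one] at hV
    refine hU.unique (hV.congr_fun fun m => ?_)
    rw [Function.comp_apply, Equiv.neg_apply, expand_intCast_mul_X_pow, Int.negOnePow_succ,
      negOnePow_five_mul, Int.negOnePow_neg, Units.val_neg, Int.cast_neg, neg_mul]
  all_goals have := pentagonal_mod_five n; omega

theorem dissect_five_eta_pow_three :
    U 2 (eta 1 ^ 3) = 0 ∧ U 3 (eta 1 ^ 3) = 5 * eta 5 ^ 3 ∧ U 4 (eta 1 ^ 3) = 0 := by
  have hcube : HasSum (fun n : ℤ => ((n * n.negOnePow : ℤ) : ℤ⟦X⟧) * X ^ triangle n)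
      (eta 1 ^ 3) :=
    hasSum_mul_negOnePow_mul_X_pow_triangle.congr_fun fun n => by rw [Int.cast_mul, mul_assoc]
  refine ⟨dissect_eq_zero hcube (by norm_num) fun n => ?_, ?_,
    dissect_eq_zero hcube (by norm_num) fun n => ?_⟩
  · have := triangle_mod_five n; omega
  · have hU := hasSum_dissect_of_injective hcube (j := 3) (by norm_num)
      (injective_five_mul_add 2) triangle_five_mul_add_two
      fun n hn => mem_range_five_mul_add (by have := triangle_mod_five n; omega)
    have hV := ((hasSum_expand hcube (NeZero.ne 5)).mul_left 5).add
      ((hasSum_expand hasSum_negOnePow_mul_X_pow_triangle (NeZero.ne 5)).mul_left 2)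
    rw [map_pow, expand_eta, mul_one, map_zero, mul_zero, add_zero] at hV
    refine hU.unique (hV.congr_fun fun m => ?_)
    rw [expand_intCast_mul_X_pow, expand_intCast_mul_X_pow, Int.negOnePow_add,
      negOnePow_five_mul, Int.negOnePow_even 2 even_two, mul_one]
    push_cast
    ring
  · have := triangle_mod_five n; omega

theorem dissect_five_psi : U 2 psi = 0 ∧ U 3 psi = V psi ∧ U 4 psi = 0 := by
  have hpsi : HasSum (fun n : ℤ => ((1 : ℤ) : ℤ⟦X⟧) * X ^ triangle n) (2 * psi) :=
    hasSum_two_mul_psi.congr_fun fun n => by rw [Int.cast_one, one_mul]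
  refine ⟨?_, ?_, ?_⟩ <;> refine mul_left_cancel₀ two_ne_zero_powerSeries ?_ <;>
    rw [← dissect_ofNat_mul]
  · rw [mul_zero]
    exact dissect_eq_zero hpsi (by norm_num) fun n => by have := triangle_mod_five n; omega
  · have hU := hasSum_dissect_of_injective hpsi (j := 3) (by norm_num)
      (injective_five_mul_add 2) triangle_five_mul_add_two
      fun n hn => mem_range_five_mul_add (by have := triangle_mod_five n; omega)
    have hV := hasSum_expand hpsi (NeZero.ne 5)
    rw [map_mul, map_ofNat] at hV
    exact hU.unique (hV.congr_fun fun m => (expand_intCast_mul_X_pow 1 _).symm)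
  · rw [mul_zero]
    exact dissect_eq_zero hpsi (by norm_num) fun n => by have := triangle_mod_five n; omega

theorem dissect_five_theta : U 0 theta = V theta ∧ U 2 theta = 0 ∧ U 3 theta = 0 := by
  refine ⟨?_, dissect_eq_zero hasSum_theta (by norm_num) fun n => ?_,
    dissect_eq_zero hasSum_theta (by norm_num) fun n => ?_⟩
  · have hU := hasSum_dissect_of_injective hasSum_theta (m := 5) (j := 0) (by norm_num)
      (injective_five_mul_add 0) (e' := fun m => 5 * m.natAbs ^ 2)
      (fun m => by rw [add_zero, add_zero, Int.natAbs_mul]; ring)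
      fun n hn => mem_range_five_mul_add (by have := natAbs_sq_mod_five n; omega)
    refine hU.unique ((hasSum_expand hasSum_theta (NeZero.ne 5)).congr_fun fun m => ?_)
    rw [expand_intCast_mul_X_pow, add_zero, negOnePow_five_mul]
  all_goals have := natAbs_sq_mod_five n; omega

theorem hasSum_negOnePow_mul_X_pow_triangle_add {k l : ℕ} (h : k + l ≠ 0) :
    HasSum (fun n : ℤ =>
      ((n.negOnePow : ℤ) : ℤ⟦X⟧) * X ^ (k * triangle n + l * triangle (n - 1)))
      (qPochInf (X ^ k) (X ^ (k + l)) * qPochInf (X ^ l) (X ^ (k + l)) * eta (k + l)) := by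
  have hab : -X ^ k * -X ^ l = (X ^ (k + l) : ℤ⟦X⟧) := by rw [neg_mul_neg, pow_add]
  have htheta := hasSum_thetaTerm (R := ℤ) (a := -X ^ k) (b := -X ^ l)
    (by rw [hab]; exact dvd_pow_self X h)
  rw [hab, neg_neg, neg_neg, mul_comm, ← eta] at htheta
  refine htheta.congr_fun fun n => ?_
  rw [thetaTerm_neg_neg, thetaTerm, ← pow_mul, ← pow_mul, ← pow_add]

theorem natAbs_five_mul_add_sq {i : ℕ} (hi : 2 * i ≤ 5) (m : ℤ) : (5 * m + i).natAbs ^ 2 =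
    5 * ((5 + 2 * i) * triangle m + (5 - 2 * i) * triangle (m - 1)) + i ^ 2 := by
  have hadd := congrArg (Nat.cast (R := ℤ)) (triangle_add_triangle_sub_one m)
  push_cast at hadd
  zify [hi]
  rw [sq_abs] at hadd ⊢
  linear_combination -25 * hadd - 10 * (i : ℤ) * triangle_eq_add m

/-- The squares congruent to `i ^ 2` modulo `5` are those of `5 * m + i` and of `-(5 * m + i)`. -/
theorem dissect_five_sq_theta {i : ℕ} (hi : i = 1 ∨ i = 2) : U (i ^ 2) theta =
    2 * (-1) ^ i * (qPochInf (X ^ (5 + 2 * i)) (X ^ 10) * qPochInf (X ^ (5 - 2 * i)) (X ^ 10) *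
      eta 10) := by
  have hsum := (hasSum_negOnePow_mul_X_pow_triangle_add
    (k := 5 + 2 * i) (l := 5 - 2 * i) (by omega)).mul_left ((-1) ^ i)
  rw [show 5 + 2 * i + (5 - 2 * i) = 10 by omega] at hsum
  have hexp := natAbs_five_mul_add_sq (i := i) (by omega)
  have hsign (m : ℤ) : (((5 * m + i).negOnePow : ℤ) : ℤ⟦X⟧) =
      (-1) ^ i * ((m.negOnePow : ℤ) : ℤ⟦X⟧) := by
    rw [Int.negOnePow_add, negOnePow_five_mul, Units.val_mul, Int.cast_mul, mul_comm,
      Int.cast_negOnePow_natCast]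
  have h := dissect_add_eq_add hasSum_theta (j := i ^ 2) (by rcases hi with rfl | rfl <;> norm_num)
    (injective_five_mul_add i) (neg_injective.comp (injective_five_mul_add i))
    (Function.injective_of_subsingleton Empty.elim) hexp
    (fun m => (congrArg (· ^ 2) (Int.natAbs_neg _)).trans (hexp m)) (e₃ := Empty.elim)
    (fun k => k.elim)
    (fun n hn => ?_) ?_ (hsum.congr_fun fun m => ?_) (hsum.congr_fun fun m => ?_) hasSum_empty
  · rw [add_zero] at h
    rw [h]
    ring
  · have := natAbs_sq_mod_five n
    rcases hi with rfl | rfl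
    · by_cases h : n % 5 = 1
      · exact Or.inl ⟨n / 5, by simp only; omega⟩
      · exact Or.inr ⟨-n / 5, by rw [Function.comp_apply]; omega⟩
    · by_cases h : n % 5 = 2
      · exact Or.inl ⟨n / 5, by simp only; omega⟩
      · exact Or.inr ⟨-n / 5, by rw [Function.comp_apply]; omega⟩
  · ext n
    simp only [Set.mem_inter_iff, Set.mem_range, IsEmpty.exists_iff, iff_false]
    rintro ⟨⟨x, hx⟩, y, hy⟩
    simp only [Function.comp_apply] at hy
    omega
  · rw [hsign, mul_assoc]
  · rw [Function.comp_apply, Int.negOnePow_neg, hsign, mul_assoc]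

theorem dissect_five_theta_mul :
    U 1 theta * U 4 theta * (eta 2 * eta 5) = -(4 * (eta 1 * eta 10 ^ 3)) := by
  have h₁ := dissect_five_sq_theta (Or.inl rfl)
  have h₂ := dissect_five_sq_theta (Or.inr rfl)
  have heta₁ := qPochInf_X_X_sq_mul_eta
  have heta₅ := congrArg V qPochInf_X_X_sq_mul_eta
  rw [map_mul, expand_qPochInf, expand_eta, expand_eta, expand_X] at heta₅
  rw [qPochInf_eq_prod X (X_dvd_X_pow 2) (m := 5) (by norm_num)] at heta₁
  norm_num [Finset.prod_range_succ, ← pow_mul, ← pow_succ'] at h₁ h₂ heta₁ heta₅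
  rw [h₁, h₂, ← heta₁, ← heta₅]
  ring

end DissectionModFive

section SquaresModFive

local notation "U" => dissect 5

local notation "V" => expand 5 (NeZero.ne 5)

/-- The two maps are multiplication by `2 + i` and by `2 - i` in `ℤ[i]`, whose product is `5`. -/
theorem mem_range_gaussian {p : ℤ × ℤ} (h : (p.1 ^ 2 + p.2 ^ 2) % 5 = 0) :
    p ∈ (Set.range fun p : ℤ × ℤ => (2 * p.1 - p.2, p.1 + 2 * p.2)) ∪
      Set.range fun p : ℤ × ℤ => (2 * p.1 + p.2, 2 * p.2 - p.1) := by
  have hdvd : (5 : ℤ) ∣ (2 * p.1 + p.2) * (2 * p.1 - p.2) := by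
    rw [show (2 * p.1 + p.2) * (2 * p.1 - p.2) = 5 * p.1 ^ 2 - (p.1 ^ 2 + p.2 ^ 2) by ring]
    omega
  rcases Int.Prime.dvd_mul' Nat.prime_five hdvd with ⟨u, hu⟩ | ⟨u, hu⟩ <;> push_cast at hu
  · exact Or.inl ⟨(u, 2 * u - p.1), Prod.ext (by dsimp only; omega) (by dsimp only; omega)⟩
  · exact Or.inr ⟨(u, p.1 - 2 * u), Prod.ext (by dsimp only; omega) (by dsimp only; omega)⟩

theorem range_gaussian_inter :
    (Set.range fun p : ℤ × ℤ => (2 * p.1 - p.2, p.1 + 2 * p.2)) ∩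
      (Set.range fun p : ℤ × ℤ => (2 * p.1 + p.2, 2 * p.2 - p.1)) =
      Set.range fun p : ℤ × ℤ => (5 * p.1, 5 * p.2) := by
  ext ⟨m, n⟩
  simp only [Set.mem_inter_iff, Set.mem_range, Prod.exists, Prod.mk.injEq]
  constructor
  · rintro ⟨⟨x, y, hx, hy⟩, z, w, hz, hw⟩
    exact ⟨m / 5, n / 5, by omega, by omega⟩
  · rintro ⟨x, y, hx, hy⟩
    exact ⟨⟨2 * x + y, 2 * y - x, by omega, by omega⟩, 2 * x - y, x + 2 * y, by omega, by omega⟩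

theorem negOnePow_two_mul_add (m n : ℤ) : (2 * m + n).negOnePow = n.negOnePow := by
  rw [Int.negOnePow_add, Int.negOnePow_two_mul, one_mul]

theorem dissect_five_theta_sq : U 0 (theta ^ 2) + V theta ^ 2 = 2 * theta ^ 2 := by
  have hsq : HasSum (fun p : ℤ × ℤ => ((p.1.negOnePow * p.2.negOnePow : ℤ) : ℤ⟦X⟧) *
      X ^ (p.1.natAbs ^ 2 + p.2.natAbs ^ 2)) (theta ^ 2) := by
    rw [sq]
    refine (hasSum_theta.mul_of_nonarchimedean hasSum_theta).congr_fun fun p => ?_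
    push_cast
    ring
  have hV : HasSum (fun p : ℤ × ℤ => ((p.1.negOnePow * p.2.negOnePow : ℤ) : ℤ⟦X⟧) *
      X ^ (5 * (p.1.natAbs ^ 2 + p.2.natAbs ^ 2))) (V theta ^ 2) := by
    rw [← map_pow]
    exact (hasSum_expand hsq (NeZero.ne 5)).congr_fun fun p => (expand_intCast_mul_X_pow _ _).symm
  rw [two_mul]
  refine dissect_add_eq_add hsq (j := 0) (by norm_num)
    (g₁ := fun p : ℤ × ℤ => (2 * p.1 - p.2, p.1 + 2 * p.2))
    (g₂ := fun p : ℤ × ℤ => (2 * p.1 + p.2, 2 * p.2 - p.1))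
    (g₃ := fun p : ℤ × ℤ => (5 * p.1, 5 * p.2))
    (e₁ := fun p => p.1.natAbs ^ 2 + p.2.natAbs ^ 2)
    (e₂ := fun p => p.1.natAbs ^ 2 + p.2.natAbs ^ 2)
    (e₃ := fun p => 5 * (p.1.natAbs ^ 2 + p.2.natAbs ^ 2))
    (fun p q h => ?_) (fun p q h => ?_) (fun p q h => ?_)
    (fun p => ?_) (fun p => ?_) (fun p => ?_) (fun p hp => mem_range_gaussian ?_)
    range_gaussian_inter (hsq.congr_fun fun p => ?_) (hsq.congr_fun fun p => ?_)
    (hV.congr_fun fun p => ?_)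
  any_goals
    simp only [Prod.mk.injEq] at h
    exact Prod.ext (by omega) (by omega)
  any_goals
    zify
    simp only [sq_abs]
    ring
  · zify at hp
    simpa only [sq_abs] using hp
  · rw [sub_eq_add_neg, negOnePow_two_mul_add, add_comm p.1, negOnePow_two_mul_add,
      Int.negOnePow_neg, mul_comm (p.2.negOnePow : ℤ)]
  · rw [negOnePow_two_mul_add, sub_eq_add_neg, negOnePow_two_mul_add, Int.negOnePow_neg,
      mul_comm (p.2.negOnePow : ℤ)]
  · rw [negOnePow_five_mul, negOnePow_five_mul]

/-- The two maps are multiplication by `2 + i` and by `2 - i` after the substitution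
`p = (a - 1 / 2, b - 1 / 2)`. -/
theorem mem_range_shifted_gaussian {p : ℤ × ℤ} (h : (triangle p.1 + triangle p.2) % 5 = 1) :
    p ∈ (Set.range fun p : ℤ × ℤ => (2 * p.1 - p.2, p.1 + 2 * p.2 + 1)) ∪
      Set.range fun p : ℤ × ℤ => (2 * p.1 + p.2 + 1, 2 * p.2 - p.1) := by
  have hdvd : (5 : ℤ) ∣ (2 * p.1 + p.2 - 1) * (2 * p.1 - p.2 - 2) := by
    rw [show (2 * p.1 + p.2 - 1) * (2 * p.1 - p.2 - 2) = 5 * (p.1 ^ 2 - p.1) -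
      (p.1 * (p.1 + 1) + p.2 * (p.2 + 1)) + 2 by ring, ← two_mul_triangle, ← two_mul_triangle]
    omega
  rcases Int.Prime.dvd_mul' Nat.prime_five hdvd with ⟨u, hu⟩ | ⟨u, hu⟩ <;> push_cast at hu
  · exact Or.inl ⟨(u, 2 * u - p.1), Prod.ext (by dsimp only; omega) (by dsimp only; omega)⟩
  · exact Or.inr ⟨(u, p.1 - 2 * u - 1), Prod.ext (by dsimp only; omega) (by dsimp only; omega)⟩

theorem range_shifted_gaussian_inter :
    (Set.range fun p : ℤ × ℤ => (2 * p.1 - p.2, p.1 + 2 * p.2 + 1)) ∩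
      (Set.range fun p : ℤ × ℤ => (2 * p.1 + p.2 + 1, 2 * p.2 - p.1)) =
      Set.range fun p : ℤ × ℤ => (5 * p.1 + 2, 5 * p.2 + 2) := by
  ext ⟨m, n⟩
  simp only [Set.mem_inter_iff, Set.mem_range, Prod.exists, Prod.mk.injEq]
  constructor
  · rintro ⟨⟨x, y, hx, hy⟩, z, w, hz, hw⟩
    exact ⟨m / 5, n / 5, by omega, by omega⟩
  · rintro ⟨x, y, hx, hy⟩
    exact ⟨⟨2 * x + y + 1, 2 * y - x, by omega, by omega⟩, 2 * x - y, x + 2 * y + 1,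
      by omega, by omega⟩

theorem triangle_add_triangle_of_sq_add_sq {a b c d : ℤ}
    (h : a * (a + 1) + b * (b + 1) = 5 * (c * (c + 1) + d * (d + 1)) + 2) :
    triangle a + triangle b = 5 * (triangle c + triangle d) + 1 := by
  zify
  linarith [two_mul_triangle a, two_mul_triangle b, two_mul_triangle c, two_mul_triangle d]

theorem dissect_five_psi_sq : U 1 (psi ^ 2) + X * V psi ^ 2 = 2 * psi ^ 2 := by
  have hsq : HasSum (fun p : ℤ × ℤ => ((1 : ℤ) : ℤ⟦X⟧) * X ^ (triangle p.1 + triangle p.2))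
      (4 * psi ^ 2) := by
    rw [show 4 * psi ^ 2 = 2 * psi * (2 * psi) by ring]
    refine (hasSum_two_mul_psi.mul_of_nonarchimedean hasSum_two_mul_psi).congr_fun fun p => ?_
    rw [Int.cast_one, one_mul, pow_add]
  have hV : HasSum (fun p : ℤ × ℤ => ((1 : ℤ) : ℤ⟦X⟧) *
      X ^ (5 * (triangle p.1 + triangle p.2) + 1)) (X * V (4 * psi ^ 2)) := by
    refine ((hasSum_expand hsq (NeZero.ne 5)).mul_left X).congr_fun fun p => ?_
    rw [expand_intCast_mul_X_pow]
    ring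
  have h := dissect_add_eq_add hsq (j := 1) (by norm_num)
    (g₁ := fun p : ℤ × ℤ => (2 * p.1 - p.2, p.1 + 2 * p.2 + 1))
    (g₂ := fun p : ℤ × ℤ => (2 * p.1 + p.2 + 1, 2 * p.2 - p.1))
    (g₃ := fun p : ℤ × ℤ => (5 * p.1 + 2, 5 * p.2 + 2))
    (e₁ := fun p => triangle p.1 + triangle p.2) (e₂ := fun p => triangle p.1 + triangle p.2)
    (e₃ := fun p => 5 * (triangle p.1 + triangle p.2) + 1)
    (fun p q h => ?_) (fun p q h => ?_) (fun p q h => ?_)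
    (fun p => triangle_add_triangle_of_sq_add_sq (by ring))
    (fun p => triangle_add_triangle_of_sq_add_sq (by ring))
    (fun p => by simp only [triangle_five_mul_add_two]; ring)
    (fun p hp => mem_range_shifted_gaussian hp) range_shifted_gaussian_inter hsq hsq hV
  · rw [dissect_ofNat_mul, map_mul, map_ofNat, map_pow V] at h
    refine mul_left_cancel₀ two_ne_zero_powerSeries
      (mul_left_cancel₀ two_ne_zero_powerSeries ?_)
    linear_combination h
  all_goals
    simp only [Prod.mk.injEq] at h
    exact Prod.ext (by omega) (by omega)

end SquaresModFive

section Components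

local notation "U" => dissect 5

local notation "V" => expand 5 (NeZero.ne 5)

local notation "V₂" => expand 2 two_ne_zero

theorem constantCoeff_dissect_zero {R : Type*} [CommRing R] (m : ℕ) (f : R⟦X⟧) :
    constantCoeff (dissect m 0 f) = constantCoeff f := by
  rw [← coeff_zero_eq_constantCoeff_apply, coeff_dissect, mul_zero, add_zero,
    coeff_zero_eq_constantCoeff_apply]

theorem constantCoeff_dissect_zero_eta : constantCoeff (U 0 (eta 1)) = 1 := by
  rw [constantCoeff_dissect_zero, constantCoeff_eta]

theorem dissect_zero_eta_ne_zero : U 0 (eta 1) ≠ 0 :=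
  ne_of_apply_ne constantCoeff (by rw [constantCoeff_dissect_zero_eta, map_zero]; norm_num)

theorem dissect_zero_eta_mul_dissect_two_eta : U 0 (eta 1) * U 2 (eta 1) = -eta 5 ^ 2 := by
  obtain ⟨u₁, u₃, u₄⟩ := dissect_five_eta
  obtain ⟨h₀, h₁, h₂, -, -⟩ := dissect_five_mul (eta 1) (eta 1)
  obtain ⟨-, -, hcube, -, -⟩ := dissect_five_mul (eta 1 * eta 1) (eta 1)
  rw [← pow_two, ← pow_succ, dissect_five_eta_pow_three.1, pow_two, h₀, h₁, h₂, u₁, u₃, u₄]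
    at hcube
  have hthree : (3 : ℤ⟦X⟧) ≠ 0 := ne_of_apply_ne constantCoeff (by rw [map_ofNat]; norm_num)
  refine mul_left_cancel₀ (mul_ne_zero hthree dissect_zero_eta_ne_zero) ?_
  linear_combination -hcube

theorem dissect_five_eta_sq : U 0 (eta 1 ^ 2) = U 0 (eta 1) ^ 2 ∧
    U 1 (eta 1 ^ 2) = -(2 * U 0 (eta 1) * eta 5) ∧ U 2 (eta 1 ^ 2) = -eta 5 ^ 2 ∧
    U 3 (eta 1 ^ 2) = -(2 * eta 5 * U 2 (eta 1)) ∧ U 4 (eta 1 ^ 2) = U 2 (eta 1) ^ 2 := by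
  obtain ⟨u₁, u₃, u₄⟩ := dissect_five_eta
  obtain ⟨h₀, h₁, h₂, h₃, h₄⟩ := dissect_five_mul (eta 1) (eta 1)
  rw [pow_two (eta 1), h₀, h₁, h₂, h₃, h₄, u₁, u₃, u₄]
  refine ⟨by ring, by ring, ?_, by ring, by ring⟩
  linear_combination 2 * dissect_zero_eta_mul_dissect_two_eta

theorem dissect_five_eta_two : U 0 (eta 2) = V₂ (U 0 (eta 1)) ∧ U 1 (eta 2) = 0 ∧
    U 2 (eta 2) = -eta 10 ∧ U 3 (eta 2) = 0 ∧ U 4 (eta 2) = V₂ (U 2 (eta 1)) := by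
  obtain ⟨u₁, u₃, u₄⟩ := dissect_five_eta
  rw [show eta 2 = V₂ (eta 1) from (expand_eta two_ne_zero 1).symm]
  have h {i j s : ℕ} (hi : i < 5) (hj : j < 5) (hs : 2 * i = j + 5 * s) :=
    dissect_five_expand_two hi hj hs (eta 1)
  refine ⟨?_, ?_, ?_, ?_, ?_⟩
  · rw [h (i := 0) (s := 0) (by norm_num) (by norm_num) rfl, pow_zero, one_mul]
  · rw [h (i := 3) (s := 1) (by norm_num) (by norm_num) rfl, u₃, map_zero, mul_zero]
  · rw [h (i := 1) (s := 0) (by norm_num) (by norm_num) rfl, u₁, map_neg, expand_eta, pow_zero,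
      one_mul]
  · rw [h (i := 4) (s := 1) (by norm_num) (by norm_num) rfl, u₄, map_zero, mul_zero]
  · rw [h (i := 2) (s := 0) (by norm_num) (by norm_num) rfl, pow_zero, one_mul]

theorem dissect_five_eta_two_sq :
    U 1 (eta 2 ^ 2) = -(2 * X * eta 10 * V₂ (U 2 (eta 1))) ∧
    U 2 (eta 2 ^ 2) = -(2 * V₂ (U 0 (eta 1)) * eta 10) := by
  obtain ⟨u₀, u₁, u₂, u₃, u₄⟩ := dissect_five_eta_two
  obtain ⟨-, h₁, h₂, -, -⟩ := dissect_five_mul (eta 2) (eta 2)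
  rw [pow_two (eta 2), h₁, h₂, u₀, u₁, u₂, u₃, u₄]
  exact ⟨by ring, by ring⟩

theorem expand_five_theta_mul_eta : V theta * eta 10 = eta 5 ^ 2 := by
  have h := congrArg V theta_mul_eta
  rwa [map_mul, map_pow, expand_eta, expand_eta] at h

theorem expand_five_psi_mul_eta : V psi * eta 5 = eta 10 ^ 2 := by
  have h := congrArg V psi_mul_eta
  rwa [map_mul, map_pow, expand_eta, expand_eta] at h

theorem theta_sq_eq : theta ^ 2 = V theta ^ 2 + X * (U 1 theta * U 4 theta) := by
  obtain ⟨t₀, t₂, t₃⟩ := dissect_five_theta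
  obtain ⟨h, -, -, -, -⟩ := dissect_five_mul theta theta
  rw [t₀, t₂, t₃] at h
  have hsq := dissect_five_theta_sq
  rw [pow_two theta, h] at hsq
  refine mul_left_cancel₀ two_ne_zero_powerSeries ?_
  linear_combination -hsq

theorem psi_sq_eq : psi ^ 2 = U 0 psi * U 1 psi + X * V psi ^ 2 := by
  obtain ⟨p₂, p₃, p₄⟩ := dissect_five_psi
  obtain ⟨-, h, -, -, -⟩ := dissect_five_mul psi psi
  rw [p₂, p₃, p₄] at h
  have hsq := dissect_five_psi_sq
  rw [pow_two psi, h] at hsq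
  refine mul_left_cancel₀ two_ne_zero_powerSeries ?_
  linear_combination -hsq

theorem dissect_five_theta_mul_eta_two :
    U 1 theta * V₂ (U 0 (eta 1)) - X * U 4 theta * eta 10 = -(2 * U 0 (eta 1) * eta 5) ∧
    X * U 4 theta * V₂ (U 2 (eta 1)) - U 1 theta * eta 10 = -(2 * eta 5 * U 2 (eta 1)) ∧
    V theta * V₂ (U 2 (eta 1)) + U 4 theta * V₂ (U 0 (eta 1)) = U 2 (eta 1) ^ 2 := by
  obtain ⟨-, q₁, -, q₃, q₄⟩ := dissect_five_eta_sq
  obtain ⟨t₀, t₂, t₃⟩ := dissect_five_theta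
  obtain ⟨u₀, u₁, u₂, u₃, u₄⟩ := dissect_five_eta_two
  obtain ⟨-, h₁, -, h₃, h₄⟩ := dissect_five_mul theta (eta 2)
  rw [theta_mul_eta, t₀, t₂, t₃, u₀, u₁, u₂, u₃, u₄] at h₁ h₃ h₄
  refine ⟨?_, ?_, ?_⟩
  · linear_combination q₁ - h₁
  · linear_combination q₃ - h₃
  · linear_combination q₄ - h₄

theorem dissect_five_psi_mul_eta :
    U 1 psi * U 0 (eta 1) - U 0 psi * eta 5 = -(2 * X * eta 10 * V₂ (U 2 (eta 1))) ∧
    U 0 psi * U 2 (eta 1) - U 1 psi * eta 5 = -(2 * V₂ (U 0 (eta 1)) * eta 10) := by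
  obtain ⟨q₁, q₂⟩ := dissect_five_eta_two_sq
  obtain ⟨u₁, u₃, u₄⟩ := dissect_five_eta
  obtain ⟨p₂, p₃, p₄⟩ := dissect_five_psi
  obtain ⟨-, h₁, h₂, -, -⟩ := dissect_five_mul psi (eta 1)
  rw [psi_mul_eta, p₂, p₃, p₄, u₁, u₃, u₄] at h₁ h₂
  constructor
  · linear_combination q₁ - h₁
  · linear_combination q₂ - h₂

end Components

section RamanujanParameter

local notation "U" => dissect 5

local notation "V" => expand 5 (NeZero.ne 5)

local notation "V₂" => expand 2 two_ne_zero

local notation "ι" => algebraMap ℤ⟦X⟧ (FractionRing ℤ⟦X⟧)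

/-- The quotient `q^{1/5} / R(q)`, where `R` is the Rogers–Ramanujan continued fraction: the
`5`-dissection of `eta 1` reads `f₁ = f₂₅ * (T - q - q² / T)` with `T = q / R(q⁵)`. -/
noncomputable def rrInv : FractionRing ℤ⟦X⟧ := ι (U 0 (eta 1)) / ι (eta 5)

/-- The quotient `q^{2/5} / R(q²)`, i.e. `rrInv` at `q²`. -/
noncomputable def rrInvTwo : FractionRing ℤ⟦X⟧ := ι (V₂ (U 0 (eta 1))) / ι (eta 10)

/-- Ramanujan's parameter `k = R(q) R(q²)²`, which uniformizes the modular functions of level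
`10`. -/
noncomputable def ramanujanK : FractionRing ℤ⟦X⟧ := ι X / (rrInv * rrInvTwo ^ 2)

theorem algebraMap_ne_zero {f : ℤ⟦X⟧} (hf : f ≠ 0) : ι f ≠ 0 :=
  (map_ne_zero_iff _ (IsFractionRing.injective _ _)).mpr hf

theorem two_ne_zero_fractionRing : (2 : FractionRing ℤ⟦X⟧) ≠ 0 := by
  rw [← map_ofNat ι]
  exact algebraMap_ne_zero two_ne_zero_powerSeries

theorem algebraMap_eta_ne_zero (k : ℕ) [NeZero k] : ι (eta k) ≠ 0 :=
  algebraMap_ne_zero (eta_ne_zero k)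

theorem expand_two_dissect_zero_eta_ne_zero : V₂ (U 0 (eta 1)) ≠ 0 :=
  ne_of_apply_ne constantCoeff
    (by rw [constantCoeff_expand, constantCoeff_dissect_zero_eta, map_zero]; norm_num)

theorem rrInv_ne_zero : rrInv ≠ 0 :=
  div_ne_zero (algebraMap_ne_zero dissect_zero_eta_ne_zero) (algebraMap_eta_ne_zero 5)

theorem rrInvTwo_ne_zero : rrInvTwo ≠ 0 :=
  div_ne_zero (algebraMap_ne_zero expand_two_dissect_zero_eta_ne_zero) (algebraMap_eta_ne_zero 10)

theorem algebraMap_X_ne_zero : ι X ≠ 0 :=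
  algebraMap_ne_zero X_ne_zero

theorem ramanujanK_ne_zero : ramanujanK ≠ 0 :=
  div_ne_zero algebraMap_X_ne_zero (mul_ne_zero rrInv_ne_zero (pow_ne_zero 2 rrInvTwo_ne_zero))

theorem ramanujanK_mul : ramanujanK * (rrInv * rrInvTwo ^ 2) = ι X :=
  div_mul_cancel₀ _ (mul_ne_zero rrInv_ne_zero (pow_ne_zero 2 rrInvTwo_ne_zero))

theorem algebraMap_dissect_zero_eta : ι (U 0 (eta 1)) = rrInv * ι (eta 5) :=
  (div_mul_cancel₀ _ (algebraMap_eta_ne_zero 5)).symm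

theorem algebraMap_expand_two_dissect_zero_eta :
    ι (V₂ (U 0 (eta 1))) = rrInvTwo * ι (eta 10) :=
  (div_mul_cancel₀ _ (algebraMap_eta_ne_zero 10)).symm

theorem algebraMap_dissect_two_eta : ι (U 2 (eta 1)) = -ι (eta 5) / rrInv := by
  have h := congrArg ι dissect_zero_eta_mul_dissect_two_eta
  rw [map_mul, map_neg, map_pow, algebraMap_dissect_zero_eta] at h
  refine eq_div_of_mul_eq rrInv_ne_zero (mul_right_cancel₀ (algebraMap_eta_ne_zero 5) ?_)
  linear_combination h

theorem algebraMap_expand_two_dissect_two_eta :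
    ι (V₂ (U 2 (eta 1))) = -ι (eta 10) / rrInvTwo := by
  have h := congrArg (fun f => ι (V₂ f)) dissect_zero_eta_mul_dissect_two_eta
  rw [map_mul V₂, map_neg V₂, map_pow V₂, expand_eta, map_mul, map_neg, map_pow,
    algebraMap_expand_two_dissect_zero_eta] at h
  refine eq_div_of_mul_eq rrInvTwo_ne_zero (mul_right_cancel₀ (algebraMap_eta_ne_zero 10) ?_)
  linear_combination h

theorem algebraMap_expand_theta : ι (V theta) = ι (eta 5) ^ 2 / ι (eta 10) := by
  rw [← map_pow, ← expand_five_theta_mul_eta, map_mul,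
    mul_div_cancel_right₀ _ (algebraMap_eta_ne_zero 10)]

theorem algebraMap_expand_psi : ι (V psi) = ι (eta 10) ^ 2 / ι (eta 5) := by
  rw [← map_pow, ← expand_five_psi_mul_eta, map_mul,
    mul_div_cancel_right₀ _ (algebraMap_eta_ne_zero 5)]

theorem algebraMap_dissect_theta_eq_rrInv :
    ι (U 1 theta) = -(ι (V theta) * (rrInv / rrInvTwo + 1 / rrInv)) ∧
    ι X * ι (U 4 theta) = ι (V theta) * (rrInv - rrInvTwo / rrInv) := by
  obtain ⟨h₁, h₃, -⟩ := dissect_five_theta_mul_eta_two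
  replace h₁ := congrArg ι h₁
  replace h₃ := congrArg ι h₃
  simp only [map_sub, map_mul, map_neg, map_ofNat, algebraMap_dissect_zero_eta,
    algebraMap_dissect_two_eta, algebraMap_expand_two_dissect_zero_eta,
    algebraMap_expand_two_dissect_two_eta] at h₁ h₃
  have hr := rrInv_ne_zero
  have hs := rrInvTwo_ne_zero
  have hf := algebraMap_eta_ne_zero 10
  rw [algebraMap_expand_theta]
  field_simp at h₁ h₃ ⊢
  constructor <;> apply mul_left_cancel₀ two_ne_zero_fractionRing
  · linear_combination rrInv * h₁ - h₃
  · linear_combination -rrInv * h₁ - h₃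

theorem algebraMap_dissect_psi :
    ι (U 0 psi) = ι (V psi) * (rrInv * rrInvTwo * (1 - ramanujanK)) ∧
    ι (U 1 psi) = ι (V psi) * (rrInvTwo * (1 + ramanujanK)) := by
  obtain ⟨h₁, h₂⟩ := dissect_five_psi_mul_eta
  replace h₁ := congrArg ι h₁
  replace h₂ := congrArg ι h₂
  simp only [map_sub, map_mul, map_neg, map_ofNat, algebraMap_dissect_zero_eta,
    algebraMap_dissect_two_eta, algebraMap_expand_two_dissect_zero_eta,
    algebraMap_expand_two_dissect_two_eta, ← ramanujanK_mul] at h₁ h₂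
  have hr := rrInv_ne_zero
  have he := algebraMap_eta_ne_zero 5
  rw [algebraMap_expand_psi]
  field_simp at h₁ h₂ ⊢
  constructor <;> apply mul_left_cancel₀ two_ne_zero_fractionRing
  · linear_combination -h₁ - h₂
  · refine mul_left_cancel₀ hr ?_
    linear_combination h₁ - h₂

theorem X_mul_rrInv_sq_add :
    ι X * (rrInv ^ 2 + rrInvTwo) = rrInv * rrInvTwo ^ 2 * (rrInv ^ 2 - rrInvTwo) := by
  have h := congrArg (fun f => ι X * ι f) dissect_five_theta_mul_eta_two.2.2
  have h₄ := algebraMap_dissect_theta_eq_rrInv.2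
  simp only [map_add, map_mul, map_pow, algebraMap_dissect_two_eta,
    algebraMap_expand_two_dissect_zero_eta, algebraMap_expand_two_dissect_two_eta,
    mul_add, ← mul_assoc, h₄, algebraMap_expand_theta] at h
  have hr := rrInv_ne_zero
  have hs := rrInvTwo_ne_zero
  have he := algebraMap_eta_ne_zero 5
  have hf := algebraMap_eta_ne_zero 10
  field_simp at h
  linear_combination -h

theorem rrInv_sq_add_ne_zero : rrInv ^ 2 + rrInvTwo ≠ 0 := by
  have hne : U 0 (eta 1) ^ 2 * eta 10 + V₂ (U 0 (eta 1)) * eta 5 ^ 2 ≠ 0 := by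
    refine ne_of_apply_ne constantCoeff ?_
    simp only [map_add, map_mul, map_pow, constantCoeff_expand, constantCoeff_dissect_zero_eta,
      constantCoeff_eta, map_zero]
    norm_num
  have he := algebraMap_eta_ne_zero 5
  have hf := algebraMap_eta_ne_zero 10
  have h : rrInv ^ 2 + rrInvTwo =
      ι (U 0 (eta 1) ^ 2 * eta 10 + V₂ (U 0 (eta 1)) * eta 5 ^ 2) /
        (ι (eta 5) ^ 2 * ι (eta 10)) := by
    rw [rrInv, rrInvTwo, map_add, map_mul, map_mul, map_pow, map_pow]
    field_simp
  rw [h]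
  exact div_ne_zero (algebraMap_ne_zero hne) (mul_ne_zero (pow_ne_zero 2 he) hf)

theorem ramanujanK_eq : ramanujanK = (rrInv ^ 2 - rrInvTwo) / (rrInv ^ 2 + rrInvTwo) := by
  rw [ramanujanK, div_eq_div_iff (mul_ne_zero rrInv_ne_zero (pow_ne_zero 2 rrInvTwo_ne_zero))
    rrInv_sq_add_ne_zero, X_mul_rrInv_sq_add, mul_comm]

theorem one_add_ramanujanK_ne_zero : 1 + ramanujanK ≠ 0 := by
  have h : 1 + ramanujanK = 2 * rrInv ^ 2 / (rrInv ^ 2 + rrInvTwo) := by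
    rw [ramanujanK_eq, one_add_div rrInv_sq_add_ne_zero]
    ring
  rw [h]
  exact div_ne_zero (mul_ne_zero two_ne_zero_fractionRing (pow_ne_zero 2 rrInv_ne_zero))
    rrInv_sq_add_ne_zero

theorem one_sub_ramanujanK_ne_zero : 1 - ramanujanK ≠ 0 := by
  have h : 1 - ramanujanK = 2 * rrInvTwo / (rrInv ^ 2 + rrInvTwo) := by
    rw [ramanujanK_eq, one_sub_div rrInv_sq_add_ne_zero]
    ring
  rw [h]
  exact div_ne_zero (mul_ne_zero two_ne_zero_fractionRing rrInvTwo_ne_zero) rrInv_sq_add_ne_zero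

theorem rrInvTwo_eq : rrInvTwo = rrInv ^ 2 * (1 - ramanujanK) / (1 + ramanujanK) := by
  refine eq_div_of_mul_eq one_add_ramanujanK_ne_zero ?_
  rw [ramanujanK_eq]
  have := rrInv_sq_add_ne_zero
  field_simp
  ring

theorem X_eq_rrInv_pow_five_mul :
    ι X = rrInv ^ 5 * ramanujanK * (1 - ramanujanK) ^ 2 / (1 + ramanujanK) ^ 2 := by
  rw [← ramanujanK_mul, rrInvTwo_eq, div_pow]
  ring

theorem algebraMap_dissect_theta :
    ι (U 1 theta) = -(2 * ι (V theta) / (rrInv * (1 - ramanujanK))) ∧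
    ι X * ι (U 4 theta) = 2 * ramanujanK * rrInv * ι (V theta) / (1 + ramanujanK) := by
  have hr := rrInv_ne_zero
  have hadd := one_add_ramanujanK_ne_zero
  have hsub := one_sub_ramanujanK_ne_zero
  rw [algebraMap_dissect_theta_eq_rrInv.1, algebraMap_dissect_theta_eq_rrInv.2, rrInvTwo_eq]
  constructor <;> field_simp <;> ring

theorem algebraMap_dissect_one_theta_mul :
    ι (U 1 theta) * (ι X * ι (U 4 theta)) * (1 - ramanujanK ^ 2) =
      -(4 * ramanujanK * ι (V theta) ^ 2) := by
  have hr := rrInv_ne_zero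
  have hadd := one_add_ramanujanK_ne_zero
  have hsub := one_sub_ramanujanK_ne_zero
  rw [algebraMap_dissect_theta.1, algebraMap_dissect_theta.2]
  field_simp
  ring

theorem algebraMap_theta_sq : ι theta ^ 2 * (1 - ramanujanK ^ 2) =
    ι (V theta) ^ 2 * (1 - 4 * ramanujanK - ramanujanK ^ 2) := by
  have h := congrArg ι theta_sq_eq
  simp only [map_add, map_mul, map_pow] at h
  linear_combination (1 - ramanujanK ^ 2) * h + algebraMap_dissect_one_theta_mul

theorem algebraMap_psi_sq : ι psi ^ 2 * ramanujanK =
    ι (V psi) ^ 2 * ι X * (1 + ramanujanK - ramanujanK ^ 2) := by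
  have h := congrArg ι psi_sq_eq
  simp only [map_add, map_mul, map_pow, algebraMap_dissect_psi.1, algebraMap_dissect_psi.2] at h
  linear_combination ramanujanK * h +
    ι (V psi) ^ 2 * (1 - ramanujanK ^ 2) * ramanujanK_mul

theorem theta_pow_four_mul_psi_sq : theta ^ 4 * psi ^ 2 = eta 1 ^ 6 := by
  refine mul_right_cancel₀ (mul_ne_zero (pow_ne_zero 4 (eta_ne_zero 2))
    (pow_ne_zero 2 (eta_ne_zero 1))) ?_
  calc theta ^ 4 * psi ^ 2 * (eta 2 ^ 4 * eta 1 ^ 2)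
      = (theta * eta 2) ^ 4 * (psi * eta 1) ^ 2 := by ring
    _ = (eta 1 ^ 2) ^ 4 * (eta 2 ^ 2) ^ 2 := by rw [theta_mul_eta, psi_mul_eta]
    _ = eta 1 ^ 6 * (eta 2 ^ 4 * eta 1 ^ 2) := by ring

theorem one_sub_ramanujanK_sq_ne_zero : 1 - ramanujanK ^ 2 ≠ 0 := by
  rw [show 1 - ramanujanK ^ 2 = (1 - ramanujanK) * (1 + ramanujanK) by ring]
  exact mul_ne_zero one_sub_ramanujanK_ne_zero one_add_ramanujanK_ne_zero

theorem rrInv_pow_five_sub :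
    ι (eta 5) ^ 6 * (rrInv ^ 5 - 11 * ι X - ι X ^ 2 / rrInv ^ 5) = ι (eta 1) ^ 6 := by
  have hr := rrInv_ne_zero
  have hk := ramanujanK_ne_zero
  have hadd := one_add_ramanujanK_ne_zero
  have hsub := one_sub_ramanujanK_ne_zero
  have he := algebraMap_eta_ne_zero 5
  have hf := algebraMap_eta_ne_zero 10
  have htheta := eq_div_of_mul_eq one_sub_ramanujanK_sq_ne_zero algebraMap_theta_sq
  have hpsi := eq_div_of_mul_eq hk algebraMap_psi_sq
  have hprod := congrArg ι theta_pow_four_mul_psi_sq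
  rw [map_mul, map_pow, map_pow, map_pow, pow_mul _ 2 2, htheta, hpsi] at hprod
  rw [← hprod, algebraMap_expand_theta, algebraMap_expand_psi, X_eq_rrInv_pow_five_mul,
    show 1 - ramanujanK ^ 2 = (1 - ramanujanK) * (1 + ramanujanK) by ring]
  field_simp
  ring

theorem dissect_zero_eta_pow_ten_sub :
    eta 5 * (U 0 (eta 1) ^ 10 - 11 * X * U 0 (eta 1) ^ 5 * eta 5 ^ 5 - X ^ 2 * eta 5 ^ 10) =
      U 0 (eta 1) ^ 5 * eta 1 ^ 6 := by
  apply IsFractionRing.injective ℤ⟦X⟧ (FractionRing ℤ⟦X⟧)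
  simp only [map_sub, map_mul, map_pow, map_ofNat]
  have hr := rrInv_ne_zero
  rw [← rrInv_pow_five_sub, algebraMap_dissect_zero_eta]
  field_simp

theorem algebraMap_expand_theta_sq_mul :
    ramanujanK * ι (V theta) ^ 2 * (ι (eta 2) * ι (eta 5)) =
      (1 - ramanujanK ^ 2) * ι X * (ι (eta 1) * ι (eta 10) ^ 3) := by
  have h := congrArg ι dissect_five_theta_mul
  simp only [map_mul, map_neg, map_pow, map_ofNat] at h
  refine mul_left_cancel₀ two_ne_zero_fractionRing
    (mul_left_cancel₀ two_ne_zero_fractionRing ?_)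
  linear_combination ι (eta 2) * ι (eta 5) * algebraMap_dissect_one_theta_mul -
    (1 - ramanujanK ^ 2) * ι X * h

theorem psi_sq_sub : eta 1 * eta 10 ^ 3 * (psi ^ 2 - 5 * X * V psi ^ 2) =
    V psi ^ 2 * theta ^ 2 * eta 2 * eta 5 := by
  apply IsFractionRing.injective ℤ⟦X⟧ (FractionRing ℤ⟦X⟧)
  simp only [map_sub, map_mul, map_pow, map_ofNat]
  refine mul_left_cancel₀ (mul_ne_zero ramanujanK_ne_zero one_sub_ramanujanK_sq_ne_zero) ?_
  linear_combination (1 - ramanujanK ^ 2) * ι (eta 1) * ι (eta 10) ^ 3 * algebraMap_psi_sq -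
    ramanujanK * ι (V psi) ^ 2 * ι (eta 2) * ι (eta 5) * algebraMap_theta_sq -
    ι (V psi) ^ 2 * (1 - 4 * ramanujanK - ramanujanK ^ 2) * algebraMap_expand_theta_sq_mul

theorem eta_two_pow_five_mul : eta 2 ^ 5 * eta 5 ^ 2 =
    eta 1 ^ 5 * eta 5 * eta 10 + 5 * X * eta 1 ^ 2 * eta 2 * eta 10 ^ 4 := by
  refine mul_left_cancel₀ (pow_ne_zero 3 (eta_ne_zero 10)) ?_
  calc eta 10 ^ 3 * (eta 2 ^ 5 * eta 5 ^ 2)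
      = eta 10 ^ 3 * (eta 2 * eta 5 ^ 2 * (psi * eta 1) ^ 2) := by rw [psi_mul_eta]; ring
    _ = eta 1 * eta 2 * eta 5 ^ 2 * (eta 1 * eta 10 ^ 3 * (psi ^ 2 - 5 * X * V psi ^ 2)) +
        5 * X * eta 1 ^ 2 * eta 2 * eta 10 ^ 3 * (V psi * eta 5) ^ 2 := by ring
    _ = eta 1 * eta 5 * (V psi * eta 5) ^ 2 * (theta * eta 2) ^ 2 +
        5 * X * eta 1 ^ 2 * eta 2 * eta 10 ^ 3 * (V psi * eta 5) ^ 2 := by rw [psi_sq_sub]; ring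
    _ = eta 10 ^ 3 * (eta 1 ^ 5 * eta 5 * eta 10 +
        5 * X * eta 1 ^ 2 * eta 2 * eta 10 ^ 4) := by
      rw [expand_five_psi_mul_eta, theta_mul_eta]; ring

theorem expand_theta_sq_mul_eq :
    V theta ^ 2 * ((V theta ^ 2 + 2 * X * U 1 theta * U 4 theta) *
        (5 * U 0 (eta 1) ^ 4 * eta 5 ^ 4) +
      2 * V theta * U 1 theta * (3 * U 0 (eta 1) ^ 5 * eta 5 ^ 3 + X * eta 5 ^ 8) +
      U 1 theta ^ 2 * (2 * U 0 (eta 1) ^ 6 * eta 5 ^ 2 - X * U 0 (eta 1) * eta 5 ^ 7) +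
      X * U 4 theta ^ 2 * (U 0 (eta 1) ^ 7 * eta 5 + 2 * X * U 0 (eta 1) ^ 2 * eta 5 ^ 6) +
      2 * V theta * U 4 theta * (U 0 (eta 1) ^ 8 - 3 * X * U 0 (eta 1) ^ 3 * eta 5 ^ 5)) =
      5 * U 0 (eta 1) ^ 4 * eta 5 ^ 4 * theta ^ 4 := by
  apply IsFractionRing.injective ℤ⟦X⟧ (FractionRing ℤ⟦X⟧)
  simp only [map_add, map_sub, map_mul, map_pow, map_ofNat]
  have hr := rrInv_ne_zero
  have hk := ramanujanK_ne_zero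
  have hadd := one_add_ramanujanK_ne_zero
  have hsub := one_sub_ramanujanK_ne_zero
  have htheta := eq_div_of_mul_eq one_sub_ramanujanK_sq_ne_zero algebraMap_theta_sq
  have h₄ := eq_div_of_mul_eq algebraMap_X_ne_zero
    ((mul_comm _ _).trans algebraMap_dissect_theta.2)
  rw [pow_mul (ι theta) 2 2, htheta, h₄, algebraMap_dissect_theta.1, algebraMap_dissect_zero_eta,
    X_eq_rrInv_pow_five_mul,
    show 1 - ramanujanK ^ 2 = (1 - ramanujanK) * (1 + ramanujanK) by ring]
  field_simp
  ring

end RamanujanParameter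

section EtaQuotients

local notation "U" => dissect 5

local notation "V" => expand 5 (NeZero.ne 5)

local notation "V₂" => expand 2 two_ne_zero

theorem eta_mul_inverse (k : ℕ) [NeZero k] : eta k * (eta k)⁻¹ʳ = 1 :=
  Ring.mul_inverse_cancel _ (isUnit_eta k)

theorem expand_inverse_eta {m : ℕ} (hm : m ≠ 0) (k : ℕ) [NeZero k] :
    expand m hm (eta k)⁻¹ʳ = (eta (m * k))⁻¹ʳ := by
  rw [map_inverse_of_isUnit _ (isUnit_eta k), expand_eta]

/-- The components, for the dissection modulo `5`, of the cofactor of `eta 1` in its norm to the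
series in `X ^ 5`, cleared of denominators. -/
noncomputable def etaCofactor : ℕ → ℤ⟦X⟧
  | 0 => U 0 (eta 1) ^ 8 - 3 * X * U 0 (eta 1) ^ 3 * eta 5 ^ 5
  | 1 => U 0 (eta 1) ^ 7 * eta 5 + 2 * X * U 0 (eta 1) ^ 2 * eta 5 ^ 6
  | 2 => 2 * U 0 (eta 1) ^ 6 * eta 5 ^ 2 - X * U 0 (eta 1) * eta 5 ^ 7
  | 3 => 3 * U 0 (eta 1) ^ 5 * eta 5 ^ 3 + X * eta 5 ^ 8
  | _ => 5 * U 0 (eta 1) ^ 4 * eta 5 ^ 4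

theorem eta_mul_sum_etaCofactor :
    eta 1 * V (U 0 (eta 1)) * ∑ i ∈ Finset.range 5, X ^ i * V (etaCofactor i) =
      V (U 0 (eta 1) ^ 10 - 11 * X * U 0 (eta 1) ^ 5 * eta 5 ^ 5 - X ^ 2 * eta 5 ^ 10) := by
  obtain ⟨u₁, u₃, u₄⟩ := dissect_five_eta
  have hmul := congrArg V dissect_zero_eta_mul_dissect_two_eta
  have hsum := sum_X_pow_mul_expand_dissect (NeZero.ne 5) (eta 1)
  simp only [Finset.sum_range_succ, Finset.sum_range_zero, u₁, u₃, u₄] at hsum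
  simp only [map_mul V, map_neg V, map_pow V, map_zero] at hmul hsum
  have heta : eta 1 * V (U 0 (eta 1)) =
      V (U 0 (eta 1)) ^ 2 - X * V (U 0 (eta 1)) * V (eta 5) - X ^ 2 * V (eta 5) ^ 2 := by
    nth_rewrite 1 [← hsum]
    linear_combination X ^ 2 * hmul
  simp only [heta, Finset.sum_range_succ, Finset.sum_range_zero, etaCofactor]
  simp only [map_add V, map_sub V, map_mul V, map_pow V, map_ofNat, expand_X]
  ring

theorem pow_ten_sub_mul_dissect_four_mul_inverse_eta (f : ℤ⟦X⟧) :
    (U 0 (eta 1) ^ 10 - 11 * X * U 0 (eta 1) ^ 5 * eta 5 ^ 5 - X ^ 2 * eta 5 ^ 10) *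
      U 4 (f * (eta 1)⁻¹ʳ) =
      U 0 (eta 1) * (U 0 f * etaCofactor 4 + U 1 f * etaCofactor 3 + U 2 f * etaCofactor 2 +
        U 3 f * etaCofactor 1 + U 4 f * etaCofactor 0) := by
  have hcof (j : ℕ) (hj : j < 5) := dissect_sum_X_pow_mul_expand (NeZero.ne 5) hj etaCofactor
  have hmul := (dissect_five_mul f (∑ i ∈ Finset.range 5, X ^ i * V (etaCofactor i))).2.2.2.2
  rw [hcof 0 (by norm_num), hcof 1 (by norm_num), hcof 2 (by norm_num), hcof 3 (by norm_num),
    hcof 4 (by norm_num)] at hmul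
  rw [← hmul, ← dissect_expand_mul (NeZero.ne 5) (by norm_num),
    ← dissect_expand_mul (NeZero.ne 5) (by norm_num), ← eta_mul_sum_etaCofactor]
  congr 1
  linear_combination V (U 0 (eta 1)) * (∑ i ∈ Finset.range 5, X ^ i * V (etaCofactor i)) * f *
    eta_mul_inverse 1

theorem eta_pow_six_mul_dissect_four_mul_inverse_eta (f : ℤ⟦X⟧) :
    U 0 (eta 1) ^ 4 * (eta 1 ^ 6 * U 4 (f * (eta 1)⁻¹ʳ)) =
      eta 5 * (U 0 f * etaCofactor 4 + U 1 f * etaCofactor 3 + U 2 f * etaCofactor 2 +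
        U 3 f * etaCofactor 1 + U 4 f * etaCofactor 0) := by
  refine mul_left_cancel₀ dissect_zero_eta_ne_zero ?_
  linear_combination eta 5 * pow_ten_sub_mul_dissect_four_mul_inverse_eta f -
    U 4 (f * (eta 1)⁻¹ʳ) * dissect_zero_eta_pow_ten_sub

theorem dissect_five_theta_sq_components :
    U 0 (theta ^ 2) = V theta ^ 2 + 2 * X * U 1 theta * U 4 theta ∧
    U 1 (theta ^ 2) = 2 * V theta * U 1 theta ∧ U 2 (theta ^ 2) = U 1 theta ^ 2 ∧
    U 3 (theta ^ 2) = X * U 4 theta ^ 2 ∧ U 4 (theta ^ 2) = 2 * V theta * U 4 theta := by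
  obtain ⟨h₀, h₁, h₂, h₃, h₄⟩ := dissect_five_mul theta theta
  obtain ⟨t₀, t₂, t₃⟩ := dissect_five_theta
  rw [pow_two theta, h₀, h₁, h₂, h₃, h₄, t₀, t₂, t₃]
  exact ⟨by ring, by ring, by ring, by ring, by ring⟩

theorem dissect_five_one : U 0 (1 : ℤ⟦X⟧) = 1 ∧ U 1 (1 : ℤ⟦X⟧) = 0 ∧ U 2 (1 : ℤ⟦X⟧) = 0 ∧
    U 3 (1 : ℤ⟦X⟧) = 0 ∧ U 4 (1 : ℤ⟦X⟧) = 0 := by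
  have h (j : ℕ) (hj : j < 5) :=
    dissect_X_pow_mul_expand (R := ℤ) (NeZero.ne 5) (show 0 < 5 by norm_num) hj 1
  simp only [pow_zero, map_one, mul_one] at h
  exact ⟨h 0 (by norm_num), h 1 (by norm_num), h 2 (by norm_num), h 3 (by norm_num),
    h 4 (by norm_num)⟩

/-- Ramanujan's generating function for the partition numbers `p(5 n + 4)`. -/
theorem eta_pow_six_mul_dissect_four_inverse_eta :
    eta 1 ^ 6 * U 4 (eta 1)⁻¹ʳ = 5 * eta 5 ^ 5 := by
  have h := eta_pow_six_mul_dissect_four_mul_inverse_eta 1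
  obtain ⟨o₀, o₁, o₂, o₃, o₄⟩ := dissect_five_one
  simp only [one_mul, o₀, o₁, o₂, o₃, o₄, etaCofactor] at h
  refine mul_left_cancel₀ (pow_ne_zero 4 dissect_zero_eta_ne_zero) ?_
  linear_combination h

theorem eta_two_pow_four_mul_dissect_four_theta_sq_mul_inverse_eta :
    eta 2 ^ 4 * U 4 (theta ^ 2 * (eta 1)⁻¹ʳ) = 5 * eta 1 ^ 2 * eta 5 * eta 10 ^ 2 := by
  have h := eta_pow_six_mul_dissect_four_mul_inverse_eta (theta ^ 2)
  obtain ⟨s₀, s₁, s₂, s₃, s₄⟩ := dissect_five_theta_sq_components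
  rw [s₀, s₁, s₂, s₃, s₄] at h
  simp only [etaCofactor] at h
  have hV : V theta ^ 2 * eta 1 ^ 6 * U 4 (theta ^ 2 * (eta 1)⁻¹ʳ) =
      5 * eta 5 ^ 5 * theta ^ 4 := by
    refine mul_left_cancel₀ (pow_ne_zero 4 dissect_zero_eta_ne_zero) ?_
    linear_combination V theta ^ 2 * h + eta 5 * expand_theta_sq_mul_eq
  refine mul_left_cancel₀
    (mul_ne_zero (pow_ne_zero 4 (eta_ne_zero 5)) (pow_ne_zero 6 (eta_ne_zero 1))) ?_
  calc eta 5 ^ 4 * eta 1 ^ 6 * (eta 2 ^ 4 * U 4 (theta ^ 2 * (eta 1)⁻¹ʳ))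
      = (eta 5 ^ 2) ^ 2 * eta 2 ^ 4 * (eta 1 ^ 6 * U 4 (theta ^ 2 * (eta 1)⁻¹ʳ)) := by ring
    _ = eta 10 ^ 2 * eta 2 ^ 4 * (V theta ^ 2 * eta 1 ^ 6 * U 4 (theta ^ 2 * (eta 1)⁻¹ʳ)) := by
      rw [← expand_five_theta_mul_eta]; ring
    _ = 5 * eta 5 ^ 5 * eta 10 ^ 2 * (theta * eta 2) ^ 4 := by rw [hV]; ring
    _ = eta 5 ^ 4 * eta 1 ^ 6 * (5 * eta 1 ^ 2 * eta 5 * eta 10 ^ 2) := by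
      rw [theta_mul_eta]; ring

end EtaQuotients

section QuinticComponents

local notation "U" => dissect 5

local notation "V₂" => expand 2 two_ne_zero

theorem eta_mul_inverse_pow (k n : ℕ) [NeZero k] : (eta k * (eta k)⁻¹ʳ) ^ n = 1 := by
  rw [eta_mul_inverse, one_pow]

theorem theta_eq : theta = eta 1 ^ 2 * (eta 2)⁻¹ʳ :=
  (Ring.eq_mul_inverse_iff_mul_eq _ _ _ (isUnit_eta 2)).mpr theta_mul_eta

theorem dissect_three_inverse_eta_two :
    U 3 (eta 2)⁻¹ʳ = 5 * X * eta 10 ^ 5 * (eta 2)⁻¹ʳ ^ 6 := by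
  have h := congrArg V₂ eta_pow_six_mul_dissect_four_inverse_eta
  rw [map_mul V₂, map_mul V₂, map_pow V₂, map_pow V₂, map_ofNat, expand_eta, expand_eta] at h
  rw [show (eta 2)⁻¹ʳ = V₂ (eta 1)⁻¹ʳ from (expand_inverse_eta two_ne_zero 1).symm,
    dissect_five_expand_two (i := 4) (s := 1) (by norm_num) (by norm_num) (by norm_num),
    expand_inverse_eta]
  linear_combination X * (eta 2)⁻¹ʳ ^ 6 * h -
    X * V₂ (U 4 (eta 1)⁻¹ʳ) * eta_mul_inverse_pow 2 6

theorem dissect_four_theta_sq_mul_inverse_eta :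
    U 4 (theta ^ 2 * (eta 1)⁻¹ʳ) = 5 * eta 1 ^ 2 * eta 5 * eta 10 ^ 2 * (eta 2)⁻¹ʳ ^ 4 := by
  linear_combination (eta 2)⁻¹ʳ ^ 4 *
      eta_two_pow_four_mul_dissect_four_theta_sq_mul_inverse_eta -
    U 4 (theta ^ 2 * (eta 1)⁻¹ʳ) * eta_mul_inverse_pow 2 4

theorem dissect_five_eta_two_pow_three : U 1 (eta 2 ^ 3) = 5 * X * eta 10 ^ 3 ∧
    U 3 (eta 2 ^ 3) = 0 ∧ U 4 (eta 2 ^ 3) = 0 := by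
  obtain ⟨h₂, h₃, h₄⟩ := dissect_five_eta_pow_three
  rw [show eta 2 ^ 3 = V₂ (eta 1 ^ 3) by rw [map_pow V₂, expand_eta],
    dissect_five_expand_two (i := 3) (j := 1) (s := 1) (by norm_num) (by norm_num) (by norm_num),
    dissect_five_expand_two (i := 4) (j := 3) (s := 1) (by norm_num) (by norm_num) (by norm_num),
    dissect_five_expand_two (i := 2) (j := 4) (s := 0) (by norm_num) (by norm_num) (by norm_num),
    h₂, h₃, h₄, map_mul V₂, map_pow V₂, map_ofNat, expand_eta]
  simp only [map_zero, mul_zero, and_true]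
  ring

theorem dissect_five_eta_pow_four :
    U 0 (eta 1 ^ 4) = U 0 (eta 1) ^ 4 + 8 * X * eta 5 ^ 3 * U 2 (eta 1) ∧
    U 1 (eta 1 ^ 4) = -4 * U 0 (eta 1) ^ 3 * eta 5 + 2 * X * eta 5 ^ 2 * U 2 (eta 1) ^ 2 ∧
    U 2 (eta 1 ^ 4) = 2 * U 0 (eta 1) ^ 2 * eta 5 ^ 2 - 4 * X * eta 5 * U 2 (eta 1) ^ 3 ∧
    U 3 (eta 1 ^ 4) = 8 * U 0 (eta 1) * eta 5 ^ 3 + X * U 2 (eta 1) ^ 4 ∧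
    U 4 (eta 1 ^ 4) = -5 * eta 5 ^ 4 := by
  obtain ⟨q₀, q₁, q₂, q₃, q₄⟩ := dissect_five_eta_sq
  obtain ⟨h₀, h₁, h₂, h₃, h₄⟩ := dissect_five_mul (eta 1 ^ 2) (eta 1 ^ 2)
  have h := dissect_zero_eta_mul_dissect_two_eta
  rw [show eta 1 ^ 4 = eta 1 ^ 2 * eta 1 ^ 2 by ring, h₀, h₁, h₂, h₃, h₄, q₀, q₁, q₂, q₃, q₄]
  generalize U 0 (eta 1) = a at *
  generalize U 2 (eta 1) = c at *
  generalize eta 5 = e at *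
  refine ⟨?_, by ring, by ring, ?_, ?_⟩
  · linear_combination -4 * X * e * c * h
  · linear_combination -4 * a * e * h
  · linear_combination (2 * a * c + 6 * e ^ 2) * h

theorem dissect_three_eta_pow_eight : U 3 (eta 1 ^ 8) = -125 * X * eta 5 ^ 8 := by
  obtain ⟨q₀, q₁, q₂, q₃, q₄⟩ := dissect_five_eta_pow_four
  obtain ⟨-, -, -, h₃, -⟩ := dissect_five_mul (eta 1 ^ 4) (eta 1 ^ 4)
  have h := dissect_zero_eta_mul_dissect_two_eta
  rw [show eta 1 ^ 8 = eta 1 ^ 4 * eta 1 ^ 4 by ring, h₃, q₀, q₁, q₂, q₃, q₄]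
  generalize U 0 (eta 1) = a at *
  generalize U 2 (eta 1) = c at *
  generalize eta 5 = e at *
  linear_combination (2 * X * (a ^ 3 * c ^ 3 - a ^ 2 * c ^ 2 * e ^ 2 + a * c * e ^ 4 - e ^ 6) +
    128 * X * e ^ 6 + 32 * X * e ^ 2 * (a ^ 2 * c ^ 2 - a * c * e ^ 2 + e ^ 4) +
    8 * X * e ^ 4 * (a * c - e ^ 2)) * h

theorem dissect_one_eta_two_pow_eight :
    U 1 (eta 2 ^ 8) = -125 * X ^ 3 * eta 10 ^ 8 := by
  rw [show eta 2 ^ 8 = V₂ (eta 1 ^ 8) by rw [map_pow V₂, expand_eta],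
    dissect_five_expand_two (i := 3) (s := 1) (by norm_num) (by norm_num) (by norm_num),
    dissect_three_eta_pow_eight, map_mul V₂, map_mul V₂, map_pow V₂, map_neg V₂, map_ofNat,
    expand_X, expand_eta]
  ring

theorem dissect_three_eta_mul_eta_two : U 3 (eta 1 * eta 2) = eta 5 * eta 10 := by
  obtain ⟨u₁, u₃, u₄⟩ := dissect_five_eta
  obtain ⟨-, v₁, v₂, v₃, v₄⟩ := dissect_five_eta_two
  rw [(dissect_five_mul _ _).2.2.2.1, u₁, u₃, u₄, v₁, v₂, v₃, v₄]
  ring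

end QuinticComponents

section Congruences

theorem dvd_dissect_sub_dissect (n m j : ℕ) [n.AtLeastTwo] {f g : ℤ⟦X⟧}
    (h : (ofNat(n) : ℤ⟦X⟧) ∣ f - g) : (ofNat(n) : ℤ⟦X⟧) ∣ dissect m j f - dissect m j g := by
  obtain ⟨w, hw⟩ := h
  exact ⟨dissect m j w, by rw [← map_sub, hw, dissect_ofNat_mul]⟩

theorem natCast_dvd_of_map_eq_zero {n : ℕ} {f : ℤ⟦X⟧}
    (h : PowerSeries.map (Int.castRingHom (ZMod n)) f = 0) : (n : ℤ⟦X⟧) ∣ f := by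
  have hdvd (k : ℕ) : (n : ℤ) ∣ coeff k f := by
    rw [← ZMod.intCast_zmod_eq_zero_iff_dvd, ← eq_intCast (Int.castRingHom (ZMod n)),
      ← coeff_map, h, map_zero]
  choose w hw using hdvd
  refine ⟨PowerSeries.mk w, ?_⟩
  ext k
  rw [hw, ← map_natCast (C (R := ℤ)), coeff_C_mul, coeff_mk]

theorem prime_dvd_pow_sub_expand {p : ℕ} (hp : p.Prime) (f : ℤ⟦X⟧) :
    (p : ℤ⟦X⟧) ∣ f ^ p - expand p hp.ne_zero f := by
  have : Fact p.Prime := ⟨hp⟩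
  have frobenius (g : (ZMod p)⟦X⟧) : expand p hp.ne_zero g = g ^ p := by
    have h := MvPowerSeries.map_frobenius_expand (R := ZMod p) p hp.ne_zero (f := g)
    rwa [ZMod.frobenius_zmod, MvPowerSeries.map_id] at h
  refine natCast_dvd_of_map_eq_zero ?_
  rw [map_sub, map_pow, map_expand, frobenius, sub_self]

/-- Put `A = α⁻¹` and `B = β⁻¹`: from `A = B + 5 g A B` one expands
`β A ^ 2 = A + 5 g A ^ 2` in powers of `B`. -/
theorem dvd_mul_inverse_sq_sub {R : Type*} [CommRing R] {α β A B g : R}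
    (hα : α * A = 1) (hβ : β * B = 1) (h : β = α + 5 * g) :
    125 ∣ β * A ^ 2 - (B + 10 * g * B ^ 2 + 75 * g ^ 2 * B ^ 3) := by
  have hAB : A = B + 5 * g * A * B := by linear_combination A * B * h - A * hβ + B * hα
  have hA : A = B + 5 * g * B ^ 2 + 25 * g ^ 2 * B ^ 3 + 125 * (g ^ 3 * B ^ 3 * A) := by
    linear_combination (1 + 5 * g * B + 25 * g ^ 2 * B ^ 2) * hAB
  have hexpand : β * A ^ 2 = A + 5 * g * A ^ 2 := by linear_combination A ^ 2 * h + A * hα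
  set p := B + 5 * g * B ^ 2 + 25 * g ^ 2 * B ^ 3 with hp
  generalize g ^ 3 * B ^ 3 * A = v at hA
  refine ⟨v + 5 * g * (2 * p * v + 125 * v ^ 2) + 3 * g ^ 3 * B ^ 4 + 10 * g ^ 4 * B ^ 5 +
    25 * g ^ 5 * B ^ 6, ?_⟩
  rw [hexpand, hA, hp]
  ring

theorem five_dvd_eta_pow_five_sub (k : ℕ) [NeZero k] : 5 ∣ eta k ^ 5 - eta (5 * k) := by
  have h := prime_dvd_pow_sub_expand (p := 5) (by norm_num) (eta k)
  rwa [expand_eta, Nat.cast_ofNat] at h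

theorem five_dvd_inverse_eta_pow_five_sub (k : ℕ) [NeZero k] :
    5 ∣ (eta k)⁻¹ʳ ^ 5 - (eta (5 * k))⁻¹ʳ := by
  have h := prime_dvd_pow_sub_expand (p := 5) (by norm_num) (eta k)⁻¹ʳ
  rwa [expand_inverse_eta, Nat.cast_ofNat] at h

/-- The eta quotient `g` for which `η₂⁵ / η₁₀ = η₁⁵ / η₅ + 5 g`. -/
noncomputable def quinticGap : ℤ⟦X⟧ := X * eta 1 ^ 2 * eta 2 * eta 10 ^ 3 * (eta 5)⁻¹ʳ ^ 2

theorem eta_two_pow_five_mul_inverse :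
    eta 2 ^ 5 * (eta 10)⁻¹ʳ = eta 1 ^ 5 * (eta 5)⁻¹ʳ + 5 * quinticGap := by
  rw [quinticGap]
  linear_combination (eta 10)⁻¹ʳ * (eta 5)⁻¹ʳ ^ 2 * eta_two_pow_five_mul -
    eta 2 ^ 5 * (eta 10)⁻¹ʳ * eta_mul_inverse_pow 5 2 +
    eta 1 ^ 5 * (eta 5)⁻¹ʳ * (eta 10 * (eta 10)⁻¹ʳ) * eta_mul_inverse 5 +
    (eta 1 ^ 5 * (eta 5)⁻¹ʳ + 5 * X * eta 1 ^ 2 * eta 2 * eta 10 ^ 3 * (eta 5)⁻¹ʳ ^ 2) *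
      eta_mul_inverse 10

/-- The eta quotient `κ` for which the odd part of `φ` is `κ β / α²`, where `α = η₁⁵ / η₅` and
`β = η₂⁵ / η₁₀`. -/
noncomputable def oddPartFactor : ℤ⟦X⟧ := eta 10 * (eta 5)⁻¹ʳ ^ 2 * eta 1 ^ 3 * eta 2 ^ 3

theorem dissect_phi_eq_oddPartFactor_mul : dissect 2 1 phi =
    oddPartFactor * (eta 2 ^ 5 * (eta 10)⁻¹ʳ * (eta 5 * (eta 1)⁻¹ʳ ^ 5) ^ 2) := by
  have hphi : dissect 2 1 phi = eta 2 ^ 8 * (eta 1)⁻¹ʳ ^ 7 := by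
    linear_combination (eta 1)⁻¹ʳ ^ 7 * eta_pow_mul_dissect_phi -
      dissect 2 1 phi * eta_mul_inverse_pow 1 7
  rw [hphi, oddPartFactor]
  linear_combination -(eta 2 ^ 8 * (eta 1)⁻¹ʳ ^ 7) *
    (eta 10 * (eta 10)⁻¹ʳ * (eta 5 * (eta 5)⁻¹ʳ) ^ 2 * eta_mul_inverse_pow 1 3 +
      eta 10 * (eta 10)⁻¹ʳ * eta_mul_inverse_pow 5 2 + eta_mul_inverse 10)

theorem oddPartFactor_mul_inverse : oddPartFactor * (eta 10 * (eta 2)⁻¹ʳ ^ 5) =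
    eta 10 ^ 2 * (eta 5)⁻¹ʳ ^ 2 * (theta ^ 2 * (eta 1)⁻¹ʳ) := by
  rw [oddPartFactor, theta_eq]
  linear_combination eta 10 ^ 2 * (eta 5)⁻¹ʳ ^ 2 * eta 1 ^ 3 * (eta 2)⁻¹ʳ ^ 2 *
    (eta_mul_inverse_pow 2 3 - eta_mul_inverse 1)

theorem dvd_oddPartFactor_mul_quinticGap_sub :
    25 ∣ oddPartFactor * quinticGap * (eta 10 * (eta 2)⁻¹ʳ ^ 5) ^ 2 -
      (eta 10 ^ 5 * (eta 5)⁻¹ʳ ^ 3 * (X * (eta 2)⁻¹ʳ) -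
        5 * X ^ 2 * eta 10 ^ 8 * (eta 5)⁻¹ʳ ^ 5 * eta 1 ^ 2) := by
  obtain ⟨w, hw⟩ := five_dvd_inverse_eta_pow_five_sub 2
  rw [show 5 * 2 = 10 from rfl] at hw
  have hα : eta 1 ^ 5 =
      eta 2 ^ 5 * eta 5 * (eta 10)⁻¹ʳ - 5 * X * eta 1 ^ 2 * eta 2 * eta 10 ^ 3 * (eta 5)⁻¹ʳ := by
    have h := eta_two_pow_five_mul_inverse
    rw [quinticGap] at h
    linear_combination -eta 5 * h -
      (eta 1 ^ 5 + 5 * X * eta 1 ^ 2 * eta 2 * eta 10 ^ 3 * (eta 5)⁻¹ʳ) * eta_mul_inverse 5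
  refine ⟨-(X ^ 2 * eta 10 ^ 9 * (eta 5)⁻¹ʳ ^ 5 * eta 1 ^ 2 * w), ?_⟩
  rw [oddPartFactor, quinticGap]
  linear_combination X * eta 10 ^ 6 * (eta 5)⁻¹ʳ ^ 4 * eta 1 ^ 5 * (eta 2)⁻¹ʳ ^ 6 *
      eta_mul_inverse_pow 2 4 + X * eta 10 ^ 6 * (eta 5)⁻¹ʳ ^ 4 * (eta 2)⁻¹ʳ ^ 6 * hα +
    X * eta 10 ^ 5 * (eta 5)⁻¹ʳ ^ 3 * (eta 2)⁻¹ʳ *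
      (eta 10 * (eta 10)⁻¹ʳ * (eta 5 * (eta 5)⁻¹ʳ) * eta_mul_inverse_pow 2 5 +
        eta 10 * (eta 10)⁻¹ʳ * eta_mul_inverse 5 + eta_mul_inverse 10) -
    5 * X ^ 2 * eta 10 ^ 9 * (eta 5)⁻¹ʳ ^ 5 * eta 1 ^ 2 *
      ((eta 2)⁻¹ʳ ^ 5 * eta_mul_inverse 2 + hw) -
    5 * X ^ 2 * eta 10 ^ 8 * (eta 5)⁻¹ʳ ^ 5 * eta 1 ^ 2 * eta_mul_inverse 10

theorem dvd_oddPartFactor_mul_quinticGap_sq_sub :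
    5 ∣ oddPartFactor * quinticGap ^ 2 * (eta 10 * (eta 2)⁻¹ʳ ^ 5) ^ 3 -
      X ^ 2 * eta 10 ^ 8 * (eta 5)⁻¹ʳ ^ 5 * eta 1 ^ 2 := by
  obtain ⟨w₁, hw₁⟩ := five_dvd_eta_pow_five_sub 1
  obtain ⟨w₂, hw₂⟩ := five_dvd_inverse_eta_pow_five_sub 2
  rw [show 5 * 1 = 5 from rfl] at hw₁
  rw [show 5 * 2 = 10 from rfl] at hw₂
  rw [oddPartFactor, quinticGap]
  refine ⟨X ^ 2 * eta 10 ^ 10 * (eta 5)⁻¹ʳ ^ 6 * eta 1 ^ 2 *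
    (w₁ * (eta 2)⁻¹ʳ ^ 10 + eta 5 * w₂ * ((eta 2)⁻¹ʳ ^ 5 + (eta 10)⁻¹ʳ)), ?_⟩
  linear_combination X ^ 2 * eta 10 ^ 10 * (eta 5)⁻¹ʳ ^ 6 * eta 1 ^ 2 *
      (eta 1 ^ 5 * (eta 2)⁻¹ʳ ^ 10 * eta_mul_inverse_pow 2 5 + (eta 2)⁻¹ʳ ^ 10 * hw₁ +
        eta 5 * ((eta 2)⁻¹ʳ ^ 5 + (eta 10)⁻¹ʳ) * hw₂) +
    X ^ 2 * eta 10 ^ 8 * (eta 5)⁻¹ʳ ^ 5 * eta 1 ^ 2 *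
      (eta 5 * (eta 5)⁻¹ʳ * eta_mul_inverse_pow 10 2 + eta_mul_inverse 5)

theorem dvd_dissect_phi_sub : 125 ∣ dissect 2 1 phi -
    (eta 10 ^ 2 * (eta 5)⁻¹ʳ ^ 2 * (theta ^ 2 * (eta 1)⁻¹ʳ) +
      10 * (eta 10 ^ 5 * (eta 5)⁻¹ʳ ^ 3 * (X * (eta 2)⁻¹ʳ)) +
      25 * (eta 10 ^ 8 * (eta 5)⁻¹ʳ ^ 5 * (X * (X * eta 1 ^ 2)))) := by
  have hα : eta 1 ^ 5 * (eta 5)⁻¹ʳ * (eta 5 * (eta 1)⁻¹ʳ ^ 5) = 1 := by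
    linear_combination eta 5 * (eta 5)⁻¹ʳ * eta_mul_inverse_pow 1 5 + eta_mul_inverse 5
  have hβ : eta 2 ^ 5 * (eta 10)⁻¹ʳ * (eta 10 * (eta 2)⁻¹ʳ ^ 5) = 1 := by
    linear_combination eta 10 * (eta 10)⁻¹ʳ * eta_mul_inverse_pow 2 5 + eta_mul_inverse 10
  obtain ⟨w, hw⟩ := dvd_mul_inverse_sq_sub hα hβ eta_two_pow_five_mul_inverse
  obtain ⟨w₂, hw₂⟩ := dvd_oddPartFactor_mul_quinticGap_sub
  obtain ⟨w₃, hw₃⟩ := dvd_oddPartFactor_mul_quinticGap_sq_sub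
  rw [dissect_phi_eq_oddPartFactor_mul]
  refine ⟨oddPartFactor * w + 2 * w₂ + 3 * w₃, ?_⟩
  linear_combination oddPartFactor * hw + oddPartFactor_mul_inverse + 10 * hw₂ + 75 * hw₃

end Congruences

section IteratedDissection

local notation "U" => dissect 5

local notation "V" => expand 5 (NeZero.ne 5)

theorem dvd_dissect_four_dissect_phi_sub : 125 ∣ U 4 (dissect 2 1 phi) -
    (5 * (eta 5 * eta 10 ^ 2 * (eta 2)⁻¹ʳ ^ 2) + 50 * (eta 10 ^ 5 * (eta 5)⁻¹ʳ * (X * theta)) -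
      25 * (eta 5 * eta 2 ^ 8)) := by
  obtain ⟨w₀, hw₀⟩ := dvd_dissect_sub_dissect 125 5 4 dvd_dissect_phi_sub
  obtain ⟨w₁, hw₁⟩ := five_dvd_inverse_eta_pow_five_sub 1
  have hV (f g : ℤ⟦X⟧) := dissect_expand_mul (NeZero.ne 5) (show 4 < 5 by norm_num) f g
  have k₁ := hV (eta 2 ^ 2 * (eta 1)⁻¹ʳ ^ 2) (theta ^ 2 * (eta 1)⁻¹ʳ)
  have k₂ := hV (eta 2 ^ 5 * (eta 1)⁻¹ʳ ^ 3) (X * (eta 2)⁻¹ʳ)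
  have k₃ := hV (eta 2 ^ 8 * (eta 1)⁻¹ʳ ^ 5) (X * (X * eta 1 ^ 2))
  simp only [map_mul V, map_pow V, expand_eta, expand_inverse_eta, Nat.reduceMul] at k₁ k₂ k₃
  rw [map_add, map_add, dissect_ofNat_mul, dissect_ofNat_mul, k₁, k₂, k₃,
    (dissect_five_X_mul _).2.2.2.2, (dissect_five_X_mul _).2.2.2.2,
    (dissect_five_X_mul _).2.2.2.1, dissect_five_eta_sq.2.2.1, dissect_three_inverse_eta_two,
    dissect_four_theta_sq_mul_inverse_eta] at hw₀
  have hθ : (eta 1)⁻¹ʳ ^ 3 * (eta 2)⁻¹ʳ = theta * (eta 1)⁻¹ʳ ^ 5 := by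
    linear_combination -(eta 1)⁻¹ʳ ^ 5 * theta_eq -
      (eta 1)⁻¹ʳ ^ 3 * (eta 2)⁻¹ʳ * eta_mul_inverse_pow 1 2
  refine ⟨w₀ + 2 * X * eta 10 ^ 5 * theta * w₁ - eta 2 ^ 8 * eta 5 ^ 2 * w₁, ?_⟩
  linear_combination hw₀ + 5 * eta 5 * eta 10 ^ 2 * (eta 2)⁻¹ʳ ^ 2 *
      ((eta 2 * (eta 2)⁻¹ʳ) ^ 2 * eta_mul_inverse_pow 1 2 + eta_mul_inverse_pow 2 2) +
    50 * X * eta 10 ^ 5 * (eta 1)⁻¹ʳ ^ 3 * (eta 2)⁻¹ʳ * eta_mul_inverse_pow 2 5 +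
    50 * X * eta 10 ^ 5 * hθ + 50 * X * eta 10 ^ 5 * theta * hw₁ -
    25 * eta 2 ^ 8 * eta 5 ^ 2 * hw₁ - 25 * eta 2 ^ 8 * eta 5 * eta_mul_inverse 5

theorem dvd_dissect_one_inverse_eta_two_sq_sub :
    25 ∣ U 1 ((eta 2)⁻¹ʳ ^ 2) - 10 * (X * eta 10 ^ 3 * (eta 2)⁻¹ʳ) := by
  have hlinear : 25 ∣ (eta 2)⁻¹ʳ ^ 2 -
      (2 * ((eta 10)⁻¹ʳ * eta 2 ^ 3) - (eta 10)⁻¹ʳ ^ 2 * eta 2 ^ 8) := by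
    obtain ⟨w, hw⟩ := five_dvd_eta_pow_five_sub 2
    have hβ : eta 2 ^ 5 * (eta 10)⁻¹ʳ - 1 = 5 * w * (eta 10)⁻¹ʳ := by
      linear_combination (eta 10)⁻¹ʳ * hw + eta_mul_inverse 10
    refine ⟨w ^ 2 * (eta 10)⁻¹ʳ ^ 2 * (eta 2)⁻¹ʳ ^ 2, ?_⟩
    linear_combination (eta 2)⁻¹ʳ ^ 2 *
        (eta 2 ^ 5 * (eta 10)⁻¹ʳ - 1 + 5 * w * (eta 10)⁻¹ʳ) * hβ +
      (2 * (eta 10)⁻¹ʳ * eta 2 ^ 3 - (eta 10)⁻¹ʳ ^ 2 * eta 2 ^ 8) * eta_mul_inverse_pow 2 2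
  obtain ⟨w, hw⟩ := dvd_dissect_sub_dissect 25 5 1 hlinear
  have hV (f g : ℤ⟦X⟧) := dissect_expand_mul (NeZero.ne 5) (show 1 < 5 by norm_num) f g
  have k₁ := hV (eta 2)⁻¹ʳ (eta 2 ^ 3)
  have k₂ := hV ((eta 2)⁻¹ʳ ^ 2) (eta 2 ^ 8)
  simp only [map_pow V, expand_inverse_eta, Nat.reduceMul] at k₁ k₂
  rw [map_sub, dissect_ofNat_mul, k₁, k₂, dissect_one_eta_two_pow_eight,
    dissect_five_eta_two_pow_three.1] at hw
  exact ⟨w + 5 * X ^ 3 * eta 10 ^ 8 * (eta 2)⁻¹ʳ ^ 2, by linear_combination hw⟩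

theorem dvd_dissect_one_dissect_four_dissect_phi_sub : 125 ∣ U 1 (U 4 (dissect 2 1 phi)) -
    (50 * (eta 10 ^ 3 * (X * (eta 1 * eta 2))) +
      50 * (eta 2 ^ 5 * V theta * (eta 1)⁻¹ʳ)) := by
  obtain ⟨w₀, hw₀⟩ := dvd_dissect_sub_dissect 125 5 1 dvd_dissect_four_dissect_phi_sub
  obtain ⟨w₁, hw₁⟩ := dvd_dissect_one_inverse_eta_two_sq_sub
  have hV (f g : ℤ⟦X⟧) := dissect_expand_mul (NeZero.ne 5) (show 1 < 5 by norm_num) f g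
  have k₁ := hV (eta 1 * eta 2 ^ 2) ((eta 2)⁻¹ʳ ^ 2)
  have k₂ := hV (eta 2 ^ 5 * (eta 1)⁻¹ʳ) (X * theta)
  have k₃ := hV (eta 1) (eta 2 ^ 8)
  simp only [map_mul V, map_pow V, expand_eta, expand_inverse_eta, Nat.reduceMul] at k₁ k₂ k₃
  rw [map_sub, map_add, dissect_ofNat_mul, dissect_ofNat_mul, dissect_ofNat_mul, k₁, k₂, k₃,
    (dissect_five_X_mul _).2.1, dissect_five_theta.1, dissect_one_eta_two_pow_eight] at hw₀
  refine ⟨w₀ + eta 1 * eta 2 ^ 2 * w₁ + 25 * eta 1 * X ^ 3 * eta 10 ^ 8, ?_⟩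
  linear_combination hw₀ + 5 * eta 1 * eta 2 ^ 2 * hw₁ +
    50 * eta 1 * eta 2 * X * eta 10 ^ 3 * eta_mul_inverse 2

theorem dvd_dissect_four_dissect_one_dissect_four_dissect_phi_sub :
    125 ∣ U 4 (U 1 (U 4 (dissect 2 1 phi))) - 50 * (eta 5 * eta 10 * eta 2 ^ 3) := by
  have hcongr : 125 ∣ U 1 (U 4 (dissect 2 1 phi)) -
      (50 * (eta 10 ^ 3 * (X * (eta 1 * eta 2))) +
        50 * (eta 10 * V theta * (eta 5)⁻¹ʳ * eta 1 ^ 4)) := by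
    obtain ⟨w₀, hw₀⟩ := dvd_dissect_one_dissect_four_dissect_phi_sub
    obtain ⟨w₁, hw₁⟩ := five_dvd_inverse_eta_pow_five_sub 1
    obtain ⟨w₂, hw₂⟩ := five_dvd_eta_pow_five_sub 2
    refine ⟨w₀ + 2 * (eta 10 * V theta * eta 1 ^ 4 * w₁ + w₂ * V theta * (eta 1)⁻¹ʳ), ?_⟩
    linear_combination hw₀ + 50 * (V theta * (eta 1)⁻¹ʳ * hw₂ +
      V theta * eta 10 * eta 1 ^ 4 * hw₁ -
      eta 10 * V theta * (eta 1)⁻¹ʳ * eta_mul_inverse_pow 1 4)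
  obtain ⟨w, hw⟩ := dvd_dissect_sub_dissect 125 5 4 hcongr
  have hV (f g : ℤ⟦X⟧) := dissect_expand_mul (NeZero.ne 5) (show 4 < 5 by norm_num) f g
  have k₁ := hV (eta 2 ^ 3) (X * (eta 1 * eta 2))
  have k₂ := hV (eta 2 * theta * (eta 1)⁻¹ʳ) (eta 1 ^ 4)
  simp only [map_mul V, map_pow V, expand_eta, expand_inverse_eta, Nat.reduceMul] at k₁ k₂
  rw [map_add, dissect_ofNat_mul, dissect_ofNat_mul, k₁, k₂, (dissect_five_X_mul _).2.2.2.2,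
    dissect_three_eta_mul_eta_two, dissect_five_eta_pow_four.2.2.2.2] at hw
  exact ⟨w - 2 * (eta 2 * theta * (eta 1)⁻¹ʳ * eta 5 ^ 4), by linear_combination hw⟩

theorem dvd_iterated_dissect_phi {r : ℕ}
    (hr : r = 1 ∨ r = 3 ∨ r = 4) : 125 ∣ U r (U 4 (U 1 (U 4 (dissect 2 1 phi)))) := by
  have hcongr := dvd_dissect_sub_dissect 125 5 r
    dvd_dissect_four_dissect_one_dissect_four_dissect_phi_sub
  refine (dvd_iff_dvd_of_dvd_sub hcongr).mpr ?_
  have hV := dissect_expand_mul (NeZero.ne 5) (show r < 5 by omega) (eta 1 * eta 2) (eta 2 ^ 3)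
  simp only [map_mul V, expand_eta, Nat.reduceMul] at hV
  rw [dissect_ofNat_mul, hV]
  obtain ⟨u₁, u₃, u₄⟩ := dissect_five_eta_two_pow_three
  rcases hr with rfl | rfl | rfl
  · exact ⟨2 * (eta 1 * eta 2 * (X * eta 10 ^ 3)), by rw [u₁]; ring⟩
  · simp only [u₃, mul_zero, dvd_zero]
  · simp only [u₄, mul_zero, dvd_zero]

end IteratedDissection

end RamanujanPhi

theorem corollary3p4 (n r : ℕ) (hr : r = 1 ∨ r = 3 ∨ r = 4) :
    RamanujanPhi.a (1250 * n + 250 * r + 219) ≡ 0 [ZMOD 125] := by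
  obtain ⟨f, hf⟩ := RamanujanPhi.dvd_iterated_dissect_phi hr
  have hcoeff := congrArg (PowerSeries.coeff n) hf
  rw [← map_ofNat (PowerSeries.C (R := ℤ)), PowerSeries.coeff_C_mul] at hcoeff
  simp only [RamanujanPhi.coeff_dissect] at hcoeff
  refine Int.modEq_zero_iff_dvd.mpr ⟨PowerSeries.coeff n f, ?_⟩
  rw [← hcoeff, RamanujanPhi.a]
  congr 2
  ring
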